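/- **Setting.** Let $T:[0,1]\to[0,1]$ satisfy (A1) (a) $T$ is continuous and attains its maximum at a unique point $\mathfrak c$, with $\Delta:=T(\mathfrak c)<1$; (b) there is an interval $[d_1,d_2]\subset[0,1]$, $d_1<d_2$, with $T([d_1,d_2])\subset[d_1,d_2]$, on which every power $T^t$, $t\ge1$, is topologically transitive, and which attracts Lebesgue-almost every initial condition: $\operatorname{dist}(T^t x,[d_1,d_2])\to0$ for a.e. $x\in[0,1]$; (c) $T$ has exactly one invariant Borel probability measure that is absolutely continuous with respect to Lebesgue measure. Put $\Gamma=1-\Delta$ and $I=[-\Gamma,1]$, and extend $T$ to $[-\Gamma,0]$ continuously and decreasingly with $T(-\Gamma)<\Delta$. Fix the noise intensity $n$. Let $a>0$ and let $\sigma=\sigma_n:I\to[0,\infty)$ be measurable, differentiable and positive on $(0,1)$, with $T(x)-a\sigma(x)>0$ for $x\in(0,1-\Gamma/2]$, and such that one of the following holds: - $T(0)=0=\sigma(0)$, $a\sigma\le\Gamma/2$ on $I$, and for some $\varepsilon_n>0$ one has $T(x)-a\sigma(x)>x$ on $(0,\varepsilon_n)$ and $T(x)-a\sigma(x)>\varepsilon_n$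 on $(\varepsilon_n,1-\Gamma/2)$; - $T(0)=q>0$ and $a\sigma\le\min\{\Gamma/2,\;q/2,\;\tfrac12T(1-\Gamma/2)\}$ on $I$. Let $\theta$ be the probability measure on $\mathbb R$ with density $g_a(y)=c_a\chi_a(y)e^{-y^2/2}$, where $\chi_a\ge0$ is $C^\infty$ and positive exactly on $(-a,a)$ and $c_a$ is the normalizing constant. Put $T_\eta(x)=T(x)+\sigma(x)\eta$, $P_x(A)=\theta\{\eta:T_\eta(x)\in A\}$ and $(\mathcal Uf)(x)=\int f(T_\eta(x))\,d\theta(\eta)$. Let $\mu_n=h_n\,dx$ be a stationary probability measure on $I$, i.e. $\int P_x(A)\,d\mu_n(x)=\mu_n(A)$ for all Borel $A$, with density $h_n\in BV(I)$. Here $BV(I)$ consists of the functions in $L^1(I)$ of finite (essential) total variation, and $\|f\|_{BV}=|f|_{TV}+\|f\|_1$. Let $g\in BV(I)$ with $\int g\,d\mu_n=0$, and on the probability space with measure $\widetilde{\mathbb P}_n=\theta^{\otimes\mathbb N}\otimes\mu_n$ let $$S_t((\eta_k)_{k\ge1},x)=\sum_{k=0}^{t-1}g\big(T_{\eta_k}\circ\cdots\circ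 T_{\eta_1}(x)\big).$$ **Theorem.** (e1) The limit $\iota^2:=\lim_{t\to\infty}\frac1t\mathbb E_{\widetilde{\mathbb P}_n}(S_t^2)$ exists (with $\iota\ge0$), the series below converges absolutely, and $$\iota^2=\int g^2\,d\mu_n+2\sum_{t=1}^\infty\int g\,(\mathcal U^tg)\,d\mu_n .$$ Suppose moreover that $\iota>0$. Then: (e2) $S_t/\sqrt t$ converges in law to $\mathcal N(0,\iota^2)$ under $\widetilde{\mathbb P}_n$. (e3) There is a non-negative function $\mathcal R:\mathbb R\to\mathbb R$, continuous, strictly convex and vanishing only at $0$, such that for every sufficiently small $\varepsilon>0$ $$\lim_{t\to\infty}\frac1t\log\widetilde{\mathbb P}_n(S_t>t\varepsilon)=-\mathcal R(\varepsilon).$$ (e4) There is $D>0$ such that for all $t\ge1$ $$\sup_{r\in\mathbb R}\Big|\widetilde{\mathbb P}_n\Big(\frac{S_t}{\sqrt t}\le r\Big)-\frac1{\iota\sqrt{2\pi}}\int_{-\infty}^re^{-u^2/(2\iota^2)}\,du\Big|\le\frac{D\,\|h_n\|_{BV}}{\sqrt t}.$$ -/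

import Mathlib

open MeasureTheory ProbabilityTheory Filter Topology Set

noncomputable section

/-! ### Functions of bounded variation, as classes modulo null sets -/

/-- Essential variation of `f` on `s`: the infimum of the pointwise variations over all functions
that agree with `f` almost everywhere on `s`. -/
def essVariationOn (f : ℝ → ℝ) (s : Set ℝ) : ENNReal :=
  ⨅ (u : ℝ → ℝ) (_ : u =ᵐ[volume.restrict s] f), eVariationOn u s

/-- `f ∈ BV(s)`: `f` is integrable on `s` and has finite essential variation there. -/
structure MemBV (f : ℝ → ℝ) (s : Set ℝ) : Prop where
  integrableOn : IntegrableOn f s volume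
  variation_ne_top : essVariationOn f s ≠ ⊤

/-- `‖f‖_BV = |f|_TV + ‖f‖₁` on `s`. -/
def bvNorm (f : ℝ → ℝ) (s : Set ℝ) : ℝ :=
  (essVariationOn f s).toReal + ∫ x in s, |f x|

/-! ### The deterministic map -/

/-- Topological transitivity of `f` on the subspace `s` (used for `s` invariant under `f`). -/
def TopTransitiveOn (f : ℝ → ℝ) (s : Set ℝ) : Prop :=
  ∀ U V : Set ℝ, IsOpen U → IsOpen V → (U ∩ s).Nonempty → (V ∩ s).Nonempty →
    ∃ k : ℕ, ∃ x ∈ V ∩ s, f^[k] x ∈ U ∩ s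

/-- The assumptions on the unperturbed map `T` of `[0,1]`, with maximum point `c` and transitive
interval `[d₁, d₂]`. -/
structure MapAssumption (T : ℝ → ℝ) (c d₁ d₂ : ℝ) : Prop where
  mapsTo : MapsTo T (Icc 0 1) (Icc 0 1)
  continuousOn : ContinuousOn T (Icc 0 1)
  c_mem : c ∈ Icc (0 : ℝ) 1
  unique_max : ∀ x ∈ Icc (0 : ℝ) 1, x ≠ c → T x < T c
  max_lt_one : T c < 1
  d_lt : d₁ < d₂
  core_subset : Icc d₁ d₂ ⊆ Icc 0 1
  core_invariant : MapsTo T (Icc d₁ d₂) (Icc d₁ d₂)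
  core_transitive : ∀ t : ℕ, 1 ≤ t → TopTransitiveOn (T^[t]) (Icc d₁ d₂)
  /-- `[d₁, d₂]` is the only transitive component: it attracts almost every initial condition. -/
  core_attracting : ∀ᵐ x ∂(volume.restrict (Icc (0 : ℝ) 1)),
    Tendsto (fun t : ℕ => Metric.infDist (T^[t] x) (Icc d₁ d₂)) atTop (𝓝 0)
  unique_acip : ∃! ν : Measure ℝ, IsProbabilityMeasure ν ∧ ν (Icc 0 1)ᶜ = 0 ∧ ν ≪ volume ∧
    ν.map T = ν

/-- The gap `Γ = 1 - Δ`, where `Δ = T c` is the maximum of `T`. -/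
def gap (T : ℝ → ℝ) (c : ℝ) : ℝ := 1 - T c

/-- The enlarged state space `[-Γ, 1]`. -/
def stateSpace (T : ℝ → ℝ) (c : ℝ) : Set ℝ := Icc (-gap T c) 1

/-- The extension of `T` to `[-Γ, 0]`: continuous, decreasing and with `T (-Γ) < Δ`.
(Measurability concerns only the irrelevant values outside `[-Γ, 1]`.) -/
structure ExtensionAssumption (T : ℝ → ℝ) (c : ℝ) : Prop where
  measurable : Measurable T
  continuousOn : ContinuousOn T (Icc (-gap T c) 0)
  antitoneOn : AntitoneOn T (Icc (-gap T c) 0)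
  left_lt : T (-gap T c) < T c

/-! ### The noise -/

/-- The variance-like function `σ`, at a fixed noise intensity, and the noise amplitude `a`. The
last field distinguishes the cases `T 0 = 0` and `T 0 = q > 0`; a bound
`a ≤ (1 / σ_max) * B` is written as `a * σ x ≤ B` for all `x`. -/
structure NoiseAssumption (T : ℝ → ℝ) (c : ℝ) (σ : ℝ → ℝ) (a : ℝ) : Prop where
  a_pos : 0 < a
  measurable : Measurable σ
  nonneg : ∀ x ∈ stateSpace T c, 0 ≤ σ x
  pos : ∀ x ∈ Ioo (0 : ℝ) 1, 0 < σ x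
  differentiableOn : DifferentiableOn ℝ σ (Ioo 0 1)
  /-- When `T 0 > 0` and `T` is increasing on `[0, c]` and decreasing on `[c, 1]`, this is a
  consequence of the bound on `a` in the second case below. -/
  lower_pos : ∀ x ∈ Ioc 0 (1 - gap T c / 2), 0 < T x - a * σ x
  cases :
    (T 0 = 0 ∧ σ 0 = 0 ∧ (∀ x ∈ stateSpace T c, a * σ x ≤ gap T c / 2) ∧
      ∃ ε : ℝ, 0 < ε ∧ (∀ x ∈ Ioo 0 ε, x < T x - a * σ x) ∧
        ∀ x ∈ Ioo ε (1 - gap T c / 2), ε < T x - a * σ x) ∨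
    (0 < T 0 ∧ ∀ x ∈ stateSpace T c,
      a * σ x ≤ min (gap T c / 2) (min (T 0 / 2) (T (1 - gap T c / 2) / 2)))

/-- `χ` is a smooth bump function on `[-a, a]`: nonnegative, and positive exactly on `(-a, a)`. -/
structure BumpAssumption (χ : ℝ → ℝ) (a : ℝ) : Prop where
  contDiff : ContDiff ℝ (⊤ : ℕ∞) χ
  nonneg : ∀ y, 0 ≤ χ y
  support_eq : Function.support χ = Ioo (-a) a

/-! ### The random system -/

/-- A map perturbed by heteroscedastic noise: the map `T` with its distinguished points, the
function `σ`, the amplitude `a` and the bump function `χ` of the noise density. -/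
structure RandomSystem where
  T : ℝ → ℝ
  c : ℝ
  d₁ : ℝ
  d₂ : ℝ
  σ : ℝ → ℝ
  a : ℝ
  χ : ℝ → ℝ
  map_assumption : MapAssumption T c d₁ d₂
  extension_assumption : ExtensionAssumption T c
  noise_assumption : NoiseAssumption T c σ a
  bump_assumption : BumpAssumption χ a

namespace RandomSystem

variable (S : RandomSystem)

/-- The state space `[-Γ, 1]`. -/
def space : Set ℝ := stateSpace S.T S.c

/-- The normalizing constant `c_a`. -/
def normConst : ℝ := (∫ y, S.χ y * Real.exp (-y ^ 2 / 2))⁻¹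

/-- The noise density `g_a(y) = c_a χ(y) exp(-y²/2)`. -/
def noiseDensity (y : ℝ) : ℝ := S.normConst * S.χ y * Real.exp (-y ^ 2 / 2)

/-- The noise law `θ = g_a(η) dη`. -/
def θ : Measure ℝ := volume.withDensity fun y => ENNReal.ofReal (S.noiseDensity y)

/-- The random map `T_η(x) = T x + σ x * η`. -/
def randomMap (η x : ℝ) : ℝ := S.T x + S.σ x * η

/-- The transition probability `P_x(A)`. -/
def transition (x : ℝ) (A : Set ℝ) : ENNReal := S.θ {η | S.randomMap η x ∈ A}

/-- `μ` is a fixed point of the Markov operator: `∫ P_x(A) dμ(x) = μ(A)` for all Borel `A`. -/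
def IsStationary (μ : Measure ℝ) : Prop :=
  ∀ A : Set ℝ, MeasurableSet A → ∫⁻ x, S.transition x A ∂μ = μ A

/-- `μ` is the measure on `[-Γ, 1]` with density `h ∈ BV`, `h ≥ 0`. -/
structure HasBVDensity (μ : Measure ℝ) (h : ℝ → ℝ) : Prop where
  memBV : MemBV h S.space
  nonneg : ∀ x, 0 ≤ h x
  eq_withDensity : μ = (volume.restrict S.space).withDensity fun x => ENNReal.ofReal (h x)

/-- The adjoint operator `(U f)(x) = ∫ f(T_η(x)) dθ(η)`. -/
def adjointOp (f : ℝ → ℝ) (x : ℝ) : ℝ := ∫ η, f (S.randomMap η x) ∂S.θ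

/-- The random orbit `T_{η_k} ∘ ⋯ ∘ T_{η_1} (x)`, where `η_{k+1}` is `ω k`. -/
def orbit (ω : ℕ → ℝ) (x : ℝ) : ℕ → ℝ
  | 0 => x
  | k + 1 => S.randomMap (ω k) (orbit ω x k)

/-- The Birkhoff sum `S_t = ∑_{k<t} g(T_{η_k} ∘ ⋯ ∘ T_{η_1} (x))`. -/
def birkhoff (g : ℝ → ℝ) (t : ℕ) (p : (ℕ → ℝ) × ℝ) : ℝ :=
  ∑ k ∈ Finset.range t, g (S.orbit p.1 p.2 k)

/-- The probability `θ^{⊗ℕ} ⊗ μ`. -/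
def pathMeasure (μ : Measure ℝ) : Measure ((ℕ → ℝ) × ℝ) :=
  (Measure.infinitePi fun _ : ℕ => S.θ).prod μ

lemma continuous_weight : Continuous fun y => S.χ y * Real.exp (-y ^ 2 / 2) :=
  S.bump_assumption.contDiff.continuous.mul (by fun_prop)

lemma weight_nonneg (y : ℝ) : 0 ≤ S.χ y * Real.exp (-y ^ 2 / 2) :=
  mul_nonneg (S.bump_assumption.nonneg y) (Real.exp_pos _).le

lemma hasCompactSupport_weight : HasCompactSupport fun y => S.χ y * Real.exp (-y ^ 2 / 2) := by
  apply HasCompactSupport.mul_right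
  refine HasCompactSupport.of_support_subset_isCompact (isCompact_Icc (a := -S.a) (b := S.a)) ?_
  rw [S.bump_assumption.support_eq]
  exact Ioo_subset_Icc_self

lemma integrable_weight : Integrable fun y => S.χ y * Real.exp (-y ^ 2 / 2) :=
  S.continuous_weight.integrable_of_hasCompactSupport S.hasCompactSupport_weight

lemma weight_integral_pos : 0 < ∫ y, S.χ y * Real.exp (-y ^ 2 / 2) := by
  apply integral_pos_of_integrable_nonneg_nonzero S.continuous_weight S.integrable_weight
    S.weight_nonneg (x := 0)
  have h0 : (0 : ℝ) ∈ Function.support S.χ := by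
    rw [S.bump_assumption.support_eq]
    exact ⟨by linarith [S.noise_assumption.a_pos], S.noise_assumption.a_pos⟩
  exact mul_ne_zero h0 (Real.exp_pos _).ne'

instance : IsProbabilityMeasure S.θ := by
  constructor
  have hnd : S.noiseDensity = fun y => S.normConst * (S.χ y * Real.exp (-y ^ 2 / 2)) := by
    funext y; simp only [noiseDensity]; ring
  have hc : 0 < S.normConst := inv_pos.mpr S.weight_integral_pos
  rw [θ, withDensity_apply _ MeasurableSet.univ, Measure.restrict_univ, hnd,
    ← ofReal_integral_eq_lintegral_ofReal (S.integrable_weight.const_mul _)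
      (Eventually.of_forall fun y => mul_nonneg hc.le (S.weight_nonneg y)),
    integral_const_mul, normConst, inv_mul_cancel₀ S.weight_integral_pos.ne', ENNReal.ofReal_one]

instance (μ : Measure ℝ) [IsProbabilityMeasure μ] : IsProbabilityMeasure (S.pathMeasure μ) := by
  unfold pathMeasure; infer_instance

end RandomSystem

end

/-!
Almost every initial condition is attracted by `[d₁, d₂]`, on which `T` is transitive, and the noise
density is positive on `(-a, a)`; together these give a Doeblin minorization of some power of the
transition kernel on a compact invariant interval inside `(0, 1)`. Every absolutely continuous
stationary measure lives on such an interval, because the noise pushes mass out of `[-Γ, 0]` and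
away from `0`. Hence the averaging operator `U` has a spectral gap on the bounded measurable
functions.

The moment generating function of `S_t` at complex `z` is `∫ (U_z ^ t) 1 dμ`, where
`U_z f = exp (z g) * U f` depends analytically on `z`. By perturbation of the leading eigenvalue it
equals `exp (t ℓ(z))` up to a relative error `O(|z|)`, uniformly in `t`, with `ℓ` analytic near `0`,
`ℓ(0) = ℓ'(0) = 0` and `ℓ''(0)` the Green–Kubo variance. All the limit theorems follow from this
expansion: the central limit theorem by Lévy continuity, the Berry–Esseen bound by Esseen's
smoothing inequality, and the large deviations by a local Gärtner–Ellis argument, with the Legendre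
transform of `ℓ` as rate function near `0`.
-/

noncomputable section

/-! ### Esseen's smoothing inequality -/

section Fejer

/-- The Fejér kernel `(1 - cos u) / u²`, not normalized to have integral `1`. It is written with
`sinc` so as to have the right value `1 / 2` at `u = 0`. -/
def fejer (u : ℝ) : ℝ := Real.sinc (u / 2) ^ 2 / 2

lemma continuous_fejer : Continuous fejer := by
  have := Real.continuous_sinc
  unfold fejer
  fun_prop

lemma fejer_nonneg (u : ℝ) : 0 ≤ fejer u := by
  unfold fejer
  positivity

lemma fejer_neg (u : ℝ) : fejer (-u) = fejer u := by
  rw [fejer, fejer, neg_div, Real.sinc_neg]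

lemma fejer_le_half (u : ℝ) : fejer u ≤ 1 / 2 := by
  have := (sq_le_one_iff_abs_le_one _).2 (Real.abs_sinc_le_one (u / 2))
  unfold fejer
  linarith

lemma fejer_of_ne_zero {u : ℝ} (hu : u ≠ 0) : fejer u = (1 - Real.cos u) / u ^ 2 := by
  have h : Real.cos u = 1 - 2 * Real.sin (u / 2) ^ 2 := by
    rw [← mul_div_cancel₀ u two_ne_zero, mul_div_assoc, Real.cos_two_mul, Real.cos_sq']
    ring_nf
  rw [fejer, Real.sinc_of_ne_zero (by positivity), h]
  field_simp
  ring

lemma fejer_le_two_div_sq {u : ℝ} (hu : u ≠ 0) : fejer u ≤ 2 / u ^ 2 := by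
  rw [fejer_of_ne_zero hu]
  gcongr
  linarith [Real.neg_one_le_cos u]

lemma integrable_fejer : Integrable fejer := by
  refine (integrable_inv_one_add_sq.const_mul (5 / 2)).mono'
    continuous_fejer.aestronglyMeasurable (Eventually.of_forall fun u => ?_)
  have hsq : fejer u * u ^ 2 ≤ 2 := by
    rcases eq_or_ne u 0 with rfl | hu
    · norm_num
    · exact (le_div_iff₀ (by positivity)).1 (fejer_le_two_div_sq hu)
  rw [Real.norm_of_nonneg (fejer_nonneg u), ← div_eq_mul_inv, le_div_iff₀ (by positivity)]
  linarith [fejer_le_half u]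

lemma integral_fejer_pos : 0 < ∫ u, fejer u :=
  integral_pos_of_integrable_nonneg_nonzero continuous_fejer integrable_fejer fejer_nonneg
    (x := 0) (by simp [fejer])

lemma setIntegral_Ioi_fejer_le {r : ℝ} (hr : 0 < r) : ∫ u in Ioi r, fejer u ≤ 2 / r :=
  calc ∫ u in Ioi r, fejer u ≤ ∫ u in Ioi r, 2 * u ^ (-2 : ℝ) := by
        refine setIntegral_mono_on integrable_fejer.integrableOn
          ((integrableOn_Ioi_rpow_of_lt (by norm_num) hr).const_mul 2) measurableSet_Ioi
          fun u hu => ?_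
        have hu : 0 < u := hr.trans hu
        rw [Real.rpow_neg hu.le, ← div_eq_mul_inv]
        exact_mod_cast fejer_le_two_div_sq hu.ne'
    _ = 2 / r := by
        rw [integral_const_mul, integral_Ioi_rpow_of_lt (by norm_num) hr]
        norm_num [Real.rpow_neg_one, div_eq_mul_inv]

lemma fejer_eq_integral_cos (u : ℝ) :
    fejer u = ∫ t in (0 : ℝ)..1, (1 - t) * Real.cos (t * u) := by
  rcases eq_or_ne u 0 with rfl | hu
  · have h : ∫ t in (0 : ℝ)..1, (1 - t) = 1 / 2 := by
      rw [intervalIntegral.integral_sub (by simp) (by simp)]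
      norm_num
    simp [fejer, h]
  · have hderiv : ∀ t ∈ uIcc (0 : ℝ) 1, HasDerivAt
        (fun t => (1 - t) * (Real.sin (t * u) / u) - Real.cos (t * u) / u ^ 2)
        ((1 - t) * Real.cos (t * u)) t := by
      intro t _
      have h : HasDerivAt (fun t : ℝ => t * u) u t := by
        simpa using (hasDerivAt_id t).mul_const u
      convert! (((hasDerivAt_id t).const_sub 1).mul (h.sin.div_const u)).sub
        (h.cos.div_const (u ^ 2)) using 1
      simp only [id]
      field_simp
      ring
    rw [intervalIntegral.integral_eq_sub_of_hasDerivAt hderiv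
      (Continuous.intervalIntegrable (by fun_prop) _ _), fejer_of_ne_zero hu]
    simp only [sub_self, one_mul, zero_mul, zero_sub, sub_zero, Real.sin_zero, zero_div, mul_zero,
      Real.cos_zero, one_div, sub_neg_eq_add]
    field_simp
    ring

lemma integral_cos_mul_eq_sinc (t y : ℝ) :
    ∫ u in (0 : ℝ)..y, Real.cos (t * u) = y * Real.sinc (t * y) := by
  rcases eq_or_ne t 0 with rfl | ht
  · simp
  rcases eq_or_ne y 0 with rfl | hy
  · simp
  rw [intervalIntegral.integral_comp_mul_left _ ht, integral_cos,
    Real.sinc_of_ne_zero (mul_ne_zero ht hy)]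
  simp only [mul_zero, Real.sin_zero, sub_zero, smul_eq_mul]
  field_simp

lemma integral_fejer_eq_integral_sinc (y : ℝ) :
    ∫ u in (0 : ℝ)..y, fejer u = ∫ t in (0 : ℝ)..1, (1 - t) * (y * Real.sinc (t * y)) := by
  simp_rw [fejer_eq_integral_cos]
  rw [intervalIntegral_intervalIntegral_swap]
  · simp_rw [intervalIntegral.integral_const_mul, integral_cos_mul_eq_sinc]
  · refine (ContinuousOn.integrableOn_compact (isCompact_uIcc.prod isCompact_uIcc)
      (Continuous.continuousOn ?_)).mono_set (prod_mono uIoc_subset_uIcc uIoc_subset_uIcc)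
    unfold Function.uncurry
    fun_prop

/-- The probability measure with density proportional to the Fejér kernel, used to smooth
distribution functions. -/
def fejerMeasure : Measure ℝ :=
  volume.withDensity fun u => ENNReal.ofReal (fejer u / ∫ v, fejer v)

lemma fejerMeasure_real {s : Set ℝ} (hs : MeasurableSet s) :
    fejerMeasure.real s = (∫ u in s, fejer u) / ∫ v, fejer v := by
  rw [Measure.real, fejerMeasure, withDensity_apply _ hs,
    ← ofReal_integral_eq_lintegral_ofReal (integrable_fejer.div_const _).integrableOn
      (Eventually.of_forall fun u => div_nonneg (fejer_nonneg u) integral_fejer_pos.le),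
    integral_div, ENNReal.toReal_ofReal]
  exact div_nonneg (integral_nonneg fejer_nonneg) integral_fejer_pos.le

instance : IsProbabilityMeasure fejerMeasure := by
  have h := fejerMeasure_real MeasurableSet.univ
  rw [setIntegral_univ, div_self integral_fejer_pos.ne', Measure.real] at h
  exact ⟨(ENNReal.toReal_eq_one_iff _).1 h⟩

lemma fejerMeasure_real_le_abs_le {r : ℝ} (hr : 0 < r) :
    fejerMeasure.real {u | r ≤ |u|} ≤ 4 / (∫ v, fejer v) / r := by
  have := integral_fejer_pos
  have hset : {u : ℝ | r ≤ |u|} = Iic (-r) ∪ Ici r := by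
    ext u
    simp only [mem_ofPred_eq, mem_union, mem_Iic, mem_Ici, le_abs']
  have hright : fejerMeasure.real (Ici r) ≤ 2 / r / ∫ v, fejer v := by
    rw [fejerMeasure_real measurableSet_Ici, integral_Ici_eq_integral_Ioi]
    gcongr
    exact setIntegral_Ioi_fejer_le hr
  have hleft : fejerMeasure.real (Iic (-r)) ≤ 2 / r / ∫ v, fejer v := by
    have hneg := integral_comp_neg_Iic (-r) fejer
    simp_rw [fejer_neg, neg_neg] at hneg
    rw [fejerMeasure_real measurableSet_Iic, hneg]
    gcongr
    exact setIntegral_Ioi_fejer_le hr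
  calc fejerMeasure.real {u | r ≤ |u|} ≤ fejerMeasure.real (Iic (-r)) + fejerMeasure.real (Ici r) :=
        hset ▸ measureReal_union_le _ _
    _ ≤ 2 / r / (∫ v, fejer v) + 2 / r / ∫ v, fejer v := add_le_add hleft hright
    _ = 4 / (∫ v, fejer v) / r := by field_simp; ring

lemma fejerMeasure_real_Iic (y : ℝ) : fejerMeasure.real (Iic y) = fejerMeasure.real (Iic 0) +
    (∫ t in (0 : ℝ)..1, (1 - t) * (y * Real.sinc (t * y))) / ∫ v, fejer v := by
  rw [fejerMeasure_real measurableSet_Iic, fejerMeasure_real measurableSet_Iic,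
    ← integral_fejer_eq_integral_sinc, ← intervalIntegral.integral_Iic_sub_Iic
      integrable_fejer.integrableOn integrable_fejer.integrableOn]
  ring

end Fejer

section Smoothing

variable {ν ν₁ ν₂ : Measure ℝ} [IsProbabilityMeasure ν] [IsProbabilityMeasure ν₁]
  [IsProbabilityMeasure ν₂]

lemma integrable_one_sub_mul_sinc (hν : Integrable (fun y => y) ν) (x : ℝ) :
    Integrable (fun p : ℝ × ℝ => (1 - p.1) * ((x - p.2) * Real.sinc (p.1 * (x - p.2))))
      ((volume.restrict (Ioc (0 : ℝ) 1)).prod ν) := by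
  have hbound : Integrable (fun p : ℝ × ℝ => |x - p.2|)
      ((volume.restrict (Ioc (0 : ℝ) 1)).prod ν) :=
    ((integrable_const x).sub hν).abs.comp_snd _
  refine hbound.mono' ?_ ?_
  · have := Real.continuous_sinc
    exact Continuous.aestronglyMeasurable (by fun_prop)
  · filter_upwards [Measure.quasiMeasurePreserving_fst.ae
      (ae_restrict_mem (measurableSet_Ioc (a := (0 : ℝ)) (b := 1)))] with p hp
    rw [Real.norm_eq_abs, abs_mul, abs_mul]
    have h : |1 - p.1| ≤ 1 := abs_le.2 ⟨by linarith [hp.2], by linarith [hp.1]⟩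
    calc |1 - p.1| * (|x - p.2| * |Real.sinc (p.1 * (x - p.2))|) ≤ 1 * (|x - p.2| * 1) := by
          gcongr
          exact Real.abs_sinc_le_one _
      _ = |x - p.2| := by ring

lemma integral_fejerMeasure_real_Iic (hν : Integrable (fun y => y) ν) (x : ℝ) :
    ∫ y, fejerMeasure.real (Iic (x - y)) ∂ν = fejerMeasure.real (Iic 0) +
      (∫ t in (0 : ℝ)..1, ∫ y, (1 - t) * ((x - y) * Real.sinc (t * (x - y))) ∂ν) /
        ∫ v, fejer v := by
  have hI := integrable_one_sub_mul_sinc hν x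
  rw [integral_congr_ae (Eventually.of_forall fun y => fejerMeasure_real_Iic (x - y))]
  simp_rw [intervalIntegral.integral_of_le zero_le_one]
  rw [integral_add (integrable_const _) (hI.integral_prod_right.div_const _), integral_div,
    integral_integral_swap (f := fun y t => (1 - t) * ((x - y) * Real.sinc (t * (x - y)))) hI.swap]
  simp

lemma integral_sin_sub_eq_im (ν : Measure ℝ) [IsProbabilityMeasure ν] (s x : ℝ) :
    ∫ y, Real.sin (s * (x - y)) ∂ν = (Complex.exp (s * x * Complex.I) * charFun ν (-s)).im := by
  have hI : Integrable (fun y : ℝ => Complex.exp ((s * (x - y) : ℝ) * Complex.I)) ν :=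
    Integrable.of_bound (Continuous.aestronglyMeasurable (by fun_prop)) 1
      (Eventually.of_forall fun y => (Complex.norm_exp_ofReal_mul_I _).le)
  calc ∫ y, Real.sin (s * (x - y)) ∂ν
      = ∫ y, (Complex.exp ((s * (x - y) : ℝ) * Complex.I)).im ∂ν := by
        simp_rw [Complex.exp_ofReal_mul_I_im]
    _ = (∫ y, Complex.exp ((s * (x - y) : ℝ) * Complex.I) ∂ν).im :=
        Complex.imCLM.integral_comp_comm hI
    _ = (Complex.exp (s * x * Complex.I) * charFun ν (-s)).im := by
        rw [charFun_apply_real, ← integral_const_mul]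
        simp_rw [← Complex.exp_add]
        congr 2 with y
        congr 1
        push_cast
        ring

lemma abs_integral_sin_sub_le (ν₁ ν₂ : Measure ℝ) [IsProbabilityMeasure ν₁]
    [IsProbabilityMeasure ν₂] (s x : ℝ) :
    |∫ y, Real.sin (s * (x - y)) ∂ν₁ - ∫ y, Real.sin (s * (x - y)) ∂ν₂| ≤
      ‖charFun ν₁ s - charFun ν₂ s‖ := by
  rw [integral_sin_sub_eq_im, integral_sin_sub_eq_im, ← Complex.sub_im, ← mul_sub]
  refine (Complex.abs_im_le_norm _).trans (le_of_eq ?_)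
  rw [norm_mul, charFun_neg, charFun_neg, ← map_sub, RCLike.norm_conj,
    ← Complex.ofReal_mul, Complex.norm_exp_ofReal_mul_I, one_mul]

lemma norm_charFun_sub_one_le (hν : Integrable (fun y => y) ν) (s : ℝ) :
    ‖charFun ν s - 1‖ ≤ |s| * ∫ y, |y| ∂ν := by
  have hI : Integrable (fun y : ℝ => Complex.exp ((s : ℂ) * y * Complex.I)) ν := by
    refine Integrable.of_bound (Continuous.aestronglyMeasurable (by fun_prop)) 1
      (Eventually.of_forall fun y => ?_)
    rw [← Complex.ofReal_mul, Complex.norm_exp_ofReal_mul_I]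
  have h : charFun ν s - 1 = ∫ y, (Complex.exp ((s : ℂ) * y * Complex.I) - 1) ∂ν := by
    rw [integral_sub hI (integrable_const _), charFun_apply_real]
    simp
  rw [h, ← integral_const_mul]
  refine norm_integral_le_of_norm_le (hν.abs.const_mul _) (Eventually.of_forall fun y => ?_)
  rw [← Complex.ofReal_mul, mul_comm _ Complex.I, ← abs_mul]
  exact Real.norm_exp_I_mul_ofReal_sub_one_le

lemma intervalIntegrable_norm_charFun_sub_div (h₁ : Integrable (fun y => y) ν₁)
    (h₂ : Integrable (fun y => y) ν₂) :
    IntervalIntegrable (fun t => ‖charFun ν₁ t - charFun ν₂ t‖ / t) volume 0 1 := by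
  rw [intervalIntegrable_iff_integrableOn_Ioc_of_le zero_le_one]
  refine Measure.integrableOn_of_bounded (M := ∫ y, |y| ∂ν₁ + ∫ y, |y| ∂ν₂) (by simp)
    (((measurable_charFun.sub measurable_charFun).norm.div measurable_id).aestronglyMeasurable) ?_
  filter_upwards [ae_restrict_mem measurableSet_Ioc] with t ht
  have hdiff : ‖charFun ν₁ t - charFun ν₂ t‖ ≤ |t| * ∫ y, |y| ∂ν₁ + |t| * ∫ y, |y| ∂ν₂ :=
    calc ‖charFun ν₁ t - charFun ν₂ t‖ = ‖(charFun ν₁ t - 1) - (charFun ν₂ t - 1)‖ := by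
          rw [sub_sub_sub_cancel_right]
      _ ≤ ‖charFun ν₁ t - 1‖ + ‖charFun ν₂ t - 1‖ := norm_sub_le _ _
      _ ≤ _ := add_le_add (norm_charFun_sub_one_le h₁ t) (norm_charFun_sub_one_le h₂ t)
  rw [abs_of_pos ht.1, ← mul_add] at hdiff
  rwa [norm_div, norm_norm, Real.norm_of_nonneg ht.1.le, div_le_iff₀' ht.1]

lemma abs_integral_fejerMeasure_real_Iic_sub_le (h₁ : Integrable (fun y => y) ν₁)
    (h₂ : Integrable (fun y => y) ν₂) (x : ℝ) :
    |∫ y, fejerMeasure.real (Iic (x - y)) ∂ν₁ - ∫ y, fejerMeasure.real (Iic (x - y)) ∂ν₂| ≤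
      (∫ t in (0 : ℝ)..1, ‖charFun ν₁ t - charFun ν₂ t‖ / t) / ∫ v, fejer v := by
  set k : Measure ℝ → ℝ → ℝ := fun ν t => ∫ y, (1 - t) * ((x - y) * Real.sinc (t * (x - y))) ∂ν
  have hk : ∀ (ν : Measure ℝ) [IsProbabilityMeasure ν], Integrable (fun y => y) ν →
      IntervalIntegrable (k ν) volume 0 1 := fun ν _ hν =>
    (intervalIntegrable_iff_integrableOn_Ioc_of_le zero_le_one).2
      (integrable_one_sub_mul_sinc hν x).integral_prod_left
  have hk_eq : ∀ (ν : Measure ℝ) {t : ℝ}, 0 < t →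
      k ν t = (1 - t) * ((∫ y, Real.sin (t * (x - y)) ∂ν) / t) := fun ν t ht => by
    rw [← integral_div, ← integral_const_mul]
    refine integral_congr_ae (Eventually.of_forall fun y => ?_)
    beta_reduce
    rcases eq_or_ne (x - y) 0 with h | h
    · simp [h]
    · rw [Real.sinc_of_ne_zero (mul_ne_zero ht.ne' h)]
      field_simp
  rw [integral_fejerMeasure_real_Iic h₁, integral_fejerMeasure_real_Iic h₂,
    add_sub_add_left_eq_sub, ← sub_div, abs_div, abs_of_pos integral_fejer_pos,
    ← intervalIntegral.integral_sub (hk ν₁ h₁) (hk ν₂ h₂)]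
  have := integral_fejer_pos
  gcongr
  rw [← Real.norm_eq_abs]
  refine intervalIntegral.norm_integral_le_of_norm_le zero_le_one
    (Eventually.of_forall fun t ht => ?_) (intervalIntegrable_norm_charFun_sub_div h₁ h₂)
  have h1t : |1 - t| ≤ 1 := abs_le.2 ⟨by linarith [ht.2], by linarith [ht.1]⟩
  rw [hk_eq ν₁ ht.1, hk_eq ν₂ ht.1, ← mul_sub, ← sub_div, norm_mul, norm_div, Real.norm_eq_abs,
    Real.norm_eq_abs, Real.norm_of_nonneg ht.1.le]
  refine (mul_le_of_le_one_left (div_nonneg (abs_nonneg _) ht.1.le) h1t).trans ?_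
  have := ht.1
  gcongr
  exact abs_integral_sin_sub_le ν₁ ν₂ t x

lemma measurable_measureReal_Iic (ν : Measure ℝ) [IsFiniteMeasure ν] :
    Measurable fun x => ν.real (Iic x) :=
  Monotone.measurable fun _ _ h => measureReal_mono (Iic_subset_Iic.2 h)

lemma integral_measureReal_Iic_sub_comm (ν κ : Measure ℝ) [IsFiniteMeasure ν]
    [IsFiniteMeasure κ] (x : ℝ) :
    ∫ u, ν.real (Iic (x - u)) ∂κ = ∫ y, κ.real (Iic (x - y)) ∂ν := by
  have hs : MeasurableSet {p : ℝ × ℝ | p.1 + p.2 ≤ x} :=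
    measurableSet_le (by fun_prop) (by fun_prop)
  have hI : Integrable ({p : ℝ × ℝ | p.1 + p.2 ≤ x}.indicator fun _ => (1 : ℝ)) (κ.prod ν) :=
    (integrable_const _).indicator hs
  have hsection : ∀ (m : Measure ℝ) (y : ℝ),
      m.real (Iic (x - y)) = ∫ u, {u | y + u ≤ x}.indicator (fun _ => (1 : ℝ)) u ∂m := by
    intro m y
    rw [integral_indicator_const _ (measurableSet_le (by fun_prop) (by fun_prop)), smul_eq_mul,
      mul_one]
    congr 1 with u
    simp only [mem_Iic, mem_ofPred_eq, le_sub_iff_add_le']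
  simp_rw [hsection]
  refine (integral_integral_swap (f := fun u y => {p : ℝ × ℝ | p.1 + p.2 ≤ x}.indicator
    (fun _ => (1 : ℝ)) (u, y)) hI).trans (integral_congr_ae (Eventually.of_forall fun y => ?_))
  simp only [indicator, mem_ofPred_eq, add_comm]

lemma le_integral_add_two_mul_measureReal {α : Type*} [MeasurableSpace α] {κ : Measure α}
    [IsProbabilityMeasure κ] {f : α → ℝ} {s : Set α} {c D : ℝ} (hf : Integrable f κ)
    (hs : MeasurableSet s) (hcD : c ≤ D) (hfD : ∀ u, |f u| ≤ D) (hfc : ∀ u ∉ s, c ≤ f u) :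
    c ≤ ∫ u, f u ∂κ + 2 * D * κ.real s := by
  have hind : Integrable (fun u => 2 * D * s.indicator (fun _ => (1 : ℝ)) u) κ :=
    ((integrable_const _).indicator hs).const_mul _
  calc c = ∫ _, c ∂κ := by simp
    _ ≤ ∫ u, f u + 2 * D * s.indicator (fun _ => 1) u ∂κ := by
        refine integral_mono (integrable_const _) (hf.add hind) fun u => ?_
        by_cases hu : u ∈ s
        · simp only [indicator_of_mem hu]
          linarith [(abs_le.1 (hfD u)).1]
        · simpa [hu] using hfc u hu
    _ = ∫ u, f u ∂κ + 2 * D * κ.real s := by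
        rw [integral_add hf hind, integral_const_mul, integral_indicator_const _ hs, smul_eq_mul,
          mul_one]

/-- A value `Δ x` persists, up to a quarter of the supremum `D` of `|Δ|`, on an interval of length
`D / (4 * m)` on one side of `x`; the smoothed function at the centre of that interval sees it. -/
lemma abs_le_of_abs_integral_sub_le {κ : Measure ℝ} [IsProbabilityMeasure κ] {Δ : ℝ → ℝ}
    {m E M : ℝ} (hm : 0 < m) (hM : 0 ≤ M) (hmeas : Measurable Δ)
    (hbdd : BddAbove (range fun x => |Δ x|))
    (hΔ : ∀ x y, x ≤ y → Δ x - Δ y ≤ m * (y - x))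
    (hE : ∀ x, |∫ u, Δ (x - u) ∂κ| ≤ E) (hκ : ∀ r, 0 < r → κ.real {u | r ≤ |u|} ≤ M / r) (x : ℝ) :
    |Δ x| ≤ 4 / 3 * (E + 16 * m * M) := by
  set D := ⨆ x, |Δ x|
  have hD : ∀ x, |Δ x| ≤ D := le_ciSup hbdd
  have hE0 : 0 ≤ E := (abs_nonneg _).trans (hE 0)
  rcases ((abs_nonneg _).trans (hD 0)).eq_or_lt with hD0 | hDpos
  · exact (hD x).trans (hD0 ▸ by positivity)
  set r := D / (8 * m) with hr_def
  have hr : 0 < r := by positivity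
  have hmr : m * (2 * r) = D / 4 := by rw [hr_def]; field_simp; norm_num
  have hmr' : ∀ {y z : ℝ}, z - y ≤ 2 * r → m * (z - y) ≤ D / 4 := fun h =>
    hmr ▸ mul_le_mul_of_nonneg_left h hm.le
  have htail : 2 * D * κ.real {u | r ≤ |u|} ≤ 16 * m * M :=
    calc 2 * D * κ.real {u | r ≤ |u|} ≤ 2 * D * (M / r) := by gcongr; exact hκ r hr
      _ = 16 * m * M := by rw [hr_def]; field_simp; ring
  have hset : MeasurableSet {u : ℝ | r ≤ |u|} := measurableSet_le (by fun_prop) (by fun_prop)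
  have hint : ∀ x, Integrable (fun u => Δ (x - u)) κ := fun x =>
    Integrable.of_bound (hmeas.comp (by fun_prop)).aestronglyMeasurable D
      (Eventually.of_forall fun u => hD _)
  have hbound : ∀ x, |Δ x| ≤ E + D / 4 + 16 * m * M := by
    intro x
    refine abs_le'.2 ⟨?_, ?_⟩
    · have h := le_integral_add_two_mul_measureReal (c := Δ x - D / 4) (hint (x + r)) hset
        (by linarith [le_abs_self (Δ x), hD x]) (fun u => hD _) fun u hu => by
          have hu : |u| < r := not_le.1 hu
          rw [abs_lt] at hu
          linarith [hΔ x (x + r - u) (by linarith),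
            hmr' (y := x) (z := x + r - u) (by linarith)]
      linarith [le_abs_self (∫ u, Δ (x + r - u) ∂κ), hE (x + r)]
    · have h := le_integral_add_two_mul_measureReal (c := -Δ x - D / 4) (hint (x - r)).neg hset
        (by linarith [neg_le_abs (Δ x), hD x]) (fun u => (abs_neg _).trans_le (hD _)) fun u hu => by
          have hu : |u| < r := not_le.1 hu
          rw [abs_lt] at hu
          simp only [Pi.neg_apply]
          linarith [hΔ (x - r - u) x (by linarith),
            hmr' (y := x - r - u) (z := x) (by linarith)]
      simp only [Pi.neg_apply, integral_neg] at h
      linarith [neg_le_abs (∫ u, Δ (x - r - u) ∂κ), hE (x - r)]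
  linarith [hD x, ciSup_le hbound]

lemma abs_measureReal_Iic_sub_le_of_unit_cutoff (h₁ : Integrable (fun y => y) ν₁)
    (h₂ : Integrable (fun y => y) ν₂) {m : ℝ} (hm : 0 < m)
    (hν₂ : ∀ x y, x ≤ y → ν₂.real (Iic y) - ν₂.real (Iic x) ≤ m * (y - x)) (x : ℝ) :
    |ν₁.real (Iic x) - ν₂.real (Iic x)| ≤
      4 / 3 * ((∫ t in (0 : ℝ)..1, ‖charFun ν₁ t - charFun ν₂ t‖ / t) / (∫ v, fejer v) +
        16 * m * (4 / ∫ v, fejer v)) := by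
  have hmeas := measurable_measureReal_Iic
  have hle_one : ∀ x, |ν₁.real (Iic x) - ν₂.real (Iic x)| ≤ 1 := fun x =>
    abs_sub_le_of_nonneg_of_le measureReal_nonneg measureReal_le_one measureReal_nonneg
      measureReal_le_one
  have hint : ∀ (ν : Measure ℝ) [IsProbabilityMeasure ν] (x : ℝ),
      Integrable (fun u => ν.real (Iic (x - u))) fejerMeasure := fun ν _ x =>
    Integrable.of_bound ((hmeas ν).comp (by fun_prop)).aestronglyMeasurable 1
      (Eventually.of_forall fun u => by
        rw [Real.norm_of_nonneg measureReal_nonneg]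
        exact measureReal_le_one)
  refine abs_le_of_abs_integral_sub_le (κ := fejerMeasure)
    (Δ := fun x => ν₁.real (Iic x) - ν₂.real (Iic x)) hm
    (div_nonneg (by norm_num) integral_fejer_pos.le) ((hmeas ν₁).sub (hmeas ν₂))
    ⟨1, by rintro _ ⟨y, rfl⟩; exact hle_one y⟩ (fun x y hxy => ?_) (fun x => ?_)
    (fun r => fejerMeasure_real_le_abs_le) x
  · have : ν₁.real (Iic x) ≤ ν₁.real (Iic y) := measureReal_mono (Iic_subset_Iic.2 hxy)
    linarith [hν₂ x y hxy]
  · rw [integral_sub (hint ν₁ x) (hint ν₂ x), integral_measureReal_Iic_sub_comm ν₁,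
      integral_measureReal_Iic_sub_comm ν₂]
    exact abs_integral_fejerMeasure_real_Iic_sub_le h₁ h₂ x

theorem abs_measureReal_Iic_sub_le_integral_charFun (h₁ : Integrable (fun y => y) ν₁)
    (h₂ : Integrable (fun y => y) ν₂) {m : ℝ} (hm : 0 < m)
    (hν₂ : ∀ x y, x ≤ y → ν₂.real (Iic y) - ν₂.real (Iic x) ≤ m * (y - x))
    {T : ℝ} (hT : 0 < T) (x : ℝ) :
    |ν₁.real (Iic x) - ν₂.real (Iic x)| ≤
      4 / 3 * ((∫ t in (0 : ℝ)..T, ‖charFun ν₁ t - charFun ν₂ t‖ / t) / (∫ v, fejer v) +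
        64 * m / (∫ v, fejer v) / T) := by
  have hmeas : Measurable fun y : ℝ => T * y := measurable_const_mul T
  have := Measure.isProbabilityMeasure_map (μ := ν₁) hmeas.aemeasurable
  have := Measure.isProbabilityMeasure_map (μ := ν₂) hmeas.aemeasurable
  have hint : ∀ ν : Measure ℝ, Integrable (fun y => y) ν →
      Integrable (fun y => y) (ν.map fun y => T * y) := fun ν hν =>
    (integrable_map_measure measurable_id.aestronglyMeasurable hmeas.aemeasurable).2
      (hν.const_mul T)
  have hIic : ∀ (ν : Measure ℝ) (z : ℝ),
      (ν.map fun y => T * y).real (Iic z) = ν.real (Iic (z / T)) := fun ν z => by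
    rw [map_measureReal_apply hmeas measurableSet_Iic]
    congr with y
    exact (le_div_iff₀' hT).symm
  have hscale := abs_measureReal_Iic_sub_le_of_unit_cutoff (hint ν₁ h₁) (hint ν₂ h₂)
    (div_pos hm hT) (fun y z hyz => by
      rw [hIic, hIic, div_mul_eq_mul_div, mul_div_assoc, sub_div]
      exact hν₂ _ _ (by gcongr)) (T * x)
  have hcv : ∫ t in (0 : ℝ)..1, ‖charFun ν₁ (T * t) - charFun ν₂ (T * t)‖ / t =
      ∫ t in (0 : ℝ)..T, ‖charFun ν₁ t - charFun ν₂ t‖ / t := by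
    have h := intervalIntegral.mul_integral_comp_mul_left (a := 0) (b := 1)
      (f := fun t => ‖charFun ν₁ t - charFun ν₂ t‖ / t) T
    rw [mul_zero, mul_one] at h
    rw [← h, ← intervalIntegral.integral_const_mul]
    congr with t
    field_simp
  simp_rw [charFun_map_mul, hIic, mul_div_cancel_left₀ x hT.ne', hcv] at hscale
  convert hscale using 3
  field_simp
  norm_num

end Smoothing

/-! ### Limit theorems for quasi-powers -/

/-- The complex moment generating functions of the bounded centred variables `S t` are, near `0`,
close to the powers `exp (t * ℓ z)` for a holomorphic function `ℓ`. The error is relative, with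
constant `C`. -/
structure QuasiPower {Ω : Type*} [MeasurableSpace Ω] (P : Measure Ω) (S : ℕ → Ω → ℝ)
    (ℓ : ℂ → ℂ) (δ C : ℝ) : Prop where
  aemeasurable : ∀ t, AEMeasurable (S t) P
  bounded : ∀ t, ∃ G : ℝ, ∀ᵐ ω ∂P, |S t ω| ≤ G
  centred : ∀ t, ∫ ω, S t ω ∂P = 0
  δ_pos : 0 < δ
  differentiableOn : DifferentiableOn ℂ ℓ (Metric.ball 0 δ)
  map_zero : ℓ 0 = 0
  bound : ∀ t : ℕ, ∀ z ∈ Metric.ball (0 : ℂ) δ,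
    ‖complexMGF (S t) P z - Complex.exp (t * ℓ z)‖ ≤ C * ‖z‖ * ‖Complex.exp (t * ℓ z)‖

namespace QuasiPower

variable {Ω : Type*} [MeasurableSpace Ω] {P : Measure Ω} {S S' : ℕ → Ω → ℝ} {ℓ : ℂ → ℂ} {δ C v : ℝ}

lemma congr_ae (H : QuasiPower P S ℓ δ C) (hS : ∀ t, S t =ᵐ[P] S' t) : QuasiPower P S' ℓ δ C where
  aemeasurable t := (H.aemeasurable t).congr (hS t)
  bounded t := by
    obtain ⟨G, hG⟩ := H.bounded t
    refine ⟨G, ?_⟩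
    filter_upwards [hG, hS t] with ω hω h
    rwa [← h]
  centred t := by rw [← integral_congr_ae (hS t), H.centred]
  δ_pos := H.δ_pos
  differentiableOn := H.differentiableOn
  map_zero := H.map_zero
  bound t z hz := by
    have h : complexMGF (S' t) P z = complexMGF (S t) P z :=
      integral_congr_ae ((hS t).symm.fun_comp fun x : ℝ => Complex.exp (z * x))
    rw [h]
    exact H.bound t z hz

lemma analyticAt (H : QuasiPower P S ℓ δ C) {z : ℂ} (hz : z ∈ Metric.ball 0 δ) : AnalyticAt ℂ ℓ z :=
  H.differentiableOn.analyticAt (Metric.isOpen_ball.mem_nhds hz)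

lemma analyticAt_zero (H : QuasiPower P S ℓ δ C) : AnalyticAt ℂ ℓ 0 :=
  H.analyticAt (Metric.mem_ball_self H.δ_pos)

/-- The relative error made in approximating the moment generating function of `S t` by
`exp (t * ℓ z)`. -/
def relativeError (P : Measure Ω) (S : ℕ → Ω → ℝ) (ℓ : ℂ → ℂ) (t : ℕ) (z : ℂ) : ℂ :=
  complexMGF (S t) P z * Complex.exp (-(t * ℓ z)) - 1

lemma norm_relativeError_le (H : QuasiPower P S ℓ δ C) (t : ℕ) {z : ℂ}
    (hz : z ∈ Metric.ball 0 δ) : ‖relativeError P S ℓ t z‖ ≤ C * ‖z‖ := by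
  have hexp : Complex.exp (t * ℓ z) * Complex.exp (-(t * ℓ z)) = 1 := by
    rw [← Complex.exp_add, add_neg_cancel, Complex.exp_zero]
  calc ‖relativeError P S ℓ t z‖
      = ‖complexMGF (S t) P z - Complex.exp (t * ℓ z)‖ * ‖Complex.exp (-(t * ℓ z))‖ := by
        rw [relativeError, ← hexp, ← sub_mul, norm_mul]
    _ ≤ C * ‖z‖ * ‖Complex.exp (t * ℓ z)‖ * ‖Complex.exp (-(t * ℓ z))‖ := by
        gcongr
        exact H.bound t z hz
    _ = C * ‖z‖ := by rw [mul_assoc, ← norm_mul, hexp, norm_one, mul_one]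

lemma C_nonneg (H : QuasiPower P S ℓ δ C) : 0 ≤ C := by
  have h0 := H.δ_pos
  have hz : ((δ / 2 : ℝ) : ℂ) ∈ Metric.ball (0 : ℂ) δ := by
    rw [mem_ball_zero_iff, Complex.norm_of_nonneg (by positivity)]
    linarith
  have := (norm_nonneg _).trans (H.norm_relativeError_le 0 hz)
  rw [Complex.norm_of_nonneg (by positivity)] at this
  exact nonneg_of_mul_nonneg_left this (by positivity)

lemma charFun_map_eq (H : QuasiPower P S ℓ δ C) (t : ℕ) (s : ℝ) :
    charFun (P.map fun ω => S t ω / √(t : ℝ)) s =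
      complexMGF (S t) P ((s / √(t : ℝ) : ℝ) * Complex.I) := by
  simp_rw [div_eq_inv_mul _ √(t : ℝ)]
  rw [complexMGF_mul_I (H.aemeasurable t), charFun_map_mul_comp (H.aemeasurable t)]

variable [IsProbabilityMeasure P]

lemma integrableExpSet_eq_univ (H : QuasiPower P S ℓ δ C) (t : ℕ) :
    integrableExpSet (S t) P = univ := by
  obtain ⟨G, hG⟩ := H.bounded t
  exact eq_univ_of_forall fun x =>
    integrable_exp_mul_of_mem_Icc (H.aemeasurable t) (hG.mono fun ω hω => abs_le.1 hω)

lemma mem_interior_integrableExpSet (H : QuasiPower P S ℓ δ C) (t : ℕ) (x : ℝ) :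
    x ∈ interior (integrableExpSet (S t) P) := by
  rw [H.integrableExpSet_eq_univ, interior_univ]
  exact mem_univ x

lemma integrable (H : QuasiPower P S ℓ δ C) (t : ℕ) : Integrable (S t) P :=
  integrable_of_mem_interior_integrableExpSet (H.mem_interior_integrableExpSet t 0)

lemma differentiable_complexMGF (H : QuasiPower P S ℓ δ C) (t : ℕ) :
    Differentiable ℂ (complexMGF (S t) P) := fun z =>
  (hasDerivAt_complexMGF (H.mem_interior_integrableExpSet t z.re)).differentiableAt

lemma hasDerivAt_complexMGF_zero (H : QuasiPower P S ℓ δ C) (t : ℕ) :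
    HasDerivAt (complexMGF (S t) P) 0 0 := by
  have h := hasDerivAt_complexMGF (z := 0) (H.mem_interior_integrableExpSet t _)
  simp only [zero_mul, Complex.exp_zero, mul_one] at h
  rwa [integral_complex_ofReal, H.centred t, Complex.ofReal_zero] at h

lemma hasDerivAt_deriv_complexMGF_zero (H : QuasiPower P S ℓ δ C) (t : ℕ) :
    HasDerivAt (deriv (complexMGF (S t) P)) ((∫ ω, S t ω ^ 2 ∂P : ℝ) : ℂ) 0 := by
  have h := iteratedDeriv_complexMGF (z := 0) (H.mem_interior_integrableExpSet t _) 2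
  rw [iteratedDeriv_succ, iteratedDeriv_one] at h
  simp only [zero_mul, Complex.exp_zero, mul_one] at h
  rw [← integral_complex_ofReal]
  simp only [Complex.ofReal_pow]
  exact h ▸ ((H.differentiable_complexMGF t).analyticAt 0).deriv.differentiableAt.hasDerivAt

lemma hasDerivAt_relativeError (H : QuasiPower P S ℓ δ C) (t : ℕ) {z : ℂ}
    (hz : z ∈ Metric.ball 0 δ) :
    HasDerivAt (relativeError P S ℓ t)
      ((deriv (complexMGF (S t) P) z - t * deriv ℓ z * complexMGF (S t) P z) *
        Complex.exp (-(t * ℓ z))) z := by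
  have hM := (H.differentiable_complexMGF t z).hasDerivAt
  have hℓ := (H.analyticAt hz).differentiableAt.hasDerivAt
  convert! (hM.mul (hℓ.const_mul (t : ℂ)).fun_neg.cexp).sub_const 1 using 1
  ring

lemma norm_iteratedDeriv_relativeError_le (H : QuasiPower P S ℓ δ C) (t n : ℕ) :
    ‖iteratedDeriv n (relativeError P S ℓ t) 0‖ ≤ n.factorial * (C * δ) / (δ / 2) ^ n := by
  have h0 := H.δ_pos
  have hC := H.C_nonneg
  have hsub : Metric.closedBall (0 : ℂ) (δ / 2) ⊆ Metric.ball 0 δ :=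
    Metric.closedBall_subset_ball (by linarith)
  refine Complex.norm_iteratedDeriv_le_of_forall_mem_sphere_norm_le n (by positivity) ?_
    fun z hz => ?_
  · refine DifferentiableOn.diffContOnCl fun z hz => ?_
    rw [closure_ball _ (by positivity)] at hz
    exact (H.hasDerivAt_relativeError t (hsub hz)).differentiableAt.differentiableWithinAt
  · refine (H.norm_relativeError_le t (hsub (Metric.sphere_subset_closedBall hz))).trans ?_
    gcongr
    linarith [mem_sphere_zero_iff_norm.1 hz]

lemma deriv_zero (H : QuasiPower P S ℓ δ C) : deriv ℓ 0 = 0 := by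
  have h0 := H.δ_pos
  have hbound : ∀ t : ℕ, (t : ℝ) * ‖deriv ℓ 0‖ ≤ C * δ / (δ / 2) := by
    intro t
    have h := H.norm_iteratedDeriv_relativeError_le t 1
    rw [iteratedDeriv_one, (H.hasDerivAt_relativeError t (Metric.mem_ball_self h0)).deriv,
      (H.hasDerivAt_complexMGF_zero t).deriv, H.map_zero] at h
    simpa [complexMGF] using h
  by_contra hne
  obtain ⟨n, hn⟩ := exists_nat_gt (C * δ / (δ / 2) / ‖deriv ℓ 0‖)
  rw [div_lt_iff₀ (norm_pos_iff.2 hne)] at hn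
  linarith [hbound n]

lemma hasDerivAt_zero (H : QuasiPower P S ℓ δ C) : HasDerivAt ℓ 0 0 := by
  have h := H.analyticAt_zero.differentiableAt.hasDerivAt
  rwa [H.deriv_zero] at h

lemma deriv_deriv_relativeError_zero (H : QuasiPower P S ℓ δ C) (t : ℕ) :
    deriv (deriv (relativeError P S ℓ t)) 0 =
      ((∫ ω, S t ω ^ 2 ∂P : ℝ) : ℂ) - t * deriv (deriv ℓ) 0 := by
  have hev : deriv (relativeError P S ℓ t) =ᶠ[𝓝 0]
      fun z => (deriv (complexMGF (S t) P) z - t * deriv ℓ z * complexMGF (S t) P z) *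
        Complex.exp (-(t * ℓ z)) := by
    filter_upwards [Metric.ball_mem_nhds 0 H.δ_pos] with z hz
    exact (H.hasDerivAt_relativeError t hz).deriv
  have hℓ' := H.analyticAt_zero.deriv.differentiableAt.hasDerivAt
  have hd := ((H.hasDerivAt_deriv_complexMGF_zero t).fun_sub
    ((hℓ'.const_mul (t : ℂ)).fun_mul (H.hasDerivAt_complexMGF_zero t))).fun_mul
      (H.hasDerivAt_zero.const_mul (t : ℂ)).fun_neg.cexp
  rw [hev.deriv_eq, hd.deriv, H.deriv_zero, H.map_zero]
  simp [complexMGF]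

lemma norm_secondMoment_sub_le (H : QuasiPower P S ℓ δ C) (t : ℕ) :
    ‖((∫ ω, S t ω ^ 2 ∂P : ℝ) : ℂ) - t * deriv (deriv ℓ) 0‖ ≤ 2 * (C * δ) / (δ / 2) ^ 2 := by
  have h := H.norm_iteratedDeriv_relativeError_le t 2
  rwa [iteratedDeriv_succ, iteratedDeriv_one, H.deriv_deriv_relativeError_zero,
    Nat.factorial_two, Nat.cast_ofNat] at h

lemma deriv_deriv_zero (H : QuasiPower P S ℓ δ C)
    (hv : Tendsto (fun t : ℕ => (1 / (t : ℝ)) * ∫ ω, S t ω ^ 2 ∂P) atTop (𝓝 v)) :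
    deriv (deriv ℓ) 0 = v := by
  refine tendsto_nhds_unique ?_ ((Complex.continuous_ofReal.tendsto v).comp hv)
  rw [tendsto_iff_norm_sub_tendsto_zero]
  refine squeeze_zero' (Eventually.of_forall fun _ => norm_nonneg _) ?_
    (tendsto_const_div_atTop_nhds_zero_nat (2 * (C * δ) / (δ / 2) ^ 2))
  filter_upwards [eventually_gt_atTop 0] with t ht
  have htc : (t : ℂ) ≠ 0 := by exact_mod_cast ht.ne'
  rw [le_div_iff₀' (by exact_mod_cast ht), ← Complex.norm_natCast, ← norm_mul]
  refine le_of_eq_of_le ?_ (H.norm_secondMoment_sub_le t)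
  rw [Function.comp_apply, mul_sub, Complex.ofReal_mul, ← mul_assoc]
  simp [htc]

lemma exists_norm_sub_sq_le (H : QuasiPower P S ℓ δ C) (hv : deriv (deriv ℓ) 0 = v) :
    ∃ r B : ℝ, 0 < r ∧ r ≤ δ ∧ 0 < B ∧
      ∀ z ∈ Metric.ball (0 : ℂ) r, ‖ℓ z - v * z ^ 2 / 2‖ ≤ B * ‖z‖ ^ 3 := by
  obtain ⟨B, hB, hO⟩ := (H.analyticAt_zero.hasFPowerSeriesAt.isBigO_sub_partialSum_pow 3).exists_pos
  obtain ⟨r, hr, hball⟩ := Metric.eventually_nhds_iff_ball.1 hO.bound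
  refine ⟨min r δ, B, lt_min hr H.δ_pos, min_le_right _ _, hB, fun z hz => ?_⟩
  have h := hball z (Metric.ball_subset_ball (min_le_left _ _) hz)
  rw [zero_add, Real.norm_of_nonneg (by positivity)] at h
  refine le_trans (le_of_eq ?_) h
  congr 2
  simp [FormalMultilinearSeries.partialSum, Finset.sum_range_succ,
    FormalMultilinearSeries.ofScalars, iteratedDeriv_succ, H.map_zero, H.deriv_zero, hv]
  ring

end QuasiPower

section CharFunEstimate

lemma norm_exp_ofReal_add_le {a b : ℝ} {w : ℂ} (h : a + ‖w‖ ≤ b) :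
    ‖Complex.exp (a + w)‖ ≤ Real.exp b := by
  rw [Complex.norm_exp, Complex.add_re, Complex.ofReal_re, Real.exp_le_exp]
  linarith [(Complex.re_le_norm w)]

lemma norm_exp_ofReal_add_sub_le {a b : ℝ} {w : ℂ} (h : a + ‖w‖ ≤ b) :
    ‖Complex.exp (a + w) - Complex.exp a‖ ≤ ‖w‖ * Real.exp b := by
  have hw : ‖Complex.exp w - 1‖ ≤ ‖w‖ * Real.exp ‖w‖ := by
    simpa using Complex.norm_exp_sub_sum_le_norm_mul_exp w 1
  calc ‖Complex.exp (a + w) - Complex.exp a‖ = Real.exp a * ‖Complex.exp w - 1‖ := by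
        rw [Complex.exp_add, ← mul_sub_one, norm_mul, Complex.norm_exp, Complex.ofReal_re]
    _ ≤ Real.exp a * (‖w‖ * Real.exp ‖w‖) := by gcongr
    _ = ‖w‖ * Real.exp (a + ‖w‖) := by rw [Real.exp_add]; ring
    _ ≤ ‖w‖ * Real.exp b := by gcongr

variable {Ω : Type*} [MeasurableSpace Ω] {P : Measure Ω} [IsProbabilityMeasure P] {S : ℕ → Ω → ℝ}
  {ℓ : ℂ → ℂ} {δ C v : ℝ}

namespace QuasiPower

/-- For small `u` a cubic error costs at most half of the Gaussian decay. -/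
lemma neg_mul_sq_add_mul_cube_le {B t u : ℝ} (ht : 0 ≤ t) (hu : B * |u| ≤ v / 4) :
    -(v / 2) * t * u ^ 2 + t * (B * |u| ^ 3) ≤ -(v / 4) * t * u ^ 2 := by
  have cube_le : t * (B * |u| ^ 3) ≤ v / 4 * (t * u ^ 2) :=
    calc t * (B * |u| ^ 3) = B * |u| * (t * u ^ 2) := by rw [← sq_abs u]; ring
      _ ≤ v / 4 * (t * u ^ 2) := by gcongr
  linarith

lemma exists_norm_complexMGF_mul_I_sub_le (H : QuasiPower P S ℓ δ C) (hv0 : 0 < v)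
    (hv : deriv (deriv ℓ) 0 = v) :
    ∃ c B : ℝ, 0 < c ∧ 0 < B ∧ ∀ t : ℕ, ∀ u : ℝ, |u| ≤ c →
      ‖complexMGF (S t) P (u * Complex.I) - Complex.exp ((-(v / 2) * t * u ^ 2 : ℝ) : ℂ)‖ ≤
        B * |u| * (1 + t * u ^ 2) * Real.exp (-(v / 4) * t * u ^ 2) := by
  obtain ⟨r, B, hr, hrδ, hB, hℓ⟩ := H.exists_norm_sub_sq_le hv
  have hC := H.C_nonneg
  refine ⟨min (r / 2) (v / (4 * B)), B + C, by positivity, by positivity, fun t u hu => ?_⟩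
  set z : ℂ := u * Complex.I with hz
  have hnorm : ‖z‖ = |u| := by simp [hz]
  have hzr : z ∈ Metric.ball (0 : ℂ) r := by
    rw [mem_ball_zero_iff, hnorm]
    linarith [hu.trans (min_le_left _ _)]
  set w : ℂ := t * (ℓ z - v * z ^ 2 / 2) with hw
  have hexp : (t : ℂ) * ℓ z = ((-(v / 2) * t * u ^ 2 : ℝ) : ℂ) + w := by
    rw [hw, hz, mul_pow, Complex.I_sq]
    push_cast
    ring
  have hw_le : ‖w‖ ≤ t * (B * |u| ^ 3) := by
    rw [hw, norm_mul, Complex.norm_natCast, ← hnorm]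
    gcongr
    exact hℓ z hzr
  have hdecay : -(v / 2) * t * u ^ 2 + ‖w‖ ≤ -(v / 4) * t * u ^ 2 := by
    have hBu : B * |u| ≤ v / 4 := by
      have := (le_div_iff₀ (by positivity)).1 (hu.trans (min_le_right _ _))
      linarith
    exact (add_le_add_right hw_le _).trans (neg_mul_sq_add_mul_cube_le t.cast_nonneg hBu)
  set E := Real.exp (-(v / 4) * t * u ^ 2)
  have hmgf : ‖complexMGF (S t) P z - Complex.exp (t * ℓ z)‖ ≤ C * |u| * E := by
    refine (H.bound t z (Metric.ball_subset_ball hrδ hzr)).trans ?_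
    rw [hnorm, hexp]
    gcongr
    exact norm_exp_ofReal_add_le hdecay
  calc _ ≤ C * |u| * E + t * (B * |u| ^ 3) * E := by
        refine (norm_sub_le_norm_sub_add_norm_sub _ (Complex.exp (t * ℓ z)) _).trans
          (add_le_add hmgf ?_)
        rw [hexp]
        exact (norm_exp_ofReal_add_sub_le hdecay).trans (by gcongr)
    _ = (C + B * (t * u ^ 2)) * (|u| * E) := by rw [← sq_abs u]; ring
    _ ≤ (B + C) * (1 + t * u ^ 2) * (|u| * E) := by
        gcongr
        have : 0 ≤ (t : ℝ) * u ^ 2 := by positivity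
        nlinarith [mul_nonneg hC this]
    _ = _ := by ring

lemma exists_norm_charFun_sub_le (H : QuasiPower P S ℓ δ C) (hv0 : 0 < v)
    (hv : deriv (deriv ℓ) 0 = v) :
    ∃ c B : ℝ, 0 < c ∧ 0 < B ∧ ∀ t : ℕ, 1 ≤ t → ∀ s : ℝ, |s| ≤ c * √(t : ℝ) →
      ‖charFun (P.map fun ω => S t ω / √(t : ℝ)) s -
        charFun (gaussianReal 0 (Real.toNNReal v)) s‖ ≤
          B / √(t : ℝ) * (|s| * ((1 + s ^ 2) * Real.exp (-(v / 4) * s ^ 2))) := by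
  obtain ⟨c, B, hc, hB, hmgf⟩ := H.exists_norm_complexMGF_mul_I_sub_le hv0 hv
  refine ⟨c, B, hc, hB, fun t ht s hs => ?_⟩
  have ht0 : (0 : ℝ) < t := by exact_mod_cast ht
  have hq : 0 < √(t : ℝ) := Real.sqrt_pos.2 ht0
  have habs : |s / √(t : ℝ)| = |s| / √(t : ℝ) := by rw [abs_div, abs_of_pos hq]
  have hsq : ∀ b : ℝ, b * t * (s / √(t : ℝ)) ^ 2 = b * s ^ 2 := fun b => by
    rw [div_pow, Real.sq_sqrt ht0.le]
    field_simp
  have h := hmgf t (s / √(t : ℝ)) (by rwa [habs, div_le_iff₀ hq])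
  have hgauss : charFun (gaussianReal 0 (Real.toNNReal v)) s =
      Complex.exp ((-(v / 2) * s ^ 2 : ℝ) : ℂ) := by
    rw [charFun_gaussianReal, Real.coe_toNNReal _ hv0.le]
    push_cast
    ring_nf
  have hone := hsq 1
  rw [one_mul, one_mul] at hone
  rw [hsq, hsq, hone, habs] at h
  rw [H.charFun_map_eq, hgauss]
  convert h using 1
  ring

theorem tendstoInDistribution (H : QuasiPower P S ℓ δ C) (hv0 : 0 < v)
    (hv : deriv (deriv ℓ) 0 = v) :
    TendstoInDistribution (fun (t : ℕ) ω => S t ω / √(t : ℝ)) atTop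
      (id : ℝ → ℝ) (fun _ => P) (gaussianReal 0 (Real.toNNReal v)) where
  forall_aemeasurable t := (H.aemeasurable t).div_const _
  tendsto := by
    refine ProbabilityMeasure.tendsto_iff_tendsto_charFun.2 fun s => ?_
    obtain ⟨c, B, hc, -, hchar⟩ := H.exists_norm_charFun_sub_le hv0 hv
    simp only [ProbabilityMeasure.coe_mk, Measure.map_id]
    rw [tendsto_iff_norm_sub_tendsto_zero]
    have hsqrt : Tendsto (fun t : ℕ => √(t : ℝ)) atTop atTop :=
      Real.tendsto_sqrt_atTop.comp tendsto_natCast_atTop_atTop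
    have hlim := (hsqrt.const_div_atTop B).mul_const
      (|s| * ((1 + s ^ 2) * Real.exp (-(v / 4) * s ^ 2)))
    rw [zero_mul] at hlim
    refine squeeze_zero' (Eventually.of_forall fun _ => norm_nonneg _) ?_ hlim
    filter_upwards [eventually_ge_atTop 1, hsqrt.eventually_ge_atTop (|s| / c)] with t ht hts
    exact hchar t ht s (by rwa [div_le_iff₀' hc] at hts)

end QuasiPower

end CharFunEstimate

section BerryEsseen

lemma gaussianReal_real_Iic_eq_integral (m : ℝ) {v : NNReal} (hv : v ≠ 0) (x : ℝ) :
    (gaussianReal m v).real (Iic x) = ∫ u in Iic x, gaussianPDFReal m v u := by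
  rw [Measure.real, gaussianReal_apply_eq_integral _ hv, ENNReal.toReal_ofReal]
  exact integral_nonneg fun u => gaussianPDFReal_nonneg _ _ _

lemma gaussianPDFReal_le (m : ℝ) (v : NNReal) (u : ℝ) :
    gaussianPDFReal m v u ≤ (√(2 * Real.pi * v))⁻¹ := by
  rw [gaussianPDFReal]
  refine mul_le_of_le_one_right (by positivity) (Real.exp_le_one_iff.2 ?_)
  exact div_nonpos_of_nonpos_of_nonneg (neg_nonpos.2 (sq_nonneg _)) (by positivity)

lemma gaussianReal_real_Iic_sub_le (m : ℝ) {v : NNReal} (hv : v ≠ 0) {x y : ℝ} (hxy : x ≤ y) :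
    (gaussianReal m v).real (Iic y) - (gaussianReal m v).real (Iic x) ≤
      (√(2 * Real.pi * v))⁻¹ * (y - x) := by
  have hint := integrable_gaussianPDFReal m v
  rw [gaussianReal_real_Iic_eq_integral m hv, gaussianReal_real_Iic_eq_integral m hv,
    intervalIntegral.integral_Iic_sub_Iic hint.integrableOn hint.integrableOn]
  calc ∫ u in x..y, gaussianPDFReal m v u ≤ ∫ u in x..y, (√(2 * Real.pi * v))⁻¹ :=
        intervalIntegral.integral_mono_on hxy hint.intervalIntegrable (by simp)
          fun u _ => gaussianPDFReal_le m v u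
    _ = _ := by rw [intervalIntegral.integral_const, smul_eq_mul, mul_comm]

lemma integrable_one_add_sq_mul_exp_neg_mul_sq {b : ℝ} (hb : 0 < b) :
    Integrable fun s : ℝ => (1 + s ^ 2) * Real.exp (-b * s ^ 2) := by
  have hsq := integrable_rpow_mul_exp_neg_mul_sq hb (s := 2) (by norm_num)
  refine ((integrable_exp_neg_mul_sq hb).add hsq).congr (Eventually.of_forall fun s => ?_)
  simp only [Pi.add_apply, Real.rpow_two]
  ring

lemma intervalIntegral_div_le_of_le_mul {f ψ : ℝ → ℝ} {K T : ℝ} (hT : 0 ≤ T) (hK : 0 ≤ K)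
    (hψ : Integrable ψ) (hψ0 : ∀ s, 0 ≤ ψ s) (hf0 : ∀ s ∈ Ioc 0 T, 0 ≤ f s)
    (hf : ∀ s ∈ Ioc 0 T, f s ≤ K * (s * ψ s)) :
    ∫ s in (0 : ℝ)..T, f s / s ≤ K * ∫ s, ψ s := by
  rw [intervalIntegral.integral_of_le hT]
  calc ∫ s in Ioc 0 T, f s / s ≤ ∫ s in Ioc 0 T, K * ψ s := by
        refine integral_mono_of_nonneg ?_ (hψ.const_mul K).integrableOn ?_ <;>
          filter_upwards [ae_restrict_mem measurableSet_Ioc] with s hs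
        · exact div_nonneg (hf0 s hs) hs.1.le
        · rw [div_le_iff₀ hs.1]
          exact (hf s hs).trans_eq (by ring)
    _ ≤ K * ∫ s, ψ s := by
        rw [integral_const_mul]
        exact mul_le_mul_of_nonneg_left
          (setIntegral_le_integral hψ (Eventually.of_forall hψ0)) hK

variable {Ω : Type*} [MeasurableSpace Ω] {P : Measure Ω} [IsProbabilityMeasure P] {S : ℕ → Ω → ℝ}
  {ℓ : ℂ → ℂ} {δ C v : ℝ}

theorem QuasiPower.berry_esseen (H : QuasiPower P S ℓ δ C) (hv0 : 0 < v)
    (hv : deriv (deriv ℓ) 0 = v) :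
    ∃ D : ℝ, 0 < D ∧ ∀ t : ℕ, 1 ≤ t → ∀ r : ℝ,
      |P.real {ω | S t ω / √(t : ℝ) ≤ r} - (gaussianReal 0 (Real.toNNReal v)).real (Iic r)|
        ≤ D / √(t : ℝ) := by
  obtain ⟨c, B, hc, hB, hchar⟩ := H.exists_norm_charFun_sub_le hv0 hv
  have hA := integral_fejer_pos
  have hvN := Real.toNNReal_pos.2 hv0
  set ψ : ℝ → ℝ := fun s => (1 + s ^ 2) * Real.exp (-(v / 4) * s ^ 2)
  have hψ0 : ∀ s, 0 ≤ ψ s := fun s => by positivity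
  have hψ : Integrable ψ := integrable_one_add_sq_mul_exp_neg_mul_sq (by positivity)
  set J := ∫ s, ψ s
  have hJ : 0 ≤ J := integral_nonneg hψ0
  set m : ℝ := (√(2 * Real.pi * (Real.toNNReal v : NNReal)))⁻¹
  have hm : 0 < m := by positivity
  refine ⟨4 / 3 * (B * J / (∫ u, fejer u) + 64 * m / (∫ u, fejer u) / c), by positivity,
    fun t ht r => ?_⟩
  have : 0 < √(t : ℝ) := Real.sqrt_pos.2 (by exact_mod_cast ht)
  have hae : AEMeasurable (fun ω => S t ω / √(t : ℝ)) P := (H.aemeasurable t).div_const _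
  have := Measure.isProbabilityMeasure_map hae
  have hint : Integrable (fun y => y) (P.map fun ω => S t ω / √(t : ℝ)) :=
    (integrable_map_measure measurable_id.aestronglyMeasurable hae).2 ((H.integrable t).div_const _)
  have hgauss : Integrable (fun y => y) (gaussianReal 0 (Real.toNNReal v)) :=
    (memLp_id_gaussianReal 1).integrable (by norm_num)
  have hesseen := abs_measureReal_Iic_sub_le_integral_charFun hint hgauss hm
    (fun x y => gaussianReal_real_Iic_sub_le 0 hvN.ne') (T := c * √(t : ℝ)) (by positivity) r
  have hintegral := intervalIntegral_div_le_of_le_mul (T := c * √(t : ℝ)) (K := B / √(t : ℝ))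
    (by positivity) (by positivity) hψ hψ0 (fun s _ => norm_nonneg _) fun s hs =>
      (hchar t ht s ((abs_of_pos hs.1).trans_le hs.2)).trans_eq (by rw [abs_of_pos hs.1])
  rw [map_measureReal_apply_of_aemeasurable hae measurableSet_Iic] at hesseen
  calc _ ≤ 4 / 3 * (B / √(t : ℝ) * J / (∫ u, fejer u) +
        64 * m / (∫ u, fejer u) / (c * √(t : ℝ))) := hesseen.trans (by gcongr)
    _ = _ := by field_simp

end BerryEsseen

/-! ### Legendre duality on the line -/

section Legendre

lemma intervalIntegral_add_mul_sub_le {ψ : ℝ → ℝ} (hψ : Monotone ψ) (x z w : ℝ) :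
    (∫ u in x..z, ψ u) + ψ z * (w - z) ≤ ∫ u in x..w, ψ u := by
  have hi : ∀ a b, IntervalIntegrable ψ volume a b := fun a b => hψ.intervalIntegrable
  have hconst : ∫ _ in z..w, ψ z = ψ z * (w - z) := by
    rw [intervalIntegral.integral_const, smul_eq_mul, mul_comm]
  rw [← intervalIntegral.integral_add_adjacent_intervals (hi x z) (hi z w), ← hconst]
  gcongr
  rcases le_total z w with h | h
  · exact intervalIntegral.integral_mono_on h (by simp) (hi _ _) fun u hu => hψ hu.1
  · rw [intervalIntegral.integral_symm w z, intervalIntegral.integral_symm w z]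
    exact neg_le_neg (intervalIntegral.integral_mono_on h (hi _ _) (by simp) fun u hu => hψ hu.2)

lemma hasDerivAt_of_continuousAt_of_add_mul_sub_le {R ζ : ℝ → ℝ} {x : ℝ}
    (hR : ∀ x y, R x + ζ x * (y - x) ≤ R y) (hζ : ContinuousAt ζ x) : HasDerivAt R (ζ x) x := by
  rw [hasDerivAt_iff_isLittleO, Asymptotics.isLittleO_iff]
  intro c hc
  filter_upwards [Metric.continuousAt_iff'.1 hζ c hc] with y hy
  rw [Real.dist_eq] at hy
  simp only [Real.norm_eq_abs, smul_eq_mul]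
  calc |R y - R x - (y - x) * ζ x| ≤ |(ζ y - ζ x) * (y - x)| := by
        rw [abs_of_nonneg (by linarith [hR x y])]
        exact le_trans (by linarith [hR y x]) (le_abs_self _)
    _ ≤ c * |y - x| := by rw [abs_mul]; gcongr

/-- The Legendre transform of `x ↦ ∫ u in 0..x, ψ u`, for an increasing bijection `ψ` of the line:
the supremum of `z * x - ∫ u in 0..z, ψ u` over `z` is attained where `ψ z = x`. -/
def legendre (ψ : ℝ ≃o ℝ) (x : ℝ) : ℝ := ψ.symm x * x - ∫ u in (0 : ℝ)..ψ.symm x, ψ u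

namespace legendre

variable (ψ : ℝ ≃o ℝ)

lemma apply_map (z : ℝ) : legendre ψ (ψ z) = z * ψ z - ∫ u in (0 : ℝ)..z, ψ u := by
  rw [legendre, ψ.symm_apply_apply]

lemma add_mul_sub_le (x y : ℝ) : legendre ψ x + ψ.symm x * (y - x) ≤ legendre ψ y := by
  have := intervalIntegral_add_mul_sub_le ψ.monotone 0 (ψ.symm y) (ψ.symm x)
  rw [ψ.apply_symm_apply] at this
  simp only [legendre]
  linarith

lemma hasDerivAt (x : ℝ) : HasDerivAt (legendre ψ) (ψ.symm x) x :=
  hasDerivAt_of_continuousAt_of_add_mul_sub_le (add_mul_sub_le ψ) ψ.symm.continuous.continuousAt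

lemma continuous : Continuous (legendre ψ) :=
  continuous_iff_continuousAt.2 fun x => (hasDerivAt ψ x).continuousAt

lemma strictConvexOn : StrictConvexOn ℝ univ (legendre ψ) := by
  refine StrictMono.strictConvexOn_univ_of_deriv (continuous ψ) ?_
  rw [funext fun x => (hasDerivAt ψ x).deriv]
  exact ψ.symm.strictMono

variable {ψ} (hψ : ψ 0 = 0)
include hψ

lemma map_zero : legendre ψ 0 = 0 := by simpa [hψ] using apply_map ψ 0

lemma nonneg (x : ℝ) : 0 ≤ legendre ψ x := by
  have h := add_mul_sub_le ψ 0 x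
  rwa [map_zero hψ, ψ.symm_apply_eq.2 hψ.symm, zero_mul, zero_add] at h

lemma eq_zero_iff {x : ℝ} : legendre ψ x = 0 ↔ x = 0 := by
  have h0 := map_zero hψ
  refine ⟨fun hx => ?_, fun hx => hx ▸ h0⟩
  by_contra hne
  have := (strictConvexOn ψ).2 (mem_univ x) (mem_univ 0) hne one_half_pos one_half_pos
    (add_halves 1)
  simp only [hx, h0, smul_zero, add_zero] at this
  exact this.not_ge (nonneg hψ _)

end legendre

lemma monotone_sub_projIcc {a b : ℝ} (h : a ≤ b) :
    Monotone fun z : ℝ => z - (projIcc a b h z : ℝ) := by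
  intro x y hxy
  simp only [coe_projIcc]
  rcases max_cases a (min b x) with h1 | h1 <;> rcases max_cases a (min b y) with h2 | h2 <;>
    rcases min_cases b x with h3 | h3 <;> rcases min_cases b y with h4 | h4 <;> linarith

lemma exists_orderIso_eqOn_Icc {f : ℝ → ℝ} {a b : ℝ} (hab : a ≤ b)
    (hc : ContinuousOn f (Icc a b)) (hm : StrictMonoOn f (Icc a b)) :
    ∃ ψ : ℝ ≃o ℝ, EqOn ψ f (Icc a b) := by
  set p : ℝ → ℝ := fun z => projIcc a b hab z
  have hp_mem : ∀ z, p z ∈ Icc a b := fun z => (projIcc a b hab z).2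
  have hp_cont : Continuous p := continuous_subtype_val.comp continuous_projIcc
  have hψ_cont : Continuous fun z => f (p z) + (z - p z) :=
    (hc.comp_continuous hp_cont hp_mem).add (continuous_id.sub hp_cont)
  have hψ_mono : StrictMono fun z => f (p z) + (z - p z) := by
    intro x y hxy
    rcases (show p x ≤ p y from monotone_projIcc hab hxy.le).eq_or_lt with h | h
    · simp only [h]
      linarith
    · exact add_lt_add_of_lt_of_le (hm (hp_mem x) (hp_mem y) h)
        (monotone_sub_projIcc hab hxy.le)
  have hψ_surj : Function.Surjective fun z => f (p z) + (z - p z) := by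
    refine hψ_cont.surjective ?_ ?_
    · refine tendsto_atTop_mono (fun z => ?_)
        (tendsto_atTop_add_const_right atTop (f a - b) tendsto_id)
      have := hm.monotoneOn (left_mem_Icc.2 hab) (hp_mem z) (hp_mem z).1
      simp only [id]
      linarith [(hp_mem z).2]
    · refine tendsto_atBot_mono (fun z => ?_)
        (tendsto_atBot_add_const_right atBot (f b - a) tendsto_id)
      have := hm.monotoneOn (hp_mem z) (right_mem_Icc.2 hab) (hp_mem z).2
      simp only [id]
      linarith [(hp_mem z).1]
  refine ⟨hψ_mono.orderIsoOfSurjective _ hψ_surj, fun z hz => ?_⟩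
  have : p z = z := congrArg Subtype.val (projIcc_of_mem hab hz)
  simp only [StrictMono.coe_orderIsoOfSurjective, this, sub_self, add_zero]

end Legendre

/-! ### Large deviations -/

section LargeDeviations

lemma add_mul_sub_lt_of_strictConvexOn {s : Set ℝ} {f : ℝ → ℝ} {x y f' : ℝ}
    (hf : StrictConvexOn ℝ s f) (hx : x ∈ s) (hy : y ∈ s) (hxy : x ≠ y)
    (hf' : HasDerivAt f f' x) : f x + f' * (y - x) < f y := by
  rcases lt_or_gt_of_ne hxy with h | h
  · have := hf.lt_slope_of_hasDerivAt hx hy h hf'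
    rw [slope_def_field, lt_div_iff₀ (by linarith)] at this
    linarith
  · have := hf.slope_lt_of_hasDerivAt hy hx h hf'
    rw [slope_def_field, div_lt_iff₀ (by linarith)] at this
    linarith

lemma tendsto_one_div_mul_log {p : ℕ → ℝ} {A R : ℝ} (hA : 0 < A)
    (hupper : ∀ t, p t ≤ A * Real.exp (-(t * R)))
    (hlower : ∀ γ > R, ∃ B > 0, ∀ᶠ t : ℕ in atTop, B * Real.exp (-(t * γ)) ≤ p t) :
    Tendsto (fun t : ℕ => 1 / (t : ℝ) * Real.log (p t)) atTop (𝓝 (-R)) := by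
  have hconst : ∀ c : ℝ, Tendsto (fun t : ℕ => 1 / (t : ℝ) * c) atTop (𝓝 0) := fun c => by
    simpa using tendsto_one_div_atTop_nhds_zero_nat.mul_const c
  have hlog : ∀ {B γ : ℝ} {t : ℕ}, 0 < B → 0 < t →
      1 / (t : ℝ) * Real.log (B * Real.exp (-(t * γ))) = 1 / (t : ℝ) * Real.log B - γ := by
    intro B γ t hB ht
    have : (0 : ℝ) < t := by exact_mod_cast ht
    rw [Real.log_mul hB.ne' (Real.exp_pos _).ne', Real.log_exp]
    field_simp
    ring
  refine tendsto_order.2 ⟨fun b hb => ?_, fun b hb => ?_⟩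
  · obtain ⟨γ, hRγ, hγb⟩ := exists_between (show R < -b by linarith)
    obtain ⟨B, hB, hev⟩ := hlower γ hRγ
    filter_upwards [hev, (hconst (Real.log B)).eventually_const_lt (show b + γ < 0 by linarith),
      eventually_gt_atTop 0] with t hp ht ht0
    calc b < 1 / (t : ℝ) * Real.log B - γ := by linarith
      _ = 1 / (t : ℝ) * Real.log (B * Real.exp (-(t * γ))) := (hlog hB ht0).symm
      _ ≤ 1 / (t : ℝ) * Real.log (p t) := by gcongr
  · obtain ⟨B, hB, hev⟩ := hlower (R + 1) (lt_add_one R)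
    filter_upwards [hev, (hconst (Real.log A)).eventually_lt_const (show 0 < b + R by linarith),
      eventually_gt_atTop 0] with t hp ht ht0
    have hpos : 0 < p t := lt_of_lt_of_le (by positivity) hp
    calc 1 / (t : ℝ) * Real.log (p t)
        ≤ 1 / (t : ℝ) * Real.log (A * Real.exp (-(t * R))) := by
          gcongr
          exact hupper t
      _ = 1 / (t : ℝ) * Real.log A - R := hlog hA ht0
      _ < b := by linarith

lemma exp_mul_le_add_indicator_add {x y z α β : ℝ} (hxy : x ≤ y) (hyz : y ≤ z) (hy : 0 ≤ y)
    (u : ℝ) :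
    Real.exp (y * u) ≤ Real.exp ((y - x) * α) * Real.exp (x * u) +
      Real.exp (y * β) * (Ioi α).indicator 1 u + Real.exp (-(z - y) * β) * Real.exp (z * u) := by
  have hleft := mul_pos (Real.exp_pos ((y - x) * α)) (Real.exp_pos (x * u))
  have hright := mul_pos (Real.exp_pos (-(z - y) * β)) (Real.exp_pos (z * u))
  have hmid : 0 ≤ Real.exp (y * β) * (Ioi α).indicator 1 u :=
    mul_nonneg (Real.exp_pos _).le (indicator_nonneg (fun _ _ => zero_le_one) _)
  rcases le_or_gt u α with hα | hα
  · have : Real.exp (y * u) ≤ Real.exp ((y - x) * α) * Real.exp (x * u) := by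
      rw [← Real.exp_add, Real.exp_le_exp]
      nlinarith
    linarith
  rcases le_or_gt u β with hβ | hβ
  · have : Real.exp (y * u) ≤ Real.exp (y * β) * (Ioi α).indicator 1 u := by
      rw [indicator_of_mem (mem_Ioi.2 hα), Pi.one_apply, mul_one]
      gcongr
    linarith
  · have : Real.exp (y * u) ≤ Real.exp (-(z - y) * β) * Real.exp (z * u) := by
      rw [← Real.exp_add, Real.exp_le_exp]
      nlinarith
    linarith

variable {Ω : Type*} [MeasurableSpace Ω] {P : Measure Ω} [IsFiniteMeasure P] {X : Ω → ℝ}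

lemma mgf_le_add_measureReal_add (hX : AEMeasurable X P) {x y z α β : ℝ} (hxy : x ≤ y)
    (hyz : y ≤ z) (hy : 0 ≤ y) (hintx : x ∈ integrableExpSet X P)
    (hintz : z ∈ integrableExpSet X P) :
    mgf X P y ≤ Real.exp ((y - x) * α) * mgf X P x + Real.exp (y * β) * P.real {ω | α < X ω} +
      Real.exp (-(z - y) * β) * mgf X P z := by
  have hms : NullMeasurableSet {ω | α < X ω} P := nullMeasurableSet_lt aemeasurable_const hX
  have hind : Integrable (fun ω => (Ioi α).indicator (1 : ℝ → ℝ) (X ω)) P :=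
    (integrable_const (1 : ℝ)).indicator₀ hms
  have hP : ∫ ω, (Ioi α).indicator (1 : ℝ → ℝ) (X ω) ∂P = P.real {ω | α < X ω} :=
    (integral_indicator₀ (f := fun _ => (1 : ℝ)) hms).trans (by simp)
  have hinty : y ∈ integrableExpSet X P :=
    convex_integrableExpSet.ordConnected.out hintx hintz ⟨hxy, hyz⟩
  have hxu := Integrable.const_mul hintx (Real.exp ((y - x) * α))
  have hzu := Integrable.const_mul hintz (Real.exp (-(z - y) * β))
  have hu := hind.const_mul (Real.exp (y * β))
  calc mgf X P y ≤ ∫ ω, (Real.exp ((y - x) * α) * Real.exp (x * X ω) +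
          Real.exp (y * β) * (Ioi α).indicator (1 : ℝ → ℝ) (X ω) +
          Real.exp (-(z - y) * β) * Real.exp (z * X ω)) ∂P :=
        integral_mono hinty ((hxu.add hu).add hzu) fun ω =>
          exp_mul_le_add_indicator_add hxy hyz hy (X ω)
    _ = _ := by
        rw [integral_add (by exact hxu.add hu) hzu, integral_add hxu hu, integral_const_mul,
          integral_const_mul, integral_const_mul, hP]
        rfl

lemma eventually_exp_mul_mul_le {M : ℕ → ℝ} {B c ε L L' : ℝ} (hε : 0 < ε)
    (hM : ∀ t : ℕ, M t ≤ B * Real.exp (t * L)) (hc : L + c < L') :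
    ∀ᶠ t : ℕ in atTop, Real.exp (t * c) * M t ≤ ε * Real.exp (t * L') := by
  have exponent_tendsto : Tendsto (fun t : ℕ => (t : ℝ) * (L + c - L')) atTop atBot :=
    tendsto_natCast_atTop_atTop.atTop_mul_const_of_neg (by linarith)
  have tendsto_zero := (Real.tendsto_exp_atBot.comp exponent_tendsto).const_mul B
  rw [mul_zero] at tendsto_zero
  filter_upwards [tendsto_zero.eventually_le_const hε] with t ht
  calc Real.exp (t * c) * M t ≤ Real.exp (t * c) * (B * Real.exp (t * L)) := by
        gcongr
        exact hM t
    _ = B * Real.exp (t * (L + c - L')) * Real.exp (t * L') := by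
        rw [mul_left_comm, mul_assoc, ← Real.exp_add, ← Real.exp_add]
        ring_nf
    _ ≤ ε * Real.exp (t * L') := by
        gcongr
        exact ht

lemma eventually_le_measureReal {S : ℕ → Ω → ℝ} (hS : ∀ t, AEMeasurable (S t) P)
    {Λ : ℝ → ℝ} {A B x y z α β : ℝ} (hA : 0 < A) (hxy : x ≤ y) (hyz : y ≤ z) (hy : 0 ≤ y)
    (hintx : ∀ t, x ∈ integrableExpSet (S t) P) (hintz : ∀ t, z ∈ integrableExpSet (S t) P)
    (hlow : ∀ t : ℕ, A * Real.exp (t * Λ y) ≤ mgf (S t) P y)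
    (huppx : ∀ t : ℕ, mgf (S t) P x ≤ B * Real.exp (t * Λ x))
    (huppz : ∀ t : ℕ, mgf (S t) P z ≤ B * Real.exp (t * Λ z))
    (hα : Λ x + α * (y - x) < Λ y) (hβ : Λ z + β * (y - z) < Λ y) :
    ∀ᶠ t : ℕ in atTop, A / 2 * Real.exp (-(t * (y * β - Λ y))) ≤
      P.real {ω | (t : ℝ) * α < S t ω} := by
  filter_upwards [eventually_exp_mul_mul_le (by positivity : 0 < A / 4) huppx hα,
    eventually_exp_mul_mul_le (by positivity : 0 < A / 4) huppz hβ] with t hx hz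
  have hmgf := mgf_le_add_measureReal_add (hS t) (α := t * α) (β := t * β) hxy hyz hy (hintx t)
    (hintz t)
  rw [show (y - x) * (t * α) = t * (α * (y - x)) by ring,
    show -(z - y) * (t * β) = t * (β * (y - z)) by ring] at hmgf
  set p := P.real {ω | (t : ℝ) * α < S t ω}
  set E := Real.exp (t * Λ y) with hE
  have hp : A / 2 * E ≤ Real.exp (y * (t * β)) * p := by linarith [hlow t]
  calc A / 2 * Real.exp (-(t * (y * β - Λ y))) = A / 2 * E * Real.exp (-(y * (t * β))) := by
        rw [hE, mul_assoc, ← Real.exp_add]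
        ring_nf
    _ ≤ Real.exp (y * (t * β)) * p * Real.exp (-(y * (t * β))) := by gcongr
    _ = p := by rw [mul_right_comm, ← Real.exp_add, add_neg_cancel, Real.exp_zero, one_mul]

lemma measureReal_lt_le_exp {Y : Ω → ℝ} {B L z s t : ℝ} (hz : 0 ≤ z)
    (hint : z ∈ integrableExpSet Y P) (hupp : mgf Y P z ≤ B * Real.exp (t * L)) :
    P.real {ω | t * s < Y ω} ≤ B * Real.exp (-(t * (z * s - L))) :=
  calc P.real {ω | t * s < Y ω} ≤ P.real {ω | t * s ≤ Y ω} :=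
        measureReal_mono fun ω (hω : t * s < Y ω) => hω.le
    _ ≤ Real.exp (-z * (t * s)) * mgf Y P z := measure_ge_le_exp_mul_mgf _ hz hint
    _ ≤ Real.exp (-z * (t * s)) * (B * Real.exp (t * L)) := by gcongr
    _ = B * Real.exp (-(t * (z * s - L))) := by
        rw [mul_left_comm, ← Real.exp_add]
        ring_nf

/-- A local Gärtner–Ellis theorem on the line. The lower bound comes from the tilted measures
`exp (y * S t) P` with `y` slightly larger than `z`: strict convexity of `Λ` makes them concentrate
on `{t * ψ z < S t ≤ t * ψ s}` for `s` slightly larger than `y`. -/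
theorem tendsto_log_measureReal {S : ℕ → Ω → ℝ} (hS : ∀ t, AEMeasurable (S t) P) {a A B : ℝ}
    (hint : ∀ t, ∀ x ∈ Icc 0 a, x ∈ integrableExpSet (S t) P) {Λ ψ : ℝ → ℝ} (hA : 0 < A)
    (hB : 0 < B)
    (hlow : ∀ t : ℕ, ∀ x ∈ Icc 0 a, A * Real.exp (t * Λ x) ≤ mgf (S t) P x)
    (hupp : ∀ t : ℕ, ∀ x ∈ Icc 0 a, mgf (S t) P x ≤ B * Real.exp (t * Λ x))
    (hΛ : ContinuousOn Λ (Icc 0 a)) (hψ : ContinuousOn ψ (Icc 0 a))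
    (htan : ∀ x ∈ Icc 0 a, ∀ y ∈ Icc 0 a, x ≠ y → Λ x + ψ x * (y - x) < Λ y)
    {z : ℝ} (hz0 : 0 < z) (hza : z < a) :
    Tendsto (fun t : ℕ => 1 / (t : ℝ) * Real.log (P.real {ω | (t : ℝ) * ψ z < S t ω}))
      atTop (𝓝 (-(z * ψ z - Λ z))) := by
  have hz : z ∈ Icc 0 a := ⟨hz0.le, hza.le⟩
  refine tendsto_one_div_mul_log hB (fun t => ?_) fun γ hγ => ⟨A / 2, half_pos hA, ?_⟩
  · exact measureReal_lt_le_exp hz0.le (hint t z hz) (hupp t z hz)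
  · have hmid : (z + z) / 2 = z := add_self_div_two z
    have hnhds : Icc 0 a ∈ 𝓝 z := Icc_mem_nhds hz0 hza
    have hcont : ContinuousAt (fun s => (z + s) / 2 * ψ s - Λ ((z + s) / 2)) z := by
      have h1 : ContinuousAt (fun s : ℝ => (z + s) / 2) z := by fun_prop
      exact (h1.mul (hψ.continuousAt hnhds)).sub
        (ContinuousAt.comp (g := Λ) (by rw [hmid]; exact hΛ.continuousAt hnhds) h1)
    have hclose : ∀ᶠ s in 𝓝 z, (z + s) / 2 * ψ s - Λ ((z + s) / 2) < γ :=
      hcont.eventually_lt continuousAt_const (by simpa only [hmid] using hγ)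
    have hright : ∀ᶠ s in 𝓝[>] z,
        ((z + s) / 2 * ψ s - Λ ((z + s) / 2) < γ ∧ s < a) ∧ s ∈ Ioi z :=
      ((hclose.and (eventually_lt_nhds hza)).filter_mono nhdsWithin_le_nhds).and
        self_mem_nhdsWithin
    obtain ⟨s, ⟨hsγ, hsa⟩, hzs⟩ := hright.exists
    have hzy : z < (z + s) / 2 := left_lt_add_div_two.2 hzs
    have hys : (z + s) / 2 < s := add_div_two_lt_right.2 hzs
    have hs : s ∈ Icc 0 a := ⟨(hz0.trans hzs).le, hsa.le⟩
    have hy : (z + s) / 2 ∈ Icc 0 a := ⟨(hz0.trans hzy).le, (hys.trans hsa).le⟩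
    filter_upwards [eventually_le_measureReal hS hA hzy.le hys.le hy.1
      (fun t => hint t z hz) (fun t => hint t s hs) (fun t => hlow t _ hy)
      (fun t => hupp t z hz) (fun t => hupp t s hs) (htan z hz _ hy hzy.ne)
      (htan s hs _ hy hys.ne')] with t ht
    refine le_trans ?_ ht
    gcongr

end LargeDeviations

namespace QuasiPower

variable {Ω : Type*} [MeasurableSpace Ω] {P : Measure Ω} {S : ℕ → Ω → ℝ}
  {ℓ : ℂ → ℂ} {δ C v a : ℝ}

lemma abs_mgf_sub_exp_le (H : QuasiPower P S ℓ δ C) (t : ℕ) {x : ℝ} (hx : |x| < δ) :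
    |mgf (S t) P x - Real.exp (t * (ℓ x).re)| ≤ C * |x| * Real.exp (t * (ℓ x).re) := by
  have hball : (x : ℂ) ∈ Metric.ball (0 : ℂ) δ := by
    rwa [mem_ball_zero_iff, Complex.norm_real, Real.norm_eq_abs]
  have hnorm : ‖Complex.exp (t * ℓ x)‖ = Real.exp (t * (ℓ x).re) := by
    rw [Complex.norm_exp, ← Complex.ofReal_natCast, Complex.re_ofReal_mul]
  have h := H.bound t x hball
  rw [complexMGF_ofReal, hnorm, Complex.norm_real, Real.norm_eq_abs] at h
  have h1 := abs_norm_sub_norm_le (mgf (S t) P x : ℂ) (Complex.exp (t * ℓ x))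
  rw [Complex.norm_of_nonneg mgf_nonneg, hnorm] at h1
  exact h1.trans h

/-- Near `0` the function `ℓ` is uniformly convex on the real line, and the relative error of the
moment generating function is at most `1 / 2`. -/
lemma exists_radius (H : QuasiPower P S ℓ δ C) (hv0 : 0 < v) (hv : deriv (deriv ℓ) 0 = v) :
    ∃ a : ℝ, 0 < a ∧ a < δ ∧ C * a ≤ 1 / 2 ∧ ∀ x ∈ Icc 0 a, 0 < (deriv (deriv ℓ) x).re := by
  have hcont : Tendsto (fun x : ℝ => (deriv (deriv ℓ) x).re) (𝓝 0) (𝓝 v) := by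
    have h := Complex.continuous_re.continuousAt.comp (x := (0 : ℂ))
      H.analyticAt_zero.deriv.deriv.continuousAt
    have h2 : ContinuousAt (fun x : ℝ => (deriv (deriv ℓ) x).re) 0 :=
      ContinuousAt.comp (g := fun z : ℂ => (deriv (deriv ℓ) z).re) (by exact_mod_cast h)
        Complex.continuous_ofReal.continuousAt
    simpa [ContinuousAt, hv] using h2
  have hC : Tendsto (fun x : ℝ => C * x) (𝓝 0) (𝓝 0) := by
    simpa using (continuous_const_mul C).tendsto 0
  obtain ⟨r, hr, hball⟩ := Metric.eventually_nhds_iff_ball.1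
    ((hcont.eventually_const_lt hv0).and ((hC.eventually_lt_const one_half_pos).and
      (eventually_lt_nhds H.δ_pos)))
  have hmem : ∀ x ∈ Icc 0 (r / 2), x ∈ Metric.ball (0 : ℝ) r := fun x hx => by
    rw [mem_ball_zero_iff, Real.norm_of_nonneg hx.1]
    linarith [hx.2]
  have hlast := hball _ (hmem (r / 2) ⟨by positivity, le_rfl⟩)
  exact ⟨r / 2, by positivity, hlast.2.2, hlast.2.1.le, fun x hx => (hball x (hmem x hx)).1⟩

lemma analyticAt_ofReal (H : QuasiPower P S ℓ δ C) (ha : a < δ) {x : ℝ} (hx : x ∈ Icc 0 a) :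
    AnalyticAt ℂ ℓ x := by
  refine H.analyticAt ?_
  rw [mem_ball_zero_iff, Complex.norm_of_nonneg hx.1]
  exact hx.2.trans_lt ha

lemma hasDerivAt_re (H : QuasiPower P S ℓ δ C) (ha : a < δ) {x : ℝ} (hx : x ∈ Icc 0 a) :
    HasDerivAt (fun x : ℝ => (ℓ x).re) (deriv ℓ x).re x :=
  (H.analyticAt_ofReal ha hx).differentiableAt.hasDerivAt.real_of_complex

lemma continuousOn_re_deriv (H : QuasiPower P S ℓ δ C) (ha : a < δ) :
    ContinuousOn (fun x : ℝ => (deriv ℓ x).re) (Icc 0 a) := fun _ hx =>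
  (H.analyticAt_ofReal ha hx).deriv.differentiableAt.hasDerivAt.real_of_complex
    |>.continuousAt.continuousWithinAt

lemma strictMonoOn_re_deriv (H : QuasiPower P S ℓ δ C) (ha : a < δ)
    (hpos : ∀ x ∈ Icc 0 a, 0 < (deriv (deriv ℓ) x).re) :
    StrictMonoOn (fun x : ℝ => (deriv ℓ x).re) (Icc 0 a) := by
  refine strictMonoOn_of_deriv_pos (convex_Icc 0 a) (H.continuousOn_re_deriv ha) fun x hx => ?_
  have hx := interior_subset hx
  rw [(H.analyticAt_ofReal ha hx).deriv.differentiableAt.hasDerivAt.real_of_complex.deriv]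
  exact hpos x hx

lemma strictConvexOn_re (H : QuasiPower P S ℓ δ C) (ha : a < δ)
    (hpos : ∀ x ∈ Icc 0 a, 0 < (deriv (deriv ℓ) x).re) :
    StrictConvexOn ℝ (Icc 0 a) fun x : ℝ => (ℓ x).re := by
  refine StrictMonoOn.strictConvexOn_of_deriv (convex_Icc 0 a)
    (fun x hx => (H.hasDerivAt_re ha hx).continuousAt.continuousWithinAt) ?_
  exact ((H.strictMonoOn_re_deriv ha hpos).mono interior_subset).congr fun x hx =>
    (H.hasDerivAt_re ha (interior_subset hx)).deriv.symm

lemma integral_eq_re (H : QuasiPower P S ℓ δ C) (ha : a < δ) {ψ : ℝ → ℝ} (hψ : Continuous ψ)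
    (hψℓ : EqOn ψ (fun x : ℝ => (deriv ℓ x).re) (Icc 0 a)) {z : ℝ} (hz : z ∈ Icc 0 a) :
    ∫ u in (0 : ℝ)..z, ψ u = (ℓ z).re := by
  rw [intervalIntegral.integral_eq_sub_of_hasDerivAt (f := fun x : ℝ => (ℓ x).re) (fun u hu => ?_)
    (hψ.intervalIntegrable _ _)]
  · simp [H.map_zero]
  · rw [uIcc_of_le hz.1] at hu
    have hu : u ∈ Icc 0 a := ⟨hu.1, hu.2.trans hz.2⟩
    rw [hψℓ hu]
    exact H.hasDerivAt_re ha hu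

theorem large_deviations [IsProbabilityMeasure P] (H : QuasiPower P S ℓ δ C) (hv0 : 0 < v)
    (hv : deriv (deriv ℓ) 0 = v) :
    ∃ R : ℝ → ℝ, (∀ x, 0 ≤ R x) ∧ Continuous R ∧ StrictConvexOn ℝ univ R ∧
      (∀ x, R x = 0 ↔ x = 0) ∧
      ∃ ε₀ : ℝ, 0 < ε₀ ∧ ∀ ε : ℝ, 0 < ε → ε < ε₀ →
        Tendsto (fun t : ℕ => (1 / (t : ℝ)) *
            Real.log (P.real {ω | (t : ℝ) * ε < S t ω})) atTop (𝓝 (-R ε)) := by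
  obtain ⟨a, ha0, haδ, haC, hpos⟩ := H.exists_radius hv0 hv
  obtain ⟨ψ, hψ⟩ := exists_orderIso_eqOn_Icc ha0.le (H.continuousOn_re_deriv haδ)
    (H.strictMonoOn_re_deriv haδ hpos)
  have hψ0 : ψ 0 = 0 := by simpa [H.deriv_zero] using hψ (left_mem_Icc.2 ha0.le)
  have hconv := H.strictConvexOn_re haδ hpos
  have hmgf : ∀ t : ℕ, ∀ x ∈ Icc 0 a, |mgf (S t) P x - Real.exp (t * (ℓ x).re)| ≤
      1 / 2 * Real.exp (t * (ℓ x).re) := fun t x hx => by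
    have habs : |x| ≤ a := (abs_of_nonneg hx.1).trans_le hx.2
    refine (H.abs_mgf_sub_exp_le t (habs.trans_lt haδ)).trans ?_
    gcongr
    exact (mul_le_mul_of_nonneg_left habs H.C_nonneg).trans haC
  refine ⟨legendre ψ, legendre.nonneg hψ0, legendre.continuous ψ, legendre.strictConvexOn ψ,
    fun _ => legendre.eq_zero_iff hψ0, ψ a, hψ0 ▸ ψ.strictMono ha0, fun ε hε hεa => ?_⟩
  obtain ⟨z, rfl⟩ := ψ.surjective ε
  have hz0 : 0 < z := ψ.lt_iff_lt.1 (by rwa [hψ0])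
  have hza : z < a := ψ.lt_iff_lt.1 hεa
  rw [legendre.apply_map, H.integral_eq_re haδ ψ.continuous hψ ⟨hz0.le, hza.le⟩]
  refine tendsto_log_measureReal (A := 1 / 2) (B := 3 / 2) (Λ := fun x : ℝ => (ℓ x).re)
    H.aemeasurable (fun t x _ => ?_) (by norm_num) (by norm_num)
    (fun t x hx => by linarith [(abs_le.1 (hmgf t x hx)).1])
    (fun t x hx => by linarith [(abs_le.1 (hmgf t x hx)).2])
    (fun x hx => (H.hasDerivAt_re haδ hx).continuousAt.continuousWithinAt)
    ψ.continuous.continuousOn (fun x hx y hy hxy => ?_) hz0 hza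
  · rw [H.integrableExpSet_eq_univ]
    exact mem_univ x
  · rw [hψ hx]
    exact add_mul_sub_lt_of_strictConvexOn hconv hx hy hxy (H.hasDerivAt_re haδ hx)

end QuasiPower

/-! ### Perturbation of operators with a spectral gap -/

/-- `U` fixes the unit vector `e`, preserves the functional `m` and contracts its kernel
exponentially fast. -/
structure SpectralGap {B : Type*} [NormedAddCommGroup B] [NormedSpace ℂ B] (U : B →L[ℂ] B)
    (m : B →L[ℂ] ℂ) (e : B) (C ρ : ℝ) : Prop where
  norm_unit : ‖e‖ ≤ 1
  map_unit : m e = 1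
  fix_unit : U e = e
  map_comp : ∀ f, m (U f) = m f
  norm_le : ∀ f, ‖U f‖ ≤ ‖f‖
  norm_map_le : ∀ f, ‖m f‖ ≤ ‖f‖
  C_pos : 0 < C
  ρ_nonneg : 0 ≤ ρ
  ρ_lt_one : ρ < 1
  decay : ∀ (n : ℕ) (f : B), m f = 0 → ‖(U ^ n) f‖ ≤ C * ρ ^ n * ‖f‖

lemma norm_log_sub_log_le {x y : ℂ} (hx : ‖x - 1‖ ≤ 1 / 2) (hy : ‖y - 1‖ ≤ 1 / 2) :
    ‖Complex.log x - Complex.log y‖ ≤ 2 * ‖x - y‖ := by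
  have hre : ∀ w ∈ Metric.closedBall (1 : ℂ) (1 / 2), 1 / 2 ≤ w.re := by
    intro w hw
    rw [mem_closedBall_iff_norm] at hw
    have h1 := (abs_le.1 ((Complex.abs_re_le_norm (w - 1)).trans hw)).1
    rw [Complex.sub_re, Complex.one_re] at h1
    linarith
  refine Convex.norm_image_sub_le_of_norm_hasDerivWithin_le
    (s := Metric.closedBall (1 : ℂ) (1 / 2))
    (f' := fun w => w⁻¹) (fun w hw => ?_) (fun w hw => ?_) (convex_closedBall _ _) ?_ ?_
  · exact (Complex.hasDerivAt_log (Or.inl (by linarith [hre w hw]))).hasDerivWithinAt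
  · rw [norm_inv]
    refine inv_le_of_inv_le₀ (by norm_num) ?_
    have := (hre w hw).trans ((le_abs_self _).trans (Complex.abs_re_le_norm w))
    linarith
  · rwa [mem_closedBall_iff_norm]
  · rwa [mem_closedBall_iff_norm]

lemma mem_slitPlane_of_norm_sub_one_le {x : ℂ} (hx : ‖x - 1‖ ≤ 1 / 2) : x ∈ Complex.slitPlane := by
  left
  have h := (abs_le.1 ((Complex.abs_re_le_norm _).trans hx)).1
  rw [Complex.sub_re, Complex.one_re] at h
  linarith

lemma exists_differentiableOn_norm_log_sub_le {lam : ℕ → ℂ → ℂ} {s : Set ℂ} {a : ℂ → ℝ} {A q : ℝ}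
    (hs : IsOpen s) (hq0 : 0 ≤ q) (hq1 : q < 1) (haA : ∀ z ∈ s, a z ≤ A)
    (hd : ∀ t, DifferentiableOn ℂ (lam t) s) (h1 : ∀ t, ∀ z ∈ s, ‖lam t z - 1‖ ≤ 1 / 2)
    (hstep : ∀ t, ∀ z ∈ s, ‖lam (t + 1) z - lam t z‖ ≤ a z * q ^ t) :
    ∃ ℓ : ℂ → ℂ, DifferentiableOn ℂ ℓ s ∧
      ∀ z ∈ s, ∀ t, ‖Complex.log (lam t z) - ℓ z‖ ≤ 2 * a z / (1 - q) * q ^ t := by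
  have hdist : ∀ z ∈ s, ∀ t, dist (Complex.log (lam t z)) (Complex.log (lam (t + 1) z)) ≤
      2 * a z * q ^ t := by
    intro z hz t
    rw [dist_comm, dist_eq_norm, mul_assoc]
    exact (norm_log_sub_log_le (h1 _ z hz) (h1 t z hz)).trans (by gcongr; exact hstep t z hz)
  have hlim : ∀ z ∈ s, ∃ w, Tendsto (fun t => Complex.log (lam t z)) atTop (𝓝 w) :=
    fun z hz => cauchySeq_tendsto_of_complete (cauchySeq_of_le_geometric q _ hq1 (hdist z hz))
  choose! ℓ hℓ using hlim
  have hbound : ∀ z ∈ s, ∀ t, ‖Complex.log (lam t z) - ℓ z‖ ≤ 2 * a z / (1 - q) * q ^ t := by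
    intro z hz t
    rw [← dist_eq_norm, div_mul_eq_mul_div]
    exact dist_le_of_le_geometric_of_tendsto q _ hq1 (hdist z hz) (hℓ z hz) t
  have hunif : TendstoUniformlyOn (fun t z => Complex.log (lam t z)) ℓ atTop s := by
    rw [Metric.tendstoUniformlyOn_iff]
    intro ε hε
    have h0 : Tendsto (fun t : ℕ => 2 * A / (1 - q) * q ^ t) atTop (𝓝 0) := by
      simpa only [mul_zero] using
        (tendsto_pow_atTop_nhds_zero_of_lt_one hq0 hq1).const_mul (2 * A / (1 - q))
    filter_upwards [h0.eventually_lt_const hε] with t ht z hz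
    rw [dist_comm, dist_eq_norm]
    refine (hbound z hz t).trans_lt (lt_of_le_of_lt ?_ ht)
    gcongr
    exact haA z hz
  refine ⟨ℓ, hunif.tendstoLocallyUniformlyOn.differentiableOn
    (Eventually.of_forall fun t => ?_) hs, hbound⟩
  exact (hd t).clog fun z hz => mem_slitPlane_of_norm_sub_one_le (h1 t z hz)

lemma norm_exp_sub_one_le_mul_exp (s : ℂ) : ‖Complex.exp s - 1‖ ≤ ‖s‖ * Real.exp ‖s‖ := by
  simpa only [Finset.range_one, Finset.sum_singleton, pow_zero, Nat.factorial_zero, Nat.cast_one,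
    div_one, pow_one] using Complex.norm_exp_sub_sum_le_norm_mul_exp s 1

lemma norm_prod_sub_exp_le {u : ℕ → ℂ} {w : ℂ} {K q : ℝ} (hq0 : 0 ≤ q) (hq1 : q < 1)
    (hu : ∀ j, u j ≠ 0) (h : ∀ j, ‖Complex.log (u j) - w‖ ≤ K * q ^ j) (t : ℕ) :
    ‖∏ j ∈ Finset.range t, u j - Complex.exp (t * w)‖ ≤
      K / (1 - q) * Real.exp (K / (1 - q)) * ‖Complex.exp (t * w)‖ := by
  set s : ℂ := ∑ j ∈ Finset.range t, (Complex.log (u j) - w)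
  have hK : 0 ≤ K := by simpa only [pow_zero, mul_one] using (norm_nonneg _).trans (h 0)
  have hs : ‖s‖ ≤ K / (1 - q) := by
    calc ‖s‖ ≤ ∑ j ∈ Finset.range t, K * q ^ j := norm_sum_le_of_le _ fun j _ => h j
      _ = K * ∑ j ∈ Finset.range t, q ^ j := by rw [Finset.mul_sum]
      _ ≤ K * (1 - q)⁻¹ := by
          gcongr
          rw [← tsum_geometric_of_lt_one hq0 hq1]
          exact (summable_geometric_of_lt_one hq0 hq1).sum_le_tsum _ fun _ _ => by positivity
  have hprod : ∏ j ∈ Finset.range t, u j = Complex.exp (t * w) * Complex.exp s := by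
    rw [← Complex.exp_add, show s = _ from Finset.sum_sub_distrib _ _, Finset.sum_const,
      Finset.card_range, nsmul_eq_mul, add_sub_cancel, Complex.exp_sum]
    exact Finset.prod_congr rfl fun j _ => (Complex.exp_log (hu j)).symm
  rw [hprod, ← mul_sub_one, norm_mul, mul_comm]
  gcongr
  exact (norm_exp_sub_one_le_mul_exp s).trans (by gcongr)

namespace SpectralGap

variable {B : Type*} [NormedAddCommGroup B] [NormedSpace ℂ B] {U : B →L[ℂ] B}
  {m : B →L[ℂ] ℂ} {e : B} {C ρ : ℝ}

/-- The normalized action of a bounded operator `L` on vectors `f` with `m (L f) ≠ 0`; it takes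
values in the affine hyperplane `m = 1`. -/
def normalize (m : B →L[ℂ] ℂ) (L : B →L[ℂ] B) (f : B) : B := (m (L f))⁻¹ • L f

/-- The factor by which `m` grows in the `t`-th application of `L` to `e`, with the junk value `0`
when `m ((L ^ t) e) = 0`. -/
def growthFactor (m : B →L[ℂ] ℂ) (e : B) (L : B →L[ℂ] B) (t : ℕ) : ℂ :=
  m ((L ^ (t + 1)) e) / m ((L ^ t) e)

lemma map_smul_normalize {L : B →L[ℂ] B} {f : B} (hf : m (L f) ≠ 0) :
    m (L f) • normalize m L f = L f :=
  smul_inv_smul₀ hf _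

lemma map_normalize {L : B →L[ℂ] B} {f : B} (hf : m (L f) ≠ 0) : m (normalize m L f) = 1 := by
  rw [normalize, map_smul, smul_eq_mul, inv_mul_cancel₀ hf]

lemma map_pow_apply_ne_zero {L : B →L[ℂ] B} (he : m e = 1)
    (hL : ∀ t, m (L ((normalize m L)^[t] e)) ≠ 0) (t : ℕ) :
    m ((L ^ t) e) ≠ 0 ∧ m ((L ^ t) e) • (normalize m L)^[t] e = (L ^ t) e := by
  induction t with
  | zero => simp [he]
  | succ t ih =>
    have hpow : (L ^ (t + 1)) e = m ((L ^ t) e) • L ((normalize m L)^[t] e) := by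
      rw [pow_succ', mul_apply_eq_comp, ← map_smul, ih.2]
    have hmap : m ((L ^ (t + 1)) e) = m ((L ^ t) e) * m (L ((normalize m L)^[t] e)) := by
      rw [hpow, map_smul, smul_eq_mul]
    refine ⟨hmap ▸ mul_ne_zero ih.1 (hL t), ?_⟩
    rw [hmap, Function.iterate_succ_apply', mul_smul, map_smul_normalize (hL t), hpow]

lemma growthFactor_eq {L : B →L[ℂ] B} (he : m e = 1)
    (hL : ∀ t, m (L ((normalize m L)^[t] e)) ≠ 0) (t : ℕ) :
    growthFactor m e L t = m (L ((normalize m L)^[t] e)) := by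
  obtain ⟨h0, hsmul⟩ := map_pow_apply_ne_zero he hL t
  rw [growthFactor, div_eq_iff h0, pow_succ', mul_apply_eq_comp, ← hsmul, map_smul, map_smul,
    hsmul, smul_eq_mul, mul_comm]

lemma prod_growthFactor {L : B →L[ℂ] B} (he : m e = 1) (hL : ∀ t, m ((L ^ t) e) ≠ 0) (t : ℕ) :
    ∏ j ∈ Finset.range t, growthFactor m e L j = m ((L ^ t) e) :=
  Finset.prod_range_induction _ _ he
    t fun j _ => (mul_div_cancel₀ _ (hL j)).symm

lemma norm_le_two (H : SpectralGap U m e C ρ) {f : B} (hf : ‖f - e‖ ≤ 1) : ‖f‖ ≤ 2 := by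
  have h := norm_le_norm_add_norm_sub e f
  rw [norm_sub_rev] at h
  linarith [H.norm_unit]

section Perturbation

variable {L : B →L[ℂ] B} {η : ℝ}

lemma norm_map_sub_one_le (H : SpectralGap U m e C ρ) (hL : ∀ f, ‖L f - U f‖ ≤ η * ‖f‖) {f : B}
    (hf : m f = 1) : ‖m (L f) - 1‖ ≤ η * ‖f‖ := by
  have h : m (L f) - 1 = m (L f - U f) := by rw [map_sub, H.map_comp, hf]
  rw [h]
  exact (H.norm_map_le _).trans (hL f)

lemma half_le_norm_map (H : SpectralGap U m e C ρ) (hη : η ≤ 1 / 4)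
    (hL : ∀ f, ‖L f - U f‖ ≤ η * ‖f‖) {f : B} (hf : m f = 1) (hf2 : ‖f‖ ≤ 2) :
    1 / 2 ≤ ‖m (L f)‖ := by
  have h1 := H.norm_map_sub_one_le hL hf
  have h2 := norm_sub_norm_le (1 : ℂ) (1 - m (L f))
  rw [sub_sub_cancel, norm_sub_rev, norm_one] at h2
  have h3 : η * ‖f‖ ≤ 1 / 4 * 2 := by gcongr
  linarith

lemma map_ne_zero (H : SpectralGap U m e C ρ) (hη : η ≤ 1 / 4)
    (hL : ∀ f, ‖L f - U f‖ ≤ η * ‖f‖) {f : B} (hf : m f = 1) (hf2 : ‖f‖ ≤ 2) : m (L f) ≠ 0 :=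
  norm_pos_iff.1 (one_half_pos.trans_le (H.half_le_norm_map hη hL hf hf2))

lemma norm_normalize_le (H : SpectralGap U m e C ρ) (hη : η ≤ 1 / 4)
    (hL : ∀ f, ‖L f - U f‖ ≤ η * ‖f‖) {f : B} (hf : m f = 1) (hf2 : ‖f‖ ≤ 2) :
    ‖normalize m L f‖ ≤ 5 := by
  have hLf : ‖L f‖ ≤ 5 / 2 := by
    calc ‖L f‖ ≤ ‖U f‖ + ‖L f - U f‖ := norm_le_norm_add_norm_sub' _ _
      _ ≤ ‖f‖ + η * ‖f‖ := add_le_add (H.norm_le f) (hL f)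
      _ ≤ 2 + 1 / 4 * 2 := by gcongr
      _ = 5 / 2 := by norm_num
  have hinv : ‖(m (L f))⁻¹‖ ≤ 2 := by
    rw [norm_inv]
    exact inv_le_of_inv_le₀ two_pos (by linarith [H.half_le_norm_map hη hL hf hf2])
  calc ‖normalize m L f‖ = ‖(m (L f))⁻¹‖ * ‖L f‖ := norm_smul _ _
    _ ≤ 2 * (5 / 2 : ℝ) := by gcongr
    _ = 5 := by norm_num

lemma norm_map_sub_map_le (H : SpectralGap U m e C ρ) (hL : ∀ f, ‖L f - U f‖ ≤ η * ‖f‖) {f g : B}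
    (hfg : m f = m g) : ‖m (L g) - m (L f)‖ ≤ η * ‖g - f‖ := by
  have h : m (L g) - m (L f) = m (L (g - f) - U (g - f)) := by
    rw [map_sub m, H.map_comp, map_sub L, map_sub m, map_sub m, hfg, sub_self, sub_zero]
  rw [h]
  exact (H.norm_map_le _).trans (hL _)

lemma norm_normalize_sub_sub_le (H : SpectralGap U m e C ρ) (hη0 : 0 ≤ η) (hη : η ≤ 1 / 4)
    (hL : ∀ f, ‖L f - U f‖ ≤ η * ‖f‖) {f : B} (hf : m f = 1) (hf2 : ‖f‖ ≤ 2)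
    (hf2' : ‖normalize m L f‖ ≤ 2) :
    ‖normalize m L (normalize m L f) - normalize m L f - U (normalize m L f - f)‖ ≤
      16 * η * ‖normalize m L f - f‖ := by
  have ha : m (L f) ≠ 0 := H.map_ne_zero hη hL hf hf2
  have hf₁ : m (normalize m L f) = 1 := map_normalize ha
  have hb : m (L (normalize m L f)) ≠ 0 := H.map_ne_zero hη hL hf₁ hf2'
  have hhalf := H.half_le_norm_map hη hL hf hf2
  have hf₂ := H.norm_normalize_le hη hL hf₁ hf2'
  have hLf := map_smul_normalize ha
  have hLf₁ := map_smul_normalize hb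
  have hba := H.norm_map_sub_map_le hL (hf.trans hf₁.symm)
  have h1a : ‖1 - m (L f)‖ ≤ η * 2 := by
    rw [norm_sub_rev]
    exact (H.norm_map_sub_one_le hL hf).trans (by gcongr)
  set f₁ := normalize m L f
  set f₂ := normalize m L f₁
  set d := f₁ - f
  have hid : m (L f) • (f₂ - f₁ - U d) =
      (L d - U d) + (1 - m (L f)) • U d - (m (L f₁) - m (L f)) • f₂ := by
    have hLd : L d = m (L f₁) • f₂ - m (L f) • f₁ := by rw [hLf₁, hLf, map_sub]
    rw [hLd]
    module
  have hn : ‖m (L f)‖ * ‖f₂ - f₁ - U d‖ ≤ 8 * η * ‖d‖ := by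
    rw [← norm_smul, hid]
    calc _ ≤ ‖L d - U d‖ + ‖1 - m (L f)‖ * ‖U d‖ + ‖m (L f₁) - m (L f)‖ * ‖f₂‖ := by
          rw [← norm_smul, ← norm_smul]
          exact (norm_sub_le _ _).trans (by gcongr; exact norm_add_le _ _)
      _ ≤ η * ‖d‖ + η * 2 * ‖d‖ + η * ‖d‖ * 5 := by
          gcongr
          exacts [hL d, H.norm_le d]
      _ = 8 * η * ‖d‖ := by ring
  have h5 : 1 / 2 * ‖f₂ - f₁ - U d‖ ≤ ‖m (L f)‖ * ‖f₂ - f₁ - U d‖ := by gcongr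
  linarith

lemma norm_normalize_unit_sub_le (H : SpectralGap U m e C ρ) (hη0 : 0 ≤ η) (hη : η ≤ 1 / 4)
    (hL : ∀ f, ‖L f - U f‖ ≤ η * ‖f‖) : ‖normalize m L e - e‖ ≤ 4 * η := by
  have he2 : ‖e‖ ≤ 2 := H.norm_unit.trans one_le_two
  have hhalf := H.half_le_norm_map hη hL H.map_unit he2
  have hid : m (L e) • (normalize m L e - e) = (L e - U e) + (1 - m (L e)) • e := by
    rw [smul_sub, map_smul_normalize (H.map_ne_zero hη hL H.map_unit he2), H.fix_unit]
    module
  have h1 : ‖L e - U e‖ ≤ η := (hL e).trans (mul_le_of_le_one_right hη0 H.norm_unit)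
  have h2 : ‖1 - m (L e)‖ ≤ η := by
    rw [norm_sub_rev]
    exact (H.norm_map_sub_one_le hL H.map_unit).trans (mul_le_of_le_one_right hη0 H.norm_unit)
  have hn : ‖m (L e)‖ * ‖normalize m L e - e‖ ≤ η + η * 1 := by
    rw [← norm_smul, hid]
    refine (norm_add_le _ _).trans ?_
    rw [norm_smul]
    gcongr
    exact H.norm_unit
  have h5 : 1 / 2 * ‖normalize m L e - e‖ ≤ ‖m (L e)‖ * ‖normalize m L e - e‖ := by gcongr
  linarith

lemma norm_pow_normalize_sub_le (H : SpectralGap U m e C ρ) (hη0 : 0 ≤ η) (hη : η ≤ 1 / 4)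
    (hL : ∀ f, ‖L f - U f‖ ≤ η * ‖f‖) {f : B} {A : ℝ} (hf : m f = 1) (hf2 : ‖f‖ ≤ 2)
    (hf2' : ‖normalize m L f‖ ≤ 2)
    (hA : ∀ n : ℕ, ‖(U ^ n) (normalize m L f - f)‖ ≤ ρ ^ n * A) (n : ℕ) :
    ‖(U ^ n) (normalize m L (normalize m L f) - normalize m L f)‖ ≤
      ρ ^ n * ((ρ + 16 * C * η) * A) := by
  have hρ := H.ρ_nonneg
  have hC := H.C_pos
  have hr := H.norm_normalize_sub_sub_le hη0 hη hL hf hf2 hf2'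
  have hf₁ : m (normalize m L f) = 1 := map_normalize (H.map_ne_zero hη hL hf hf2)
  have hf₂ : m (normalize m L (normalize m L f)) = 1 :=
    map_normalize (H.map_ne_zero hη hL hf₁ hf2')
  have hd : ‖normalize m L f - f‖ ≤ A := by simpa using hA 0
  set f₁ := normalize m L f
  set f₂ := normalize m L f₁
  set r := f₂ - f₁ - U (f₁ - f)
  have hmr : m r = 0 := by
    rw [map_sub, H.map_comp, map_sub, map_sub, hf₂, hf₁, hf, sub_self]
  have hdec : (U ^ n) (f₂ - f₁) = (U ^ (n + 1)) (f₁ - f) + (U ^ n) r := by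
    rw [pow_succ, mul_apply_eq_comp, ← map_add, add_sub_cancel]
  rw [hdec]
  calc _ ≤ ‖(U ^ (n + 1)) (f₁ - f)‖ + ‖(U ^ n) r‖ := norm_add_le _ _
    _ ≤ ρ ^ (n + 1) * A + C * ρ ^ n * (16 * η * A) := by
        refine add_le_add (hA (n + 1)) ((H.decay n r hmr).trans ?_)
        gcongr
        exact hr.trans (by gcongr)
    _ = ρ ^ n * ((ρ + 16 * C * η) * A) := by ring

/-- The bound for all powers of `U` is what makes the induction close: one step costs a power of
`U` on the old difference, plus a remainder in the kernel of `m`. -/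
lemma norm_pow_iterate_normalize_sub_le (H : SpectralGap U m e C ρ) (hη0 : 0 ≤ η) (hη : η ≤ 1 / 4)
    (hηC : 16 * C * η ≤ (1 - ρ) / 2) (hL : ∀ f, ‖L f - U f‖ ≤ η * ‖f‖) (t : ℕ) :
    m ((normalize m L)^[t] e) = 1 ∧ ‖(normalize m L)^[t] e - e‖ ≤ 1 - ((1 + ρ) / 2) ^ t ∧
      ∀ n : ℕ, ‖(U ^ n) ((normalize m L)^[t + 1] e - (normalize m L)^[t] e)‖ ≤
        ρ ^ n * (4 * C * η * ((1 + ρ) / 2) ^ t) := by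
  have hρ := H.ρ_nonneg
  have hC := H.C_pos
  induction t with
  | zero =>
    refine ⟨H.map_unit, by simp, fun n => ?_⟩
    have h0 : m (normalize m L e - e) = 0 := by
      rw [map_sub, map_normalize (H.map_ne_zero hη hL H.map_unit (H.norm_unit.trans one_le_two)),
        H.map_unit, sub_self]
    calc _ ≤ C * ρ ^ n * ‖normalize m L e - e‖ := H.decay n _ h0
      _ ≤ C * ρ ^ n * (4 * η) := by
        gcongr; exact H.norm_normalize_unit_sub_le hη0 hη hL
      _ = _ := by ring
  | succ t ih =>
    obtain ⟨hf, hfe, hdiff⟩ := ih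
    simp only [Function.iterate_succ_apply'] at hdiff ⊢
    set f := (normalize m L)^[t] e
    set q := (1 + ρ) / 2 with hq
    have hq0 : 0 ≤ q := by positivity
    have hf2 : ‖f‖ ≤ 2 := H.norm_le_two (hfe.trans (sub_le_self _ (pow_nonneg hq0 t)))
    have hf₁e : ‖normalize m L f - e‖ ≤ 1 - q ^ (t + 1) := by
      have hd : ‖normalize m L f - f‖ ≤ 4 * C * η * q ^ t := by
        simpa using hdiff 0
      have hsmall : 4 * C * η * q ^ t ≤ (1 - ρ) / 2 * q ^ t := by
        gcongr
        nlinarith [mul_nonneg hC.le hη0]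
      have hpow : q ^ (t + 1) = (1 - (1 - ρ) / 2) * q ^ t := by rw [pow_succ, hq]; ring
      linarith [norm_sub_le_norm_sub_add_norm_sub (normalize m L f) f e]
    have hf2' := H.norm_le_two (hf₁e.trans (sub_le_self _ (pow_nonneg hq0 (t + 1))))
    refine ⟨map_normalize (H.map_ne_zero hη hL hf hf2), hf₁e, fun n => ?_⟩
    calc _ ≤ ρ ^ n * ((ρ + 16 * C * η) * (4 * C * η * q ^ t)) :=
          H.norm_pow_normalize_sub_le hη0 hη hL hf hf2 hf2' hdiff n
      _ ≤ ρ ^ n * ((ρ + (1 - ρ) / 2) * (4 * C * η * q ^ t)) := by gcongr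
      _ = _ := by rw [pow_succ, hq]; ring

lemma growthFactor_estimates (H : SpectralGap U m e C ρ) (hη0 : 0 ≤ η) (hη : η ≤ 1 / 4)
    (hηC : 16 * C * η ≤ (1 - ρ) / 2) (hL : ∀ f, ‖L f - U f‖ ≤ η * ‖f‖) (t : ℕ) :
    m ((L ^ t) e) ≠ 0 ∧ ‖growthFactor m e L t - 1‖ ≤ 1 / 2 ∧
      ‖growthFactor m e L (t + 1) - growthFactor m e L t‖ ≤
        4 * C * η * ((1 + ρ) / 2) ^ t := by
  have hq0 : 0 ≤ (1 + ρ) / 2 := by linarith [H.ρ_nonneg]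
  have horbit := H.norm_pow_iterate_normalize_sub_le hη0 hη hηC hL
  have hf2 : ∀ t, ‖(normalize m L)^[t] e‖ ≤ 2 := fun t =>
    H.norm_le_two ((horbit t).2.1.trans (sub_le_self _ (pow_nonneg hq0 t)))
  have hne : ∀ t, m (L ((normalize m L)^[t] e)) ≠ 0 := fun t =>
    H.map_ne_zero hη hL (horbit t).1 (hf2 t)
  simp only [growthFactor_eq H.map_unit hne]
  refine ⟨(map_pow_apply_ne_zero H.map_unit hne t).1, ?_, ?_⟩
  · calc _ ≤ η * ‖(normalize m L)^[t] e‖ := H.norm_map_sub_one_le hL (horbit t).1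
      _ ≤ 1 / 4 * 2 := by gcongr; exact hf2 t
      _ = 1 / 2 := by norm_num
  · have hd := (horbit t).2.2 0
    rw [pow_zero, pow_zero, one_mul] at hd
    calc _ ≤ η * ‖(normalize m L)^[t + 1] e - (normalize m L)^[t] e‖ :=
          H.norm_map_sub_map_le hL ((horbit t).1.trans (horbit (t + 1)).1.symm)
      _ ≤ 1 * (4 * C * η * ((1 + ρ) / 2) ^ t) := by gcongr; exacts [by linarith, hd]
      _ = _ := one_mul _

end Perturbation

lemma exists_perturbation_radius (H : SpectralGap U m e C ρ) {κ : ℝ} (hκ : 0 < κ) :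
    ∃ δ : ℝ, 0 < δ ∧ δ ≤ 1 ∧ κ * δ ≤ 1 / 4 ∧ 16 * C * (κ * δ) ≤ (1 - ρ) / 2 := by
  have hC := H.C_pos
  have hρ : 0 < 1 - ρ := sub_pos.2 H.ρ_lt_one
  refine ⟨min 1 (min (1 / (4 * κ)) ((1 - ρ) / (32 * C * κ))), by positivity, min_le_left _ _,
    ?_, ?_⟩
  · calc _ ≤ κ * (1 / (4 * κ)) := by
          gcongr; exact (min_le_right _ _).trans (min_le_left _ _)
      _ = 1 / 4 := by field_simp
  · calc _ ≤ 16 * C * (κ * ((1 - ρ) / (32 * C * κ))) := by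
          gcongr; exact (min_le_right _ _).trans (min_le_right _ _)
      _ = (1 - ρ) / 2 := by field_simp; ring

lemma growthFactor_self (H : SpectralGap U m e C ρ) (t : ℕ) : growthFactor m e U t = 1 := by
  have h : ∀ t : ℕ, (U ^ t) e = e := fun t => by
    rw [FunLike.coe_pow_eq_iterate]
    exact Function.IsFixedPt.iterate H.fix_unit t
  rw [growthFactor, h, h, H.map_unit, div_one]

/-- Writing `m ((L z ^ t) e)` as a product of growth factors makes perturbation theory of the
leading eigenvalue elementary: `exp (ℓ z)` is the limit of these factors. -/
theorem exists_quasiPower (H : SpectralGap U m e C ρ) {L : ℂ → B →L[ℂ] B} {κ : ℝ} (hκ : 0 < κ)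
    (hL : ∀ z : ℂ, ‖z‖ ≤ 1 → ∀ f, ‖L z f - U f‖ ≤ κ * ‖z‖ * ‖f‖)
    (hd : ∀ t : ℕ, Differentiable ℂ fun z => m ((L z ^ t) e)) :
    ∃ (ℓ : ℂ → ℂ) (δ K : ℝ), 0 < δ ∧ DifferentiableOn ℂ ℓ (Metric.ball 0 δ) ∧ ℓ 0 = 0 ∧
      ∀ t : ℕ, ∀ z ∈ Metric.ball (0 : ℂ) δ,
        ‖m ((L z ^ t) e) - Complex.exp (t * ℓ z)‖ ≤ K * ‖z‖ * ‖Complex.exp (t * ℓ z)‖ := by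
  have hC := H.C_pos
  obtain ⟨δ, hδ0, hδ1, hδκ, hδC⟩ := H.exists_perturbation_radius hκ
  have hest : ∀ z ∈ Metric.ball (0 : ℂ) δ, ∀ t, m ((L z ^ t) e) ≠ 0 ∧
      ‖growthFactor m e (L z) t - 1‖ ≤ 1 / 2 ∧
      ‖growthFactor m e (L z) (t + 1) - growthFactor m e (L z) t‖ ≤
        4 * C * (κ * ‖z‖) * ((1 + ρ) / 2) ^ t := by
    intro z hz
    have hzδ : ‖z‖ ≤ δ := (mem_ball_zero_iff.1 hz).le
    exact H.growthFactor_estimates (by positivity) (le_trans (by gcongr) hδκ)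
      (le_trans (by gcongr) hδC) (hL z (hzδ.trans hδ1))
  set q := (1 + ρ) / 2 with hq
  have hq0 : 0 ≤ q := by linarith [H.ρ_nonneg]
  have hq1 : q < 1 := by linarith [H.ρ_lt_one]
  obtain ⟨ℓ, hℓd, hℓ⟩ := exists_differentiableOn_norm_log_sub_le
    (lam := fun t z => growthFactor m e (L z) t) (A := 4 * C * (κ * δ)) Metric.isOpen_ball hq0 hq1
    (fun z hz => by have := (mem_ball_zero_iff.1 hz).le; gcongr)
    (fun t => (hd (t + 1)).differentiableOn.div (hd t).differentiableOn fun z hz => (hest z hz t).1)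
    (fun t z hz => (hest z hz t).2.1) (fun t z hz => (hest z hz t).2.2)
  set K := 2 * (4 * C * κ) / (1 - q) / (1 - q)
  have hK : 0 < K := by positivity
  refine ⟨ℓ, δ, K * Real.exp K, hδ0, hℓd, ?_, fun t z hz => ?_⟩
  · have hL0 : growthFactor m e (L 0) 0 = 1 := by
      have hLU : L 0 = U := by
        ext f
        exact sub_eq_zero.1 (norm_le_zero_iff.1 (by simpa using hL 0 (by simp) f))
      rw [hLU, H.growthFactor_self]
    have h := hℓ 0 (Metric.mem_ball_self hδ0) 0
    rw [hL0] at h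
    simpa using h
  · have hz1 : ‖z‖ ≤ 1 := (mem_ball_zero_iff.1 hz).le.trans hδ1
    have hKz : 2 * (4 * C * (κ * ‖z‖)) / (1 - q) / (1 - q) = K * ‖z‖ := by ring
    have hne : ∀ j, growthFactor m e (L z) j ≠ 0 := fun j =>
      Complex.slitPlane_ne_zero (mem_slitPlane_of_norm_sub_one_le (hest z hz j).2.1)
    have h := norm_prod_sub_exp_le hq0 hq1 hne (hℓ z hz) t
    rw [prod_growthFactor H.map_unit (fun j => (hest z hz j).1), hKz] at h
    refine h.trans (le_of_le_of_eq ?_ (congrArg (· * _) (mul_right_comm K (Real.exp K) ‖z‖).symm))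
    gcongr
    exact mul_le_of_le_one_right hK.le hz1

section Minorization

lemma norm_pow_apply_le (hU : ∀ f, ‖U f‖ ≤ ‖f‖) (n : ℕ) (f : B) : ‖(U ^ n) f‖ ≤ ‖f‖ := by
  induction n with
  | zero => rfl
  | succ n ih => rw [pow_succ', mul_apply_eq_comp]; exact (hU _).trans ih

lemma map_pow_apply (hmU : ∀ f, m (U f) = m f) (n : ℕ) (f : B) : m ((U ^ n) f) = m f := by
  induction n with
  | zero => rfl
  | succ n ih => rw [pow_succ', mul_apply_eq_comp, hmU, ih]

lemma exists_norm_pow_sub_smul_le {V : B →L[ℂ] B} (hVe : V e = e) {γ : ℝ} (hγ0 : 0 ≤ γ)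
    {ν : B → ℂ} (hν : ∀ f, ‖V f - ν f • e‖ ≤ γ * ‖f‖) (k : ℕ) (f : B) :
    ∃ c : ℂ, ‖(V ^ k) f - c • e‖ ≤ γ ^ k * ‖f‖ := by
  induction k with
  | zero => exact ⟨0, by simp⟩
  | succ k ih =>
    obtain ⟨c, hc⟩ := ih
    set w := (V ^ k) f - c • e with hw
    have hVw : (V ^ (k + 1)) f - (c + ν w) • e = V w - ν w • e := by
      rw [hw, map_sub, map_smul, hVe, ← hw, pow_succ', mul_apply_eq_comp]
      module
    refine ⟨c + ν w, ?_⟩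
    calc _ ≤ γ * ‖w‖ := hVw ▸ hν w
      _ ≤ γ * (γ ^ k * ‖f‖) := by gcongr
      _ = _ := by rw [pow_succ]; ring

lemma norm_pow_apply_le_of_map_eq_zero {V : B →L[ℂ] B} (he : ‖e‖ ≤ 1) (hme : m e = 1)
    (hVe : V e = e) (hmV : ∀ f, m (V f) = m f) (hm : ∀ f, ‖m f‖ ≤ ‖f‖) {γ : ℝ} (hγ0 : 0 ≤ γ)
    {ν : B → ℂ} (hν : ∀ f, ‖V f - ν f • e‖ ≤ γ * ‖f‖) (k : ℕ) {f : B} (hf : m f = 0) :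
    ‖(V ^ k) f‖ ≤ 2 * γ ^ k * ‖f‖ := by
  obtain ⟨c, hc⟩ := exists_norm_pow_sub_smul_le hVe hγ0 hν k f
  have hcn : ‖c‖ ≤ γ ^ k * ‖f‖ := by
    have h := (hm ((V ^ k) f - c • e)).trans hc
    rwa [map_sub, map_pow_apply hmV, hf, map_smul, hme, zero_sub, norm_neg, smul_eq_mul,
      mul_one] at h
  calc ‖(V ^ k) f‖ ≤ ‖c • e‖ + ‖(V ^ k) f - c • e‖ := norm_le_norm_add_norm_sub' _ _
    _ ≤ γ ^ k * ‖f‖ * 1 + γ ^ k * ‖f‖ := by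
        rw [norm_smul]
        gcongr
    _ = _ := by ring

theorem exists_of_minorization (he : ‖e‖ ≤ 1) (hme : m e = 1) (hUe : U e = e)
    (hmU : ∀ f, m (U f) = m f) (hU : ∀ f, ‖U f‖ ≤ ‖f‖) (hm : ∀ f, ‖m f‖ ≤ ‖f‖)
    {N : ℕ} (hN : 0 < N) {γ : ℝ} (hγ0 : 0 < γ) (hγ1 : γ < 1) {ν : B → ℂ}
    (hν : ∀ f, ‖(U ^ N) f - ν f • e‖ ≤ γ * ‖f‖) : ∃ C ρ : ℝ, SpectralGap U m e C ρ := by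
  have hUNe : (U ^ N) e = e := by
    rw [FunLike.coe_pow_eq_iterate]
    exact Function.IsFixedPt.iterate hUe N
  set ρ : ℝ := γ ^ ((N : ℝ)⁻¹)
  have hρ0 : 0 < ρ := Real.rpow_pos_of_pos hγ0 _
  have hρ1 : ρ < 1 := Real.rpow_lt_one hγ0.le hγ1 (by positivity)
  have hρN : ρ ^ N = γ := Real.rpow_inv_natCast_pow hγ0.le hN.ne'
  refine ⟨2 / γ, ρ, he, hme, hUe, hmU, hU, hm, by positivity, hρ0.le, hρ1, fun n f hf => ?_⟩
  have hn : n = n % N + N * (n / N) := (Nat.mod_add_div n N).symm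
  have hmod : γ ≤ ρ ^ (n % N) := by
    rw [← hρN]
    exact pow_le_pow_of_le_one hρ0.le hρ1.le (Nat.mod_lt n hN).le
  calc ‖(U ^ n) f‖ = ‖(U ^ (n % N)) (((U ^ N) ^ (n / N)) f)‖ := by
        rw [← pow_mul, ← mul_apply_eq_comp, ← pow_add, ← hn]
    _ ≤ ‖((U ^ N) ^ (n / N)) f‖ := norm_pow_apply_le hU _ _
    _ ≤ 2 * γ ^ (n / N) * ‖f‖ :=
        norm_pow_apply_le_of_map_eq_zero he hme hUNe (map_pow_apply hmU N) hm hγ0.le hν _ hf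
    _ = 2 / γ * (γ * γ ^ (n / N)) * ‖f‖ := by field_simp
    _ ≤ 2 / γ * (ρ ^ (n % N) * γ ^ (n / N)) * ‖f‖ := by gcongr
    _ = 2 / γ * ρ ^ n * ‖f‖ := by
        rw [← hρN, ← pow_mul, ← pow_add, ← hn]

end Minorization

end SpectralGap

/-! ### Random iterations -/

section PathMeasure

variable {X Y : Type*} [MeasurableSpace X] [MeasurableSpace Y]

/-- The sequence `η, ω 0, ω 1, …`. -/
def consSeq {Y : Type*} (η : Y) (ω : ℕ → Y) : ℕ → Y
  | 0 => η
  | k + 1 => ω k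

lemma measurable_consSeq : Measurable fun p : Y × (ℕ → Y) => consSeq p.1 p.2 := by
  refine measurable_pi_lambda _ fun k => ?_
  cases k with
  | zero => exact measurable_fst
  | succ k => exact (measurable_pi_apply k).comp measurable_snd

lemma preimage_consSeq_pi_univ {Y : Type*} (t : ℕ → Set Y) :
    (fun p : Y × (ℕ → Y) => consSeq p.1 p.2) ⁻¹' univ.pi t =
      t 0 ×ˢ univ.pi fun i => t (i + 1) := by
  ext p
  simp only [mem_preimage, mem_univ_pi, mem_prod]
  rw [← Nat.and_forall_add_one]
  rfl

lemma measurePreserving_consSeq (θ : Measure Y) [IsProbabilityMeasure θ] :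
    MeasurePreserving (fun p : Y × (ℕ → Y) => consSeq p.1 p.2)
      (θ.prod (Measure.infinitePi fun _ : ℕ => θ)) (Measure.infinitePi fun _ : ℕ => θ) := by
  refine ⟨measurable_consSeq, Measure.eq_infinitePi _ fun s t ht => ?_⟩
  classical
  set u : ℕ → Set Y := fun i => if i ∈ s then t i else univ with hu
  have measurable_u (i : ℕ) : MeasurableSet (u i) := by
    by_cases hi : i ∈ s <;> simp only [hu, hi, if_true, if_false, ht i, MeasurableSet.univ]
  have u_eq_univ {i : ℕ} (hi : i ∉ s) : u i = univ := if_neg hi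
  obtain ⟨n, hn⟩ := s.exists_nat_subset_range
  have tail_eq : univ.pi (fun i => u (i + 1)) =
      Set.pi (Finset.range n) fun i => u (i + 1) := by
    ext ω
    refine ⟨fun h i _ => h i trivial, fun h i _ => ?_⟩
    by_cases hi : i + 1 ∈ s
    · exact h i (Finset.mem_coe.2 (Finset.mem_range.2
        ((Nat.lt_succ_self i).trans (Finset.mem_range.1 (hn hi)))))
    · exact (u_eq_univ hi).symm.subset (mem_univ (ω i))
  calc _ = (θ.prod (Measure.infinitePi fun _ : ℕ => θ))
        (u 0 ×ˢ Set.pi (Finset.range n) fun i => u (i + 1)) := by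
        rw [Measure.map_apply measurable_consSeq (.pi s.countable_toSet fun i _ => ht i),
          ← Set.pi_univ_ite, ← tail_eq, ← preimage_consSeq_pi_univ]
        rfl
    _ = ∏ i ∈ Finset.range (n + 1), θ (u i) := by
        rw [Measure.prod_prod, Measure.infinitePi_pi _ fun i _ => measurable_u (i + 1), mul_comm,
          ← Finset.prod_range_succ' fun i => θ (u i)]
    _ = ∏ i ∈ s, θ (u i) :=
        (Finset.prod_subset (hn.trans (Finset.range_mono n.le_succ)) fun i _ hi => by
          rw [u_eq_univ hi, measure_univ]).symm
    _ = ∏ i ∈ s, θ (t i) := Finset.prod_congr rfl fun i hi => by simp only [hu, if_pos hi]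

lemma integral_infinitePi_eq_integral_consSeq {E : Type*} [NormedAddCommGroup E]
    [NormedSpace ℝ E] {θ : Measure Y} [IsProbabilityMeasure θ] {φ : (ℕ → Y) → E}
    (hφ : Integrable φ (Measure.infinitePi fun _ : ℕ => θ)) :
    ∫ ω, φ ω ∂(Measure.infinitePi fun _ : ℕ => θ) =
      ∫ η, ∫ ω, φ (consSeq η ω) ∂(Measure.infinitePi fun _ : ℕ => θ) ∂θ := by
  have hmp := measurePreserving_consSeq θ
  conv_lhs => rw [← hmp.map_eq]
  exact (integral_map hmp.aemeasurable (hmp.map_eq.symm ▸ hφ.aestronglyMeasurable)).trans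
    (integral_prod _ (hmp.integrable_comp_of_integrable hφ))

/-- The law of a sequence of independent noises with law `θ` and an independent initial point with
law `μ`. -/
abbrev path (θ : Measure Y) (μ : Measure X) : Measure ((ℕ → Y) × X) :=
  (Measure.infinitePi fun _ : ℕ => θ).prod μ

/-- The random orbit `F (ω (k-1)) ∘ ⋯ ∘ F (ω 0)` of `x`. -/
def randomOrbit {X Y : Type*} (F : Y → X → X) (ω : ℕ → Y) (x : X) : ℕ → X
  | 0 => x
  | k + 1 => F (ω k) (randomOrbit F ω x k)

/-- The Birkhoff sums of `g` along the random orbit. -/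
def randomSum {X Y : Type*} (F : Y → X → X) (g : X → ℝ) (t : ℕ) (p : (ℕ → Y) × X) : ℝ :=
  ∑ k ∈ Finset.range t, g (randomOrbit F p.1 p.2 k)

/-- The skew product: discard the first noise after applying it to the initial point. -/
def pathShift {X Y : Type*} (F : Y → X → X) (p : (ℕ → Y) × X) : (ℕ → Y) × X :=
  (fun k => p.1 (k + 1), F (p.1 0) p.2)

lemma randomOrbit_pathShift {X Y : Type*} (F : Y → X → X) (p : (ℕ → Y) × X) (k : ℕ) :
    randomOrbit F (pathShift F p).1 (pathShift F p).2 k = randomOrbit F p.1 p.2 (k + 1) := by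
  induction k with
  | zero => rfl
  | succ k ih => rw [randomOrbit, ih]; rfl

lemma randomSum_succ {X Y : Type*} (F : Y → X → X) (g : X → ℝ) (t : ℕ) (p : (ℕ → Y) × X) :
    randomSum F g (t + 1) p = g p.2 + randomSum F g t (pathShift F p) := by
  rw [randomSum, Finset.sum_range_succ', add_comm, randomSum]
  simp only [randomOrbit_pathShift]
  rfl

/-- The measure `μ` is stationary for the random map `F` with noise law `θ`. -/
abbrev StationarySystem (F : Y → X → X) (θ : Measure Y) (μ : Measure X) : Prop :=
  MeasurePreserving (fun p : Y × X => F p.1 p.2) (θ.prod μ) μ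

variable {F : Y → X → X}

lemma measurable_pathShift (hF : Measurable fun p : Y × X => F p.1 p.2) :
    Measurable (pathShift F) := by
  have measurable_first : Measurable fun p : (ℕ → Y) × X => (p.1 0, p.2) := by fun_prop
  have measurable_tail : Measurable fun p : (ℕ → Y) × X => fun k => p.1 (k + 1) := by fun_prop
  exact measurable_tail.prodMk (hF.comp measurable_first)

lemma measurable_randomOrbit (hF : Measurable fun p : Y × X => F p.1 p.2) (k : ℕ) :
    Measurable fun p : (ℕ → Y) × X => randomOrbit F p.1 p.2 k := by
  induction k with
  | zero => exact measurable_snd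
  | succ k ih => exact hF.comp (((measurable_pi_apply k).comp measurable_fst).prodMk ih)

variable {θ : Measure Y} {μ : Measure X} [IsProbabilityMeasure θ] [IsProbabilityMeasure μ]

lemma StationarySystem.measurePreserving_pathShift (H : StationarySystem F θ μ) :
    MeasurePreserving (pathShift F) (path θ μ) (path θ μ) := by
  have cons_prod : MeasurePreserving (Prod.map (fun p : Y × (ℕ → Y) => consSeq p.1 p.2) id)
      ((θ.prod (Measure.infinitePi fun _ : ℕ => θ)).prod μ) (path θ μ) :=
    (measurePreserving_consSeq θ).prod (.id μ)
  have apply_first := ((MeasurePreserving.id (Measure.infinitePi fun _ : ℕ => θ)).prod H).comp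
    ((measurePreserving_prodAssoc _ _ μ).comp (Measure.measurePreserving_swap.prod (.id μ)))
  refine ⟨measurable_pathShift H.measurable, ?_⟩
  conv_lhs => rw [← cons_prod.map_eq]
  rw [Measure.map_map (measurable_pathShift H.measurable) cons_prod.measurable]
  exact apply_first.map_eq

lemma StationarySystem.measurePreserving_randomOrbit (H : StationarySystem F θ μ) (k : ℕ) :
    MeasurePreserving (fun p : (ℕ → Y) × X => randomOrbit F p.1 p.2 k) (path θ μ) μ := by
  induction k with
  | zero => exact measurePreserving_snd
  | succ k ih =>
    exact (ih.comp H.measurePreserving_pathShift).congr (measurable_randomOrbit H.measurable _)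
      (.of_forall fun p => randomOrbit_pathShift F p k)

end PathMeasure

/-- Bounded measurable real functions. -/
structure BddMeasurable {X : Type*} [MeasurableSpace X] (g : X → ℝ) : Prop where
  measurable : Measurable g
  bounded : ∃ G : ℝ, ∀ x, |g x| ≤ G

namespace BddMeasurable

variable {X Y : Type*} [MeasurableSpace X] [MeasurableSpace Y] {f g : X → ℝ}

lemma integrable (hg : BddMeasurable g) (μ : Measure X) [IsFiniteMeasure μ] : Integrable g μ := by
  obtain ⟨G, hG⟩ := hg.bounded
  exact Integrable.of_bound hg.measurable.aestronglyMeasurable G (Eventually.of_forall hG)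

lemma add (hf : BddMeasurable f) (hg : BddMeasurable g) : BddMeasurable fun x => f x + g x := by
  obtain ⟨G, hG⟩ := hg.bounded
  obtain ⟨K, hK⟩ := hf.bounded
  exact ⟨hf.measurable.add hg.measurable, K + G, fun x =>
    (abs_add_le _ _).trans (add_le_add (hK x) (hG x))⟩

lemma mul (hf : BddMeasurable f) (hg : BddMeasurable g) : BddMeasurable fun x => f x * g x := by
  obtain ⟨G, hG⟩ := hg.bounded
  obtain ⟨K, hK⟩ := hf.bounded
  refine ⟨hf.measurable.mul hg.measurable, K * G, fun x => ?_⟩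
  rw [abs_mul]
  exact mul_le_mul (hK x) (hG x) (abs_nonneg _) ((abs_nonneg _).trans (hK x))

lemma const (c : ℝ) : BddMeasurable fun _ : X => c := ⟨measurable_const, |c|, fun _ => le_rfl⟩

lemma pow_two (hf : BddMeasurable f) : BddMeasurable fun x => f x ^ 2 := by
  simpa only [sq] using hf.mul hf

lemma sum {ι : Type*} (s : Finset ι) {f : ι → X → ℝ} (hf : ∀ i ∈ s, BddMeasurable (f i)) :
    BddMeasurable fun x => ∑ i ∈ s, f i x := by
  classical
  induction s using Finset.induction_on with
  | empty => simpa only [Finset.sum_empty] using const 0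
  | insert a s ha ih =>
    simp only [Finset.sum_insert ha]
    exact (hf a (Finset.mem_insert_self a s)).add
      (ih fun i hi => hf i (Finset.mem_insert_of_mem hi))

lemma comp {Z : Type*} [MeasurableSpace Z] (hf : BddMeasurable f) {φ : Z → X} (hφ : Measurable φ) :
    BddMeasurable fun z => f (φ z) := by
  obtain ⟨G, hG⟩ := hf.bounded
  exact ⟨hf.measurable.comp hφ, G, fun z => hG _⟩

lemma integral_left {f : Y × X → ℝ} (hf : BddMeasurable f) (θ : Measure Y)
    [IsProbabilityMeasure θ] : BddMeasurable fun x => ∫ η, f (η, x) ∂θ := by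
  obtain ⟨G, hG⟩ := hf.bounded
  refine ⟨hf.measurable.stronglyMeasurable.integral_prod_left'.measurable, G, fun x => ?_⟩
  simpa only [Real.norm_eq_abs, probReal_univ, mul_one] using norm_integral_le_of_norm_le_const
    (μ := θ) (f := fun η => f (η, x)) (Eventually.of_forall fun η => hG (η, x))

lemma randomSum {F : Y → X → X} (hF : Measurable fun p : Y × X => F p.1 p.2)
    (hg : BddMeasurable g) (t : ℕ) : BddMeasurable (randomSum F g t) :=
  sum _ fun k _ => hg.comp (measurable_randomOrbit hF k)

end BddMeasurable

section AverageOp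

variable {X Y : Type*} [MeasurableSpace X] [MeasurableSpace Y] {F : Y → X → X} {θ : Measure Y}
  [IsProbabilityMeasure θ] {f g : X → ℝ}

/-- The averaging operator `f ↦ ∫ f (F η ·) dθ(η)`. -/
def averageOp {X Y : Type*} [MeasurableSpace Y] (F : Y → X → X) (θ : Measure Y) (f : X → ℝ)
    (x : X) : ℝ := ∫ η, f (F η x) ∂θ

lemma BddMeasurable.averageOp_iterate (hF : Measurable fun p : Y × X => F p.1 p.2)
    (hg : BddMeasurable g) (k : ℕ) : BddMeasurable ((averageOp F θ)^[k] g) := by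
  induction k with
  | zero => exact hg
  | succ k ih =>
    rw [Function.iterate_succ_apply']
    exact (ih.comp hF).integral_left θ

lemma integral_randomOrbit (hF : Measurable fun p : Y × X => F p.1 p.2) (hg : BddMeasurable g)
    (k : ℕ) (x : X) :
    ∫ ω, g (randomOrbit F ω x k) ∂(Measure.infinitePi fun _ : ℕ => θ) =
      (averageOp F θ)^[k] g x := by
  induction k generalizing x with
  | zero => simp only [randomOrbit, integral_const, probReal_univ, one_smul, Function.iterate_zero,
      id_eq]
  | succ k ih =>
    rw [integral_infinitePi_eq_integral_consSeq
      (φ := fun ω => g (randomOrbit F ω x (k + 1)))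
      ((hg.comp ((measurable_randomOrbit hF (k + 1)).comp measurable_prodMk_right)).integrable _),
      Function.iterate_succ_apply', averageOp]
    refine integral_congr_ae (.of_forall fun η => ?_)
    refine Eq.trans ?_ (ih (F η x))
    exact integral_congr_ae (.of_forall fun ω =>
      congrArg g (randomOrbit_pathShift F (consSeq η ω, x) k).symm)

lemma integral_mul_randomOrbit {μ : Measure X} [IsProbabilityMeasure μ]
    (hF : Measurable fun p : Y × X => F p.1 p.2) (hf : BddMeasurable f) (hg : BddMeasurable g)
    (k : ℕ) :
    ∫ p, f p.2 * g (randomOrbit F p.1 p.2 k) ∂(path θ μ) =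
      ∫ x, f x * (averageOp F θ)^[k] g x ∂μ := by
  rw [integral_prod_symm _ (((hf.comp measurable_snd).mul
    (hg.comp (measurable_randomOrbit hF k))).integrable _)]
  simp only [integral_const_mul, integral_randomOrbit hF hg]

end AverageOp

/-! ### The space of bounded measurable functions -/

/-- The bounded measurable functions as a subspace of all bounded functions. -/
def measurableSubmodule (X : Type*) [MeasurableSpace X] :
    Submodule ℂ (lp (fun _ : X => ℂ) ⊤) where
  carrier := {f | Measurable (f : X → ℂ)}
  add_mem' := fun {f g} (hf : Measurable (f : X → ℂ)) (hg : Measurable (g : X → ℂ)) => by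
    change Measurable ((f + g : lp (fun _ : X => ℂ) ⊤) : X → ℂ)
    rw [lp.coeFn_add]
    exact hf.add hg
  zero_mem' := by
    change Measurable ((0 : lp (fun _ : X => ℂ) ⊤) : X → ℂ)
    rw [lp.coeFn_zero]
    exact measurable_zero
  smul_mem' := fun c f (hf : Measurable (f : X → ℂ)) => by
    change Measurable ((c • f : lp (fun _ : X => ℂ) ⊤) : X → ℂ)
    rw [lp.coeFn_smul]
    exact hf.const_smul c

/-- Bounded measurable complex functions with the supremum norm. -/
def BoundedMeasurable (X : Type*) [MeasurableSpace X] : Type _ := measurableSubmodule X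

namespace BoundedMeasurable

variable {X : Type*} [MeasurableSpace X]

instance : NormedAddCommGroup (BoundedMeasurable X) :=
  inferInstanceAs (NormedAddCommGroup (measurableSubmodule X))

instance : NormedSpace ℂ (BoundedMeasurable X) :=
  inferInstanceAs (NormedSpace ℂ (measurableSubmodule X))

/-- The value of a bounded measurable function at a point. -/
def eval (f : BoundedMeasurable X) (x : X) : ℂ := (f.1 : lp (fun _ : X => ℂ) ⊤) x

lemma measurable_eval (f : BoundedMeasurable X) : Measurable (eval f) := f.2

lemma norm_eval_le (f : BoundedMeasurable X) (x : X) : ‖eval f x‖ ≤ ‖f‖ :=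
  lp.norm_apply_le_norm ENNReal.top_ne_zero _ x

lemma norm_le {f : BoundedMeasurable X} {c : ℝ} (hc : 0 ≤ c) (h : ∀ x, ‖eval f x‖ ≤ c) :
    ‖f‖ ≤ c :=
  lp.norm_le_of_forall_le hc h

@[ext]
lemma ext {f g : BoundedMeasurable X} (h : ∀ x, eval f x = eval g x) : f = g :=
  Subtype.ext (lp.ext (funext h))

/-- The element of the space given by a bounded measurable function. -/
def mk (f : X → ℂ) (hf : Measurable f) (hb : ∃ c : ℝ, ∀ x, ‖f x‖ ≤ c) : BoundedMeasurable X :=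
  ⟨⟨f, memℓp_infty (by
    obtain ⟨c, hc⟩ := hb
    exact ⟨c, by rintro _ ⟨x, rfl⟩; exact hc x⟩)⟩, hf⟩

@[simp] lemma eval_mk (f : X → ℂ) (hf : Measurable f) (hb : ∃ c : ℝ, ∀ x, ‖f x‖ ≤ c) (x : X) :
    eval (mk f hf hb) x = f x := rfl

@[simp] lemma eval_add (f g : BoundedMeasurable X) (x : X) :
    eval (f + g) x = eval f x + eval g x := rfl

@[simp] lemma eval_sub (f g : BoundedMeasurable X) (x : X) :
    eval (f - g) x = eval f x - eval g x := rfl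

@[simp] lemma eval_smul (c : ℂ) (f : BoundedMeasurable X) (x : X) :
    eval (c • f) x = c * eval f x := rfl

lemma integrable_eval (f : BoundedMeasurable X) (μ : Measure X) [IsFiniteMeasure μ] :
    Integrable (eval f) μ :=
  Integrable.of_bound f.measurable_eval.aestronglyMeasurable _ (Eventually.of_forall f.norm_eval_le)

/-- The constant function `1`. -/
def one (X : Type*) [MeasurableSpace X] : BoundedMeasurable X :=
  mk (fun _ => 1) measurable_const ⟨1, by simp⟩

@[simp] lemma eval_one (x : X) : eval (one X) x = 1 := rfl

lemma norm_one_le : ‖one X‖ ≤ 1 := norm_le zero_le_one fun _ => norm_one.le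

lemma norm_integral_eval_le (f : BoundedMeasurable X) (μ : Measure X) [IsProbabilityMeasure μ] :
    ‖∫ x, eval f x ∂μ‖ ≤ ‖f‖ := by
  simpa only [probReal_univ, mul_one] using
    norm_integral_le_of_norm_le_const (μ := μ) (Eventually.of_forall f.norm_eval_le)

/-- Integration against a probability measure. -/
def integralCLM (μ : Measure X) [IsProbabilityMeasure μ] : BoundedMeasurable X →L[ℂ] ℂ :=
  LinearMap.mkContinuous
    { toFun := fun f => ∫ x, eval f x ∂μ
      map_add' := fun f g => integral_add (f.integrable_eval μ) (g.integrable_eval μ)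
      map_smul' := fun _ _ => integral_const_mul _ _ }
    1 fun f => (norm_integral_eval_le f μ).trans_eq (one_mul _).symm

lemma integralCLM_apply (μ : Measure X) [IsProbabilityMeasure μ] (f : BoundedMeasurable X) :
    integralCLM μ f = ∫ x, eval f x ∂μ := rfl

/-- A bounded measurable real function as an element of the space. -/
def ofReal {g : X → ℝ} (hg : BddMeasurable g) : BoundedMeasurable X :=
  mk (fun x => (g x : ℂ)) (Complex.measurable_ofReal.comp hg.measurable)
    (hg.bounded.imp fun _ hG x => (Complex.norm_real _).trans_le (hG x))

lemma integralCLM_ofReal {g : X → ℝ} (hg : BddMeasurable g) (μ : Measure X)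
    [IsProbabilityMeasure μ] : integralCLM μ (ofReal hg) = (∫ x, g x ∂μ : ℝ) :=
  integral_complex_ofReal

/-- The weight `exp (z g)`. -/
def expWeight {g : X → ℝ} (hg : BddMeasurable g) (z : ℂ) : BoundedMeasurable X :=
  mk (fun x => Complex.exp (z * g x)) (by have := hg.measurable; fun_prop) (by
    obtain ⟨G, hG⟩ := hg.bounded
    refine ⟨Real.exp (‖z‖ * G), fun x => (Complex.norm_exp_le_exp_norm _).trans ?_⟩
    rw [norm_mul, Complex.norm_real]
    gcongr
    exact hG x)

@[simp] lemma eval_expWeight {g : X → ℝ} (hg : BddMeasurable g) (z : ℂ) (x : X) :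
    eval (expWeight hg z) x = Complex.exp (z * g x) := rfl

lemma norm_expWeight_sub_one_le {g : X → ℝ} (hg : BddMeasurable g) {G : ℝ} (hG0 : 0 ≤ G)
    (hG : ∀ x, |g x| ≤ G) {z : ℂ} (hz : ‖z‖ ≤ 1) :
    ‖expWeight hg z - one X‖ ≤ G * Real.exp G * ‖z‖ := by
  refine norm_le (by positivity) fun x => ?_
  have norm_le_mul : ‖z * (g x : ℂ)‖ ≤ ‖z‖ * G := by
    rw [norm_mul, Complex.norm_real]
    gcongr
    exact hG x
  calc ‖Complex.exp (z * g x) - 1‖ ≤ ‖z * (g x : ℂ)‖ * Real.exp ‖z * (g x : ℂ)‖ :=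
        norm_exp_sub_one_le_mul_exp _
    _ ≤ ‖z‖ * G * Real.exp G := by
        gcongr
        exact norm_le_mul.trans (mul_le_of_le_one_left hG0 hz)
    _ = G * Real.exp G * ‖z‖ := by ring

section MarkovKernel

variable (κ : Kernel X X) [IsMarkovKernel κ]

/-- The weighted averaging operator `f ↦ w · ∫ f dκ`. -/
def weightedOp (w : BoundedMeasurable X) : BoundedMeasurable X →L[ℂ] BoundedMeasurable X :=
  LinearMap.mkContinuous
    { toFun := fun f => mk (fun x => eval w x * ∫ y, eval f y ∂(κ x))
        (w.measurable_eval.mul f.measurable_eval.stronglyMeasurable.integral_kernel.measurable)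
        ⟨‖w‖ * ‖f‖, fun x => by
          rw [norm_mul]
          exact mul_le_mul (w.norm_eval_le x) (norm_integral_eval_le f _) (norm_nonneg _)
            (norm_nonneg _)⟩
      map_add' := fun f g => by
        ext x
        simp only [eval_mk, eval_add]
        rw [integral_add (f.integrable_eval _) (g.integrable_eval _), mul_add]
      map_smul' := fun c f => by
        ext x
        simp only [eval_mk, eval_smul, RingHom.id_apply]
        rw [integral_const_mul, mul_left_comm] }
    ‖w‖ fun f => norm_le (by positivity) fun x => by
      rw [LinearMap.coe_mk, AddHom.coe_mk, eval_mk, norm_mul]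
      exact mul_le_mul (w.norm_eval_le x) (norm_integral_eval_le f _) (norm_nonneg _)
        (norm_nonneg _)

@[simp] lemma eval_weightedOp (w f : BoundedMeasurable X) (x : X) :
    eval (weightedOp κ w f) x = eval w x * ∫ y, eval f y ∂(κ x) := rfl

lemma norm_weightedOp_le (w f : BoundedMeasurable X) : ‖weightedOp κ w f‖ ≤ ‖w‖ * ‖f‖ :=
  norm_le (by positivity) fun x => by
    rw [eval_weightedOp, norm_mul]
    exact mul_le_mul (w.norm_eval_le x) (norm_integral_eval_le f _) (norm_nonneg _)
      (norm_nonneg _)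

lemma weightedOp_sub (v w f : BoundedMeasurable X) :
    weightedOp κ (v - w) f = weightedOp κ v f - weightedOp κ w f := by
  ext x
  simp only [eval_weightedOp, eval_sub, sub_mul]

/-- The averaging operator `f ↦ ∫ f dκ`. -/
abbrev averageCLM : BoundedMeasurable X →L[ℂ] BoundedMeasurable X := weightedOp κ (one X)

lemma eval_averageCLM (f : BoundedMeasurable X) (x : X) :
    eval (averageCLM κ f) x = ∫ y, eval f y ∂(κ x) := by
  rw [eval_weightedOp, eval_one, one_mul]

lemma norm_averageCLM_le (f : BoundedMeasurable X) : ‖averageCLM κ f‖ ≤ ‖f‖ :=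
  (norm_weightedOp_le κ _ f).trans (mul_le_of_le_one_left (norm_nonneg f) norm_one_le)

lemma averageCLM_one : averageCLM κ (one X) = one X := by
  ext x
  simp only [eval_averageCLM, eval_one, integral_const, probReal_univ, one_smul]

lemma integralCLM_averageCLM {μ : Measure X} [IsProbabilityMeasure μ] {κ : Kernel X X}
    [IsMarkovKernel κ] (hκ : κ.Invariant μ) (f : BoundedMeasurable X) :
    integralCLM μ (averageCLM κ f) = integralCLM μ f := by
  have hconst : (κ ∘ₖ Kernel.const Unit μ) () = μ := by
    rw [Kernel.comp_apply, Kernel.const_apply, hκ.def]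
  have h := Kernel.integral_comp (κ := Kernel.const Unit μ) (η := κ) (a := ()) (f := eval f)
    (hconst.symm ▸ f.integrable_eval μ)
  rw [hconst, Kernel.const_apply] at h
  simp only [integralCLM_apply, eval_averageCLM, h]

end MarkovKernel

end BoundedMeasurable

section TransitionKernel

open BoundedMeasurable

variable {X Y : Type*} [MeasurableSpace X] [MeasurableSpace Y] {F : Y → X → X}

/-- The transition kernel `x ↦ law of F η x` of the random map `F` with noise law `θ`. -/
def transitionKernel (θ : Measure Y) [SFinite θ] (hF : Measurable fun p : Y × X => F p.1 p.2) :
    Kernel X X where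
  toFun x := θ.map fun η => F η x
  measurable' := by
    refine Measure.measurable_of_measurable_coe _ fun A hA => ?_
    have map_eq (x : X) : θ.map (fun η => F η x) A =
        θ ((fun η => (η, x)) ⁻¹' ((fun p : Y × X => F p.1 p.2) ⁻¹' A)) :=
      Measure.map_apply (hF.comp measurable_prodMk_right) hA
    simp only [map_eq]
    exact measurable_measure_prodMk_right (hF hA)

variable {θ : Measure Y} [IsProbabilityMeasure θ]

instance (hF : Measurable fun p : Y × X => F p.1 p.2) : IsMarkovKernel (transitionKernel θ hF) :=
  ⟨fun _ => Measure.isProbabilityMeasure_map (hF.comp measurable_prodMk_right).aemeasurable⟩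

lemma integral_transitionKernel (hF : Measurable fun p : Y × X => F p.1 p.2)
    (f : BoundedMeasurable X) (x : X) :
    ∫ y, eval f y ∂(transitionKernel θ hF x) = ∫ η, eval f (F η x) ∂θ :=
  integral_map (hF.comp measurable_prodMk_right).aemeasurable
    f.measurable_eval.aestronglyMeasurable

variable {g : X → ℝ}

lemma averageCLM_pow_ofReal (hF : Measurable fun p : Y × X => F p.1 p.2) (hg : BddMeasurable g)
    (k : ℕ) (x : X) :
    eval ((averageCLM (transitionKernel θ hF) ^ k) (ofReal hg)) x =
      ((averageOp F θ)^[k] g x : ℝ) := by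
  induction k generalizing x with
  | zero => rfl
  | succ k ih =>
    rw [pow_succ', mul_apply_eq_comp, eval_averageCLM, integral_transitionKernel,
      Function.iterate_succ_apply', averageOp]
    simp only [ih]
    exact integral_complex_ofReal

lemma eval_weightedOp_pow (hF : Measurable fun p : Y × X => F p.1 p.2) (hg : BddMeasurable g)
    (z : ℂ) (t : ℕ) (x : X) :
    eval ((weightedOp (transitionKernel θ hF) (expWeight hg z) ^ t) (one X)) x =
      ∫ ω, Complex.exp (z * randomSum F g t (ω, x)) ∂(Measure.infinitePi fun _ : ℕ => θ) := by
  induction t generalizing x with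
  | zero => simp only [pow_zero, one_apply_eq_self, eval_one, randomSum, Finset.range_zero,
      Finset.sum_empty, Complex.ofReal_zero, mul_zero, Complex.exp_zero, integral_const,
      probReal_univ, one_smul]
  | succ t ih =>
    have randomSum_consSeq (η : Y) (ω : ℕ → Y) :
        randomSum F g (t + 1) (consSeq η ω, x) = g x + randomSum F g t (ω, F η x) :=
      randomSum_succ F g t (consSeq η ω, x)
    have hS : BddMeasurable fun ω => randomSum F g (t + 1) (ω, x) :=
      (hg.randomSum hF (t + 1)).comp measurable_prodMk_right
    rw [integral_infinitePi_eq_integral_consSeq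
        (φ := fun ω => Complex.exp (z * randomSum F g (t + 1) (ω, x)))
        ((expWeight hS z).integrable_eval _),
      pow_succ', mul_apply_eq_comp, eval_weightedOp, integral_transitionKernel]
    simp only [ih, eval_expWeight, randomSum_consSeq, Complex.ofReal_add, mul_add, Complex.exp_add,
      integral_const_mul]

variable {μ : Measure X} [IsProbabilityMeasure μ]

lemma integralCLM_weightedOp_pow (hF : Measurable fun p : Y × X => F p.1 p.2)
    (hg : BddMeasurable g) (z : ℂ) (t : ℕ) :
    integralCLM μ ((weightedOp (transitionKernel θ hF) (expWeight hg z) ^ t) (one X)) =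
      complexMGF (randomSum F g t) (path θ μ) z := by
  rw [integralCLM_apply, complexMGF]
  simp only [eval_weightedOp_pow]
  exact (integral_prod_symm _ ((expWeight (hg.randomSum hF t) z).integrable_eval _)).symm

lemma norm_weightedOp_sub_averageCLM_le (κ : Kernel X X) [IsMarkovKernel κ]
    (hg : BddMeasurable g) {G : ℝ} (hG0 : 0 ≤ G) (hG : ∀ x, |g x| ≤ G) {z : ℂ} (hz : ‖z‖ ≤ 1)
    (f : BoundedMeasurable X) :
    ‖weightedOp κ (expWeight hg z) f - averageCLM κ f‖ ≤ G * Real.exp G * ‖z‖ * ‖f‖ := by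
  rw [← weightedOp_sub]
  exact (norm_weightedOp_le κ _ f).trans
    (mul_le_mul_of_nonneg_right (norm_expWeight_sub_one_le hg hG0 hG hz) (norm_nonneg f))

lemma BddMeasurable.differentiable_complexMGF (hg : BddMeasurable g) :
    Differentiable ℂ (complexMGF g μ) := by
  obtain ⟨G, hG⟩ := hg.bounded
  have integrable_exp : integrableExpSet g μ = univ := eq_univ_of_forall fun x =>
    integrable_exp_mul_of_mem_Icc hg.measurable.aemeasurable
      (.of_forall fun y => abs_le.1 (hG y))
  exact fun z => (hasDerivAt_complexMGF (by
    rw [integrable_exp, interior_univ]; trivial)).differentiableAt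

namespace StationarySystem

lemma invariant_transitionKernel (H : StationarySystem F θ μ) :
    (transitionKernel θ H.measurable).Invariant μ := by
  refine Measure.ext fun A hA => ?_
  rw [Measure.bind_apply hA (Kernel.aemeasurable _), ← H.measure_preimage hA.nullMeasurableSet,
    Measure.prod_apply_symm (H.measurable hA)]
  exact lintegral_congr fun x =>
    Measure.map_apply (H.measurable.comp measurable_prodMk_right) hA

lemma integral_randomSum (H : StationarySystem F θ μ) (hg : BddMeasurable g)
    (t : ℕ) : ∫ p, randomSum F g t p ∂(path θ μ) = t * ∫ x, g x ∂μ := by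
  have integral_eq (k : ℕ) :
      ∫ p : (ℕ → Y) × X, g (randomOrbit F p.1 p.2 k) ∂(path θ μ) = ∫ x, g x ∂μ := by
    have hmp := H.measurePreserving_randomOrbit k
    conv_rhs => rw [← hmp.map_eq]
    exact (integral_map hmp.aemeasurable hg.measurable.aestronglyMeasurable).symm
  simp only [randomSum]
  rw [integral_finsetSum _ fun k _ =>
    (hg.comp (measurable_randomOrbit H.measurable k)).integrable _]
  simp only [integral_eq, Finset.sum_const, Finset.card_range, nsmul_eq_mul]

theorem exists_quasiPower (H : StationarySystem F θ μ) {C ρ : ℝ}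
    (hgap : SpectralGap (averageCLM (transitionKernel θ H.measurable)) (integralCLM μ) (one X) C ρ)
    (hg : BddMeasurable g) (h0 : ∫ x, g x ∂μ = 0) :
    ∃ (ℓ : ℂ → ℂ) (δ K : ℝ), QuasiPower (path θ μ) (randomSum F g) ℓ δ K := by
  obtain ⟨G, hG⟩ := hg.bounded
  have hG' (x : X) : |g x| ≤ max G 1 := (hG x).trans (le_max_left _ _)
  have hG'pos : 0 < max G 1 := one_pos.trans_le (le_max_right _ _)
  have mgf_eq := integralCLM_weightedOp_pow (μ := μ) (θ := θ) H.measurable hg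
  have hS := hg.randomSum H.measurable
  obtain ⟨ℓ, δ, K, hδ, hdiff, hℓ0, hbound⟩ := hgap.exists_quasiPower
    (κ := max G 1 * Real.exp (max G 1)) (by positivity)
    (fun z hz f => norm_weightedOp_sub_averageCLM_le _ hg hG'pos.le hG' hz f)
    (fun t => by simpa only [mgf_eq] using (hS t).differentiable_complexMGF)
  exact ⟨ℓ, δ, K,
    { aemeasurable := fun t => (hS t).measurable.aemeasurable
      bounded := fun t => (hS t).bounded.imp fun _ hb => .of_forall hb
      centred := fun t => by rw [H.integral_randomSum hg, h0, mul_zero]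
      δ_pos := hδ
      differentiableOn := hdiff
      map_zero := hℓ0
      bound := fun t z hz => by rw [← mgf_eq]; exact hbound t z hz }⟩

end StationarySystem

end TransitionKernel

/-! ### The Green–Kubo formula -/

namespace StationarySystem

open BoundedMeasurable

variable {X Y : Type*} [MeasurableSpace X] [MeasurableSpace Y] {F : Y → X → X} {θ : Measure Y}
  {μ : Measure X} [IsProbabilityMeasure θ] [IsProbabilityMeasure μ] {g : X → ℝ}

lemma integral_mul_randomSum_pathShift (H : StationarySystem F θ μ) (hg : BddMeasurable g)
    (t : ℕ) : ∫ p, g p.2 * randomSum F g t (pathShift F p) ∂(path θ μ) =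
      ∑ k ∈ Finset.range t, ∫ x, g x * (averageOp F θ)^[k + 1] g x ∂μ := by
  simp only [randomSum, randomOrbit_pathShift, Finset.mul_sum]
  rw [integral_finsetSum _ fun k _ => ((hg.comp measurable_snd).mul
    (hg.comp (measurable_randomOrbit H.measurable (k + 1)))).integrable _]
  exact Finset.sum_congr rfl fun k _ => integral_mul_randomOrbit H.measurable hg hg (k + 1)

lemma integral_randomSum_sq_succ (H : StationarySystem F θ μ) (hg : BddMeasurable g) (t : ℕ) :
    ∫ p, randomSum F g (t + 1) p ^ 2 ∂(path θ μ) =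
      ∫ x, g x ^ 2 ∂μ + 2 * ∑ k ∈ Finset.range t, ∫ x, g x * (averageOp F θ)^[k + 1] g x ∂μ +
        ∫ p, randomSum F g t p ^ 2 ∂(path θ μ) := by
  have hgs : BddMeasurable fun p : (ℕ → Y) × X => g p.2 := hg.comp measurable_snd
  have hS : BddMeasurable fun p => randomSum F g t (pathShift F p) :=
    (hg.randomSum H.measurable t).comp (measurable_pathShift H.measurable)
  have integral_first : ∫ p : (ℕ → Y) × X, g p.2 ^ 2 ∂(path θ μ) = ∫ x, g x ^ 2 ∂μ := by
    simpa only [probReal_univ, one_smul] using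
      integral_fun_snd (μ := Measure.infinitePi fun _ : ℕ => θ) (ν := μ) fun x => g x ^ 2
  have integral_shift : ∫ p, randomSum F g t (pathShift F p) ^ 2 ∂(path θ μ) =
      ∫ p, randomSum F g t p ^ 2 ∂(path θ μ) := by
    have hmp := H.measurePreserving_pathShift
    conv_rhs => rw [← hmp.map_eq]
    exact (integral_map hmp.aemeasurable
      (hg.randomSum H.measurable t).pow_two.measurable.aestronglyMeasurable).symm
  have integrable_cross := ((BddMeasurable.const 2).mul (hgs.mul hS)).integrable (path θ μ)
  have integrable_sq_add_cross : Integrable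
      (fun p => g p.2 ^ 2 + 2 * (g p.2 * randomSum F g t (pathShift F p))) (path θ μ) :=
    (hgs.pow_two.integrable _).add integrable_cross
  simp only [randomSum_succ, add_sq, mul_assoc]
  rw [integral_add integrable_sq_add_cross (hS.pow_two.integrable _),
    integral_add (hgs.pow_two.integrable _) integrable_cross, integral_const_mul,
    H.integral_mul_randomSum_pathShift hg, integral_first, integral_shift]

section SpectralGap

variable {C ρ : ℝ} (H : StationarySystem F θ μ)
  (hgap : SpectralGap (averageCLM (transitionKernel θ H.measurable)) (integralCLM μ) (one X) C ρ)
  (hg : BddMeasurable g) (h0 : ∫ x, g x ∂μ = 0)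

include hgap h0

lemma abs_averageOp_iterate_le (k : ℕ) (x : X) :
    |(averageOp F θ)^[k] g x| ≤ C * ρ ^ k * ‖ofReal hg‖ := by
  have integral_ofReal : integralCLM μ (ofReal hg) = 0 := by
    rw [integralCLM_ofReal, h0, Complex.ofReal_zero]
  have decay := (norm_eval_le _ x).trans (hgap.decay k _ integral_ofReal)
  rwa [averageCLM_pow_ofReal, Complex.norm_real] at decay

include hg in
lemma summable_correlations :
    Summable fun t : ℕ => ∫ x, g x * (averageOp F θ)^[t + 1] g x ∂μ := by
  obtain ⟨G, hG⟩ := hg.bounded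
  refine Summable.of_norm_bounded (g := fun t => (G * (C * ρ * ‖ofReal hg‖)) * ρ ^ t)
    ((summable_geometric_of_lt_one hgap.ρ_nonneg hgap.ρ_lt_one).mul_left _) fun t => ?_
  calc ‖∫ x, g x * (averageOp F θ)^[t + 1] g x ∂μ‖
      ≤ G * (C * ρ ^ (t + 1) * ‖ofReal hg‖) * μ.real univ :=
        norm_integral_le_of_norm_le_const (.of_forall fun x => by
          rw [norm_mul]
          exact mul_le_mul (hG x) (H.abs_averageOp_iterate_le hgap hg h0 _ x) (abs_nonneg _)
            ((abs_nonneg _).trans (hG x)))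
    _ = G * (C * ρ * ‖ofReal hg‖) * ρ ^ t := by rw [probReal_univ]; ring

end SpectralGap

/-- The increments of `𝔼 S_t ^ 2` are partial sums of the correlation
series, so their Cesàro means converge to its sum. -/
theorem tendsto_variance (H : StationarySystem F θ μ) (hg : BddMeasurable g)
    (hs : Summable fun t : ℕ => ∫ x, g x * (averageOp F θ)^[t + 1] g x ∂μ) :
    Tendsto (fun t : ℕ => (1 / (t : ℝ)) * ∫ p, randomSum F g t p ^ 2 ∂(path θ μ)) atTop
      (𝓝 (∫ x, g x ^ 2 ∂μ + 2 * ∑' t : ℕ, ∫ x, g x * (averageOp F θ)^[t + 1] g x ∂μ)) := by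
  refine ((hs.hasSum.tendsto_sum_nat.const_mul 2).const_add
    (∫ x, g x ^ 2 ∂μ)).cesaro.congr fun t => ?_
  rw [one_div]
  congr 1
  induction t with
  | zero => simp [randomSum]
  | succ t ih => rw [Finset.sum_range_succ, ih, H.integral_randomSum_sq_succ hg t, add_comm]

end StationarySystem

/-! ### Minorization of Markov kernels -/

section Minorization

open BoundedMeasurable

variable {X : Type*} [MeasurableSpace X]

instance isMarkovKernel_pow (κ : Kernel X X) [IsMarkovKernel κ] (n : ℕ) :
    IsMarkovKernel (κ ^ n) := by
  induction n with
  | zero => exact inferInstanceAs (IsMarkovKernel Kernel.id)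
  | succ n ih => rw [pow_succ]; exact Kernel.IsMarkovKernel.comp _ _

section SpectralGap

variable {κ : Kernel X X} [IsMarkovKernel κ]

lemma eval_averageCLM_pow (n : ℕ) (f : BoundedMeasurable X) (x : X) :
    eval ((averageCLM κ ^ n) f) x = ∫ y, eval f y ∂((κ ^ n) x) := by
  induction n generalizing x with
  | zero =>
    rw [pow_zero, one_apply_eq_self, pow_zero]
    exact (integral_dirac' _ x f.measurable_eval.stronglyMeasurable).symm
  | succ n ih =>
    rw [pow_succ', mul_apply_eq_comp, eval_averageCLM, pow_succ]
    simp only [ih]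
    exact (Kernel.integral_comp (f.integrable_eval _)).symm

lemma norm_integral_sub_le_of_measure_le {μ ν : Measure X} [IsProbabilityMeasure μ]
    (hν : ν ≤ μ) (f : BoundedMeasurable X) :
    ‖∫ y, eval f y ∂μ - ∫ y, eval f y ∂ν‖ ≤ (1 - ν.real univ) * ‖f‖ := by
  have : IsFiniteMeasure ν := isFiniteMeasure_of_le μ hν
  have sub_add : μ - ν + ν = μ := Measure.sub_add_cancel_of_le hν
  have mass_sub : (μ - ν).real univ = 1 - ν.real univ := by
    rw [eq_sub_iff_add_eq, ← measureReal_add_apply, sub_add, probReal_univ]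
  have integral_sub : ∫ y, eval f y ∂μ - ∫ y, eval f y ∂ν = ∫ y, eval f y ∂(μ - ν) := by
    rw [sub_eq_iff_eq_add, ← integral_add_measure (f.integrable_eval _) (f.integrable_eval _),
      sub_add]
  rw [integral_sub, ← mass_sub, mul_comm]
  exact norm_integral_le_of_norm_le_const (.of_forall f.norm_eval_le)

theorem exists_spectralGap_of_minorization {μ : Measure X} [IsProbabilityMeasure μ]
    (hκ : κ.Invariant μ) {N : ℕ} (hN : 0 < N) {ν : Measure X} (hν0 : ν ≠ 0)
    (hν : ∀ x, ν ≤ (κ ^ N) x) :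
    ∃ C ρ : ℝ, SpectralGap (averageCLM κ) (integralCLM μ) (one X) C ρ := by
  have : Nonempty X := by
    by_contra hX
    rw [not_nonempty_iff] at hX
    exact hν0 (Measure.eq_zero_of_isEmpty ν)
  have : IsFiniteMeasure ν := isFiniteMeasure_of_le _ (hν (Classical.arbitrary X))
  have : NeZero ν := ⟨hν0⟩
  have mass_pos : 0 < ν.real univ := measureReal_univ_pos
  refine SpectralGap.exists_of_minorization norm_one_le ?_ (averageCLM_one κ)
    (integralCLM_averageCLM hκ) (norm_averageCLM_le κ) (norm_integral_eval_le · μ) hN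
    (γ := max (1 - ν.real univ) 2⁻¹) (by positivity) (max_lt (by linarith) (by norm_num))
    (ν := fun f => ∫ y, eval f y ∂ν) fun f => norm_le (by positivity) fun x => ?_
  · rw [integralCLM_apply]
    simp only [eval_one, integral_const, probReal_univ, one_smul]
  · rw [eval_sub, eval_smul, eval_one, mul_one, eval_averageCLM_pow]
    exact (norm_integral_sub_le_of_measure_le (hν x) f).trans (by gcongr; exact le_max_left _ _)

end SpectralGap

/-- The set `s` is small at time `n` for the kernel `κ` and the measure `ν`: the `n`-step
transition probabilities from points of `s` dominate a common positive multiple of `ν`. -/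
def IsSmall (κ : Kernel X X) (ν : Measure X) (n : ℕ) (s : Set X) : Prop :=
  ∃ c : ENNReal, c ≠ 0 ∧ ∀ x ∈ s, c • ν ≤ (κ ^ n) x

namespace IsSmall

variable {κ : Kernel X X} {ν : Measure X} {n m : ℕ} {s t V : Set X}

lemma empty : IsSmall κ ν n ∅ := ⟨1, one_ne_zero, fun _ hx => hx.elim⟩

lemma mono (h : IsSmall κ ν n t) (hst : s ⊆ t) : IsSmall κ ν n s := by
  obtain ⟨c, hc, hle⟩ := h
  exact ⟨c, hc, fun x hx => hle x (hst hx)⟩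

lemma union (hs : IsSmall κ ν n s) (ht : IsSmall κ ν n t) : IsSmall κ ν n (s ∪ t) := by
  obtain ⟨c, hc, hle⟩ := hs
  obtain ⟨c', hc', hle'⟩ := ht
  refine ⟨min c c', (lt_min (pos_iff_ne_zero.2 hc) (pos_iff_ne_zero.2 hc')).ne', fun x hx => ?_⟩
  rcases hx with hx | hx
  · exact le_trans (by gcongr; exact min_le_left _ _) (hle x hx)
  · exact le_trans (by gcongr; exact min_le_right _ _) (hle' x hx)

lemma comp (h : IsSmall κ ν m V) (hV : MeasurableSet V) {c : ENNReal} (hc : c ≠ 0)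
    (hs : ∀ y ∈ s, c ≤ (κ ^ n) y V) : IsSmall κ ν (n + m) s := by
  obtain ⟨c', hc', hle⟩ := h
  refine ⟨c' * c, mul_ne_zero hc' hc, fun y hy => Measure.le_iff.2 fun A hA => ?_⟩
  rw [Kernel.pow_add_apply_eq_lintegral κ n m y hA]
  calc (c' * c) • ν A = c' * ν A * c := by rw [smul_eq_mul]; ring
    _ ≤ c' * ν A * (κ ^ n) y V := by gcongr; exact hs y hy
    _ = ∫⁻ _ in V, c' * ν A ∂((κ ^ n) y) := by rw [setLIntegral_const]
    _ ≤ ∫⁻ z in V, (κ ^ m) z A ∂((κ ^ n) y) := setLIntegral_mono' hV fun z hz => hle z hz A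
    _ ≤ ∫⁻ z, (κ ^ m) z A ∂((κ ^ n) y) := setLIntegral_le_lintegral _ _

lemma succ_of_le (hV : MeasurableSet V) (hνV : ν V ≠ 0) (hone : ∀ x ∈ V, ν ≤ κ x) (n : ℕ) :
    IsSmall κ ν (n + 1) V := by
  induction n with
  | zero => exact ⟨1, one_ne_zero, by simpa only [one_smul, zero_add, pow_one] using hone⟩
  | succ n ih =>
    rw [add_comm]
    exact ih.comp hV hνV fun y hy => by rw [pow_one]; exact hone y hy V

end IsSmall

/-- From all points near `x`, the set `V` is reached at time `n` with probability bounded below. -/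
def Reaches [TopologicalSpace X] (κ : Kernel X X) (V : Set X) (n : ℕ) (x : X) : Prop :=
  ∃ c : ENNReal, c ≠ 0 ∧ ∀ᶠ y in 𝓝 x, c ≤ (κ ^ n) y V

section Topology

variable [TopologicalSpace X] {κ : Kernel X X} {V : Set X}

lemma Reaches.of_mem_nhds {x : X} (hV : V ∈ 𝓝 x) : Reaches κ V 0 x := by
  refine ⟨1, one_ne_zero, ?_⟩
  filter_upwards [hV] with y hy
  exact (Measure.dirac_apply_of_mem hy).ge

/-- Once the process is in `V` it may stay there for arbitrarily long, so the different hitting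
times of the members of a finite cover of `K` can all be delayed to a common time. -/
lemma exists_forall_ge_isSmall {K : Set X} (hK : IsCompact K) (hV : MeasurableSet V)
    {ν : Measure X} (hνV : ν V ≠ 0) (hone : ∀ x ∈ V, ν ≤ κ x)
    (hreach : ∀ x ∈ K, ∃ n, Reaches κ V n x) : ∃ M : ℕ, ∀ n ≥ M, IsSmall κ ν n K := by
  refine hK.induction_on (p := fun s => ∃ M : ℕ, ∀ n ≥ M, IsSmall κ ν n s) ⟨0, fun _ _ => .empty⟩
    ?_ ?_ fun x hx => ?_
  · rintro s t hst ⟨M, hM⟩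
    exact ⟨M, fun n hn => (hM n hn).mono hst⟩
  · rintro s t ⟨M, hM⟩ ⟨M', hM'⟩
    exact ⟨max M M', fun n hn =>
      (hM n (le_of_max_le_left hn)).union (hM' n (le_of_max_le_right hn))⟩
  · obtain ⟨n, c, hc, near⟩ := hreach x hx
    refine ⟨_, mem_nhdsWithin_of_mem_nhds near, n + 1, fun m hm => ?_⟩
    obtain ⟨j, rfl⟩ := Nat.exists_eq_add_of_le hm
    rw [add_assoc, add_comm 1]
    exact (IsSmall.succ_of_le hV hνV hone j).comp hV hc fun y hy => hy

theorem exists_uniform_minorization {K : Set X} (hK : IsCompact K) (hKm : MeasurableSet K)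
    (hmaps : ∀ x, κ x K = 1) (hV : MeasurableSet V) {ν : Measure X} (hνV : ν V ≠ 0)
    (hone : ∀ x ∈ V, ν ≤ κ x) (hreach : ∀ x ∈ K, ∃ n, Reaches κ V n x) :
    ∃ N > 0, IsSmall κ ν N univ := by
  obtain ⟨M, hM⟩ := exists_forall_ge_isSmall hK hV hνV hone hreach
  exact ⟨1 + M, by positivity, (hM M le_rfl).comp hKm one_ne_zero fun x _ => by
    rw [pow_one, hmaps]⟩

end Topology

section RandomMap

variable [TopologicalSpace X] {Y : Type*} [MeasurableSpace Y] [TopologicalSpace Y] {F : Y → X → X}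
  {θ : Measure Y} [IsProbabilityMeasure θ] {V : Set X} {η : Y} {n : ℕ} {x : X}

lemma Reaches.step (hF : Measurable fun p : Y × X => F p.1 p.2)
    (hFc : Continuous fun p : Y × X => F p.1 p.2) (hV : MeasurableSet V)
    (hη : ∀ J ∈ 𝓝 η, θ J ≠ 0) (h : Reaches (transitionKernel θ hF) V n (F η x)) :
    Reaches (transitionKernel θ hF) V (n + 1) x := by
  obtain ⟨c, hc, near⟩ := h
  have near_prod : ∀ᶠ p : Y × X in 𝓝 η ×ˢ 𝓝 x, c ≤ (transitionKernel θ hF ^ n) (F p.1 p.2) V :=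
    nhds_prod_eq (x := η) (y := x) ▸ (hFc.tendsto (η, x)).eventually near
  obtain ⟨good, good_near, close, close_near, hle⟩ := eventually_prod_iff.1 near_prod
  refine ⟨c * θ {η' | good η'}, mul_ne_zero hc (hη _ good_near), ?_⟩
  filter_upwards [close_near] with y hy
  have measurable_prob : Measurable fun z => (transitionKernel θ hF ^ n) z V :=
    Kernel.measurable_coe _ hV
  have measurable_F : Measurable fun η' => F η' y := hF.comp measurable_prodMk_right
  calc c * θ {η' | good η'}
      ≤ c * θ {η' | c ≤ (transitionKernel θ hF ^ n) (F η' y) V} := by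
        gcongr
        exact fun hgood => hle hgood hy
    _ ≤ ∫⁻ η', (transitionKernel θ hF ^ n) (F η' y) V ∂θ :=
        mul_meas_ge_le_lintegral₀ (measurable_prob.comp measurable_F).aemeasurable c
    _ = (transitionKernel θ hF ^ (n + 1)) y V := by
        rw [add_comm, Kernel.pow_add_apply_eq_lintegral _ 1 n y hV, pow_one]
        exact (lintegral_map measurable_prob measurable_F).symm

lemma Reaches.iterate (hF : Measurable fun p : Y × X => F p.1 p.2)
    (hFc : Continuous fun p : Y × X => F p.1 p.2) (hV : MeasurableSet V)
    (hη : ∀ J ∈ 𝓝 η, θ J ≠ 0) (k : ℕ)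
    (h : Reaches (transitionKernel θ hF) V n ((F η)^[k] x)) :
    Reaches (transitionKernel θ hF) V (n + k) x := by
  induction k generalizing x with
  | zero => exact h
  | succ k ih => exact (ih (x := F η x) h).step hF hFc hV hη

end RandomMap

end Minorization

/-! ### Additive noise around an attracting interval -/

/-- The interval `[d₁, d₂]` is invariant and topologically transitive under `T`, and attracts
almost every point of `K`. -/
structure IsTransitiveAttractor (T : ℝ → ℝ) (K : Set ℝ) (d₁ d₂ : ℝ) : Prop where
  lt : d₁ < d₂
  mapsTo : MapsTo T (Icc d₁ d₂) (Icc d₁ d₂)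
  transitive : TopTransitiveOn T (Icc d₁ d₂)
  attracting : ∀ᵐ x ∂(volume.restrict K),
    Tendsto (fun t : ℕ => Metric.infDist (T^[t] x) (Icc d₁ d₂)) atTop (𝓝 0)

/-- The map `T` perturbed by the noise `η`, scaled by the local intensity `σ`. -/
def noisyMap (T σ : ℝ → ℝ) (η x : ℝ) : ℝ := T x + σ x * η

/-- The points that `noisyMap T σ` reaches from `x` with a noise in `(-a, a)`. -/
def noiseInterval (T σ : ℝ → ℝ) (a x : ℝ) : Set ℝ := Ioo (T x - a * σ x) (T x + a * σ x)

section NoisyMap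

variable {T σ : ℝ → ℝ} {a x y : ℝ}

lemma noisyMap_zero : noisyMap T σ 0 = T := by
  ext x
  rw [noisyMap, mul_zero, add_zero]

lemma continuous_noisyMap (hT : Continuous T) (hσ : Continuous σ) :
    Continuous fun p : ℝ × ℝ => noisyMap T σ p.1 p.2 := by
  unfold noisyMap
  fun_prop

lemma noisyMap_mem_noiseInterval (hσ : 0 < σ x) {η : ℝ} (hη : η ∈ Ioo (-a) a) :
    noisyMap T σ η x ∈ noiseInterval T σ a x := by
  rw [noisyMap, noiseInterval]
  constructor <;> nlinarith [hη.1, hη.2]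

lemma exists_noisyMap_eq (hσ : 0 < σ x) (hy : y ∈ noiseInterval T σ a x) :
    ∃ η ∈ Ioo (-a) a, noisyMap T σ η x = y := by
  refine ⟨(y - T x) / σ x, ⟨?_, ?_⟩, ?_⟩
  · rw [lt_div_iff₀ hσ]; linarith [hy.1]
  · rw [div_lt_iff₀ hσ]; linarith [hy.2]
  · rw [noisyMap, mul_div_cancel₀ _ hσ.ne', add_sub_cancel]

lemma map_mem_noiseInterval (ha : 0 < a) (hσ : 0 < σ x) : T x ∈ noiseInterval T σ a x :=
  have := mul_pos ha hσ
  ⟨by linarith, by linarith⟩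

lemma mapsTo_of_noiseInterval_subset {K : Set ℝ} (ha : 0 < a) (hσ : ∀ x ∈ K, 0 < σ x)
    (hK : ∀ x ∈ K, noiseInterval T σ a x ⊆ K) : MapsTo T K K := fun x hx =>
  hK x hx (map_mem_noiseInterval ha (hσ x hx))

end NoisyMap

lemma eqOn_iterate {α : Type*} {f g : α → α} {s : Set α} (h : EqOn f g s) (hs : MapsTo f s s)
    (n : ℕ) : EqOn f^[n] g^[n] s := by
  induction n with
  | zero => exact fun _ _ => rfl
  | succ n ih =>
    intro x hx
    rw [Function.iterate_succ_apply, Function.iterate_succ_apply, ih (hs hx), h hx]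

namespace IsTransitiveAttractor

variable {T T' σ : ℝ → ℝ} {a s₀ d₁ d₂ : ℝ} {K : Set ℝ}

lemma congr (A : IsTransitiveAttractor T K d₁ d₂) (hTT' : EqOn T T' K) (hK : MeasurableSet K)
    (hmaps : MapsTo T K K) (hsub : Icc d₁ d₂ ⊆ K) : IsTransitiveAttractor T' K d₁ d₂ := by
  refine ⟨A.lt, A.mapsTo.congr (hTT'.mono hsub), fun U V hU hV hUs hVs => ?_, ?_⟩
  · obtain ⟨k, x, hx, hkx⟩ := A.transitive U V hU hV hUs hVs
    exact ⟨k, x, hx, eqOn_iterate hTT' hmaps k (hsub hx.2) ▸ hkx⟩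
  · filter_upwards [A.attracting, ae_restrict_mem hK] with x hattr hx
    exact hattr.congr fun t => by rw [eqOn_iterate hTT' hmaps t hx]

/-- The first noise step moves almost surely to a point attracted by `[d₁, d₂]`; once the
deterministic orbit is within noise range of `[d₁, d₂]`, a second noise step enters it. -/
lemma exists_jump (A : IsTransitiveAttractor T K d₁ d₂) (ha : 0 < a) (hs : 0 < s₀)
    (hσ : ∀ x ∈ K, s₀ ≤ σ x) (hK : ∀ x ∈ K, noiseInterval T σ a x ⊆ K) {x : ℝ} (hx : x ∈ K) :
    ∃ y ∈ noiseInterval T σ a x, ∃ t : ℕ, T^[t] y ∈ K ∧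
      (noiseInterval T σ a (T^[t] y) ∩ Ioo d₁ d₂).Nonempty := by
  have σ_pos : ∀ x ∈ K, 0 < σ x := fun x hx => hs.trans_le (hσ x hx)
  have volume_pos : volume.restrict K (noiseInterval T σ a x) ≠ 0 := by
    rw [Measure.restrict_eq_self _ (hK x hx)]
    exact (isOpen_Ioo.measure_pos volume ⟨T x, map_mem_noiseInterval ha (σ_pos x hx)⟩).ne'
  obtain ⟨y, hy, attracted⟩ : ∃ y ∈ noiseInterval T σ a x,
      Tendsto (fun t : ℕ => Metric.infDist (T^[t] y) (Icc d₁ d₂)) atTop (𝓝 0) := by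
    by_contra! hcon
    exact volume_pos (measure_mono_null hcon (ae_iff.1 A.attracting))
  obtain ⟨t, close⟩ := ((tendsto_add_atTop_iff_nat 1).2 attracted |>.eventually
    (gt_mem_nhds (mul_pos ha hs))).exists
  obtain ⟨w, hw, hdist⟩ := (Metric.infDist_lt_iff ⟨d₁, left_mem_Icc.2 A.lt.le⟩).1 close
  have iterate_mem : T^[t] y ∈ K :=
    (mapsTo_of_noiseInterval_subset ha σ_pos hK).iterate t (hK x hx hy)
  refine ⟨y, hy, t, iterate_mem, ?_⟩
  rw [Function.iterate_succ_apply', Real.dist_eq, abs_lt] at hdist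
  have noise_range : a * s₀ ≤ a * σ (T^[t] y) := by gcongr; exact hσ _ iterate_mem
  have w_mem : w ∈ noiseInterval T σ a (T^[t] y) := ⟨by linarith, by linarith⟩
  rw [← closure_Ioo A.lt.ne] at hw
  exact mem_closure_iff.1 hw _ isOpen_Ioo w_mem

lemma subset_of_isClosed (A : IsTransitiveAttractor T K d₁ d₂) (ha : 0 < a) (hs : 0 < s₀)
    (hσ : ∀ x ∈ K, s₀ ≤ σ x) (hK : ∀ x ∈ K, noiseInterval T σ a x ⊆ K) (hKc : IsClosed K)
    (hKne : K.Nonempty) : Icc d₁ d₂ ⊆ K := by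
  obtain ⟨x, hx⟩ := hKne
  obtain ⟨y, -, t, iterate_mem, u, hu⟩ := A.exists_jump ha hs hσ hK hx
  have hmaps := mapsTo_of_noiseInterval_subset ha (fun x hx => hs.trans_le (hσ x hx)) hK
  intro w hw
  rw [← hKc.closure_eq, mem_closure_iff]
  intro U hU hwU
  obtain ⟨k, v, hv, hkv⟩ := A.transitive U _ hU (isOpen_Ioo.inter isOpen_Ioo) ⟨w, hwU, hw⟩
    ⟨u, hu, Ioo_subset_Icc_self hu.2⟩
  exact ⟨_, hkv.1, hmaps.iterate k (hK _ iterate_mem hv.1.1)⟩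

end IsTransitiveAttractor

section LocalMinorization

variable {T σ : ℝ → ℝ} {a s₀ s₁ z : ℝ} {θ : Measure ℝ} {m : ENNReal}

lemma smul_restrict_le_map_affine {J V : Set ℝ} (hθ : m • volume.restrict J ≤ θ)
    {τ σ s : ℝ} (hσ : 0 < σ) (hσs : σ ≤ s)
    (hVJ : (fun η => τ + σ * η) ⁻¹' V ⊆ J) :
    (m * ENNReal.ofReal s⁻¹) • volume.restrict V ≤ θ.map fun η => τ + σ * η := by
  have measurable_affine : Measurable fun η : ℝ => τ + σ * η := by fun_prop
  refine Measure.le_iff.2 fun A hA => ?_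
  have volume_preimage : volume ((fun η => τ + σ * η) ⁻¹' (A ∩ V)) =
      ENNReal.ofReal σ⁻¹ * volume (A ∩ V) := by
    change volume ((fun η => σ * η) ⁻¹' ((fun y => τ + y) ⁻¹' (A ∩ V))) = _
    rw [Real.volume_preimage_mul_left hσ.ne', measure_preimage_add, abs_of_pos (inv_pos.2 hσ)]
  calc ((m * ENNReal.ofReal s⁻¹) • volume.restrict V) A
      = m * (ENNReal.ofReal s⁻¹ * volume (A ∩ V)) := by
        rw [Measure.smul_apply, Measure.restrict_apply hA, smul_eq_mul, mul_assoc]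
    _ ≤ m * (ENNReal.ofReal σ⁻¹ * volume (A ∩ V)) := by gcongr
    _ ≤ m * volume.restrict J ((fun η => τ + σ * η) ⁻¹' A) := by
        rw [← volume_preimage, Measure.restrict_apply (measurable_affine hA)]
        gcongr
        exact subset_inter (preimage_mono inter_subset_left)
          ((preimage_mono inter_subset_right).trans hVJ)
    _ ≤ θ ((fun η => τ + σ * η) ⁻¹' A) := hθ _
    _ = θ.map (fun η => τ + σ * η) A := (Measure.map_apply measurable_affine hA).symm

lemma exists_ball_preimage_noisyMap_subset (hT : ContinuousAt T z) (hz : Function.IsFixedPt T z)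
    (ha : 0 < a) (hs : 0 < s₀) (hσ : ∀ x, s₀ ≤ σ x) :
    ∃ δ > 0, ∀ x ∈ Metric.ball z δ,
      (fun η => noisyMap T σ η x) ⁻¹' Metric.ball z δ ⊆ Icc (-a) a := by
  obtain ⟨δ, hδ, near_fixed⟩ := Metric.continuousAt_iff.1 hT (a * s₀ / 2) (by positivity)
  rw [hz.eq] at near_fixed
  refine ⟨min δ (a * s₀ / 2), by positivity, fun x hx η hη => abs_le.1 ?_⟩
  have map_close := near_fixed (lt_of_lt_of_le hx (min_le_left _ _))
  have image_close : dist (T x + σ x * η) z < a * s₀ / 2 :=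
    lt_of_lt_of_le (Metric.mem_ball.1 hη) (min_le_right _ _)
  rw [Real.dist_eq, abs_lt] at map_close image_close
  have noise_le : |σ x * η| ≤ s₀ * a := abs_le.2 ⟨by linarith, by linarith⟩
  rw [abs_mul, abs_of_pos (hs.trans_le (hσ x))] at noise_le
  exact le_of_mul_le_mul_left ((mul_le_mul_of_nonneg_right (hσ x) (abs_nonneg η)).trans noise_le) hs

lemma exists_smul_restrict_ball_le_map_noisyMap (hT : ContinuousAt T z)
    (hz : Function.IsFixedPt T z) (ha : 0 < a) (hs : 0 < s₀) (hσ : ∀ x, s₀ ≤ σ x)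
    (hσ' : ∀ x, σ x ≤ s₁) (hm : m ≠ 0) (hθ : m • volume.restrict (Icc (-a) a) ≤ θ) :
    ∃ δ > 0, ∃ c : ENNReal, c ≠ 0 ∧ ∀ x ∈ Metric.ball z δ,
      c • volume.restrict (Metric.ball z δ) ≤ θ.map fun η => noisyMap T σ η x := by
  obtain ⟨δ, hδ, hsub⟩ := exists_ball_preimage_noisyMap_subset hT hz ha hs hσ
  have s₁_pos : 0 < s₁ := hs.trans_le ((hσ z).trans (hσ' z))
  exact ⟨δ, hδ, m * ENNReal.ofReal s₁⁻¹, mul_ne_zero hm (by simpa using s₁_pos), fun x hx =>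
    smul_restrict_le_map_affine hθ (hs.trans_le (hσ x)) (hσ' x) (hsub x hx)⟩

end LocalMinorization

section GlobalMinorization

variable {T σ : ℝ → ℝ} {a s₀ s₁ d₁ d₂ : ℝ} {K : Set ℝ} {θ : Measure ℝ} [IsProbabilityMeasure θ]

lemma Reaches.of_mem_noiseInterval (hFc : Continuous fun p : ℝ × ℝ => noisyMap T σ p.1 p.2)
    {V : Set ℝ} (hV : MeasurableSet V) (hsupp : ∀ η ∈ Ioo (-a) a, ∀ J ∈ 𝓝 η, θ J ≠ 0) {x y : ℝ}
    (hσ : 0 < σ x) (hy : y ∈ noiseInterval T σ a x) {n : ℕ}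
    (h : Reaches (transitionKernel θ hFc.measurable) V n y) :
    Reaches (transitionKernel θ hFc.measurable) V (n + 1) x := by
  obtain ⟨η, hη, rfl⟩ := exists_noisyMap_eq hσ hy
  exact h.step hFc.measurable hFc hV (hsupp η hη)

/-- Along noise that keeps close to `0` the orbit shadows the one of `T`; two jumps and the
transitivity of `T` on `[d₁, d₂]` then lead to any open set that meets `[d₁, d₂]`. -/
lemma IsTransitiveAttractor.exists_reaches (A : IsTransitiveAttractor T K d₁ d₂)
    (hFc : Continuous fun p : ℝ × ℝ => noisyMap T σ p.1 p.2) (ha : 0 < a) (hs : 0 < s₀)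
    (hσ : ∀ x ∈ K, s₀ ≤ σ x) (hK : ∀ x ∈ K, noiseInterval T σ a x ⊆ K)
    (hsupp : ∀ η ∈ Ioo (-a) a, ∀ J ∈ 𝓝 η, θ J ≠ 0) {V : Set ℝ} (hV : IsOpen V)
    (hVd : (V ∩ Icc d₁ d₂).Nonempty) {x : ℝ} (hx : x ∈ K) :
    ∃ n, Reaches (transitionKernel θ hFc.measurable) V n x := by
  have reaches_of_iterate : ∀ (k : ℕ) {n : ℕ} {y : ℝ},
      Reaches (transitionKernel θ hFc.measurable) V n (T^[k] y) →
        Reaches (transitionKernel θ hFc.measurable) V (n + k) y := fun k n y h =>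
    Reaches.iterate hFc.measurable hFc hV.measurableSet (hsupp 0 ⟨neg_lt_zero.2 ha, ha⟩) k
      (by rwa [noisyMap_zero])
  obtain ⟨y, hy, t, iterate_mem, u, hu⟩ := A.exists_jump ha hs hσ hK hx
  obtain ⟨k, v, hv, hkv⟩ := A.transitive V _ hV (isOpen_Ioo.inter isOpen_Ioo) hVd
    ⟨u, hu, Ioo_subset_Icc_self hu.2⟩
  have reaches_v := reaches_of_iterate k (Reaches.of_mem_nhds (hV.mem_nhds hkv.1))
  have reaches_iterate := reaches_v.of_mem_noiseInterval hFc hV.measurableSet hsupp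
    (hs.trans_le (hσ _ iterate_mem)) hv.1.1
  have reaches_y := reaches_of_iterate t reaches_iterate
  exact ⟨_, reaches_y.of_mem_noiseInterval hFc hV.measurableSet hsupp (hs.trans_le (hσ x hx)) hy⟩

/-- Near a fixed point in the attractor one noise step already minorizes Lebesgue measure, and
every point of `K` reaches that neighbourhood. -/
theorem IsTransitiveAttractor.exists_minorization (A : IsTransitiveAttractor T K d₁ d₂)
    (hT : Continuous T) (hFc : Continuous fun p : ℝ × ℝ => noisyMap T σ p.1 p.2) (ha : 0 < a)
    (hs : 0 < s₀) (hσ : ∀ x, s₀ ≤ σ x) (hσ' : ∀ x, σ x ≤ s₁) (hKc : IsCompact K)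
    (hK : ∀ x, noiseInterval T σ a x ⊆ K) (hθ : ∀ᵐ η ∂θ, η ∈ Ioo (-a) a)
    (hsupp : ∀ η ∈ Ioo (-a) a, ∀ J ∈ 𝓝 η, θ J ≠ 0) {r : ℝ} (hr : 0 < r) {m : ENNReal}
    (hm : m ≠ 0) (hdens : m • volume.restrict (Icc (-r) r) ≤ θ) :
    ∃ N > 0, ∃ ν : Measure ℝ, ν ≠ 0 ∧
      ∀ x, ν ≤ (transitionKernel θ hFc.measurable ^ N) x := by
  obtain ⟨z, hz, hfix⟩ := exists_mem_Icc_isFixedPt_of_mapsTo hT.continuousOn A.lt.le A.mapsTo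
  obtain ⟨δ, hδ, c, hc, hone⟩ := exists_smul_restrict_ball_le_map_noisyMap hT.continuousAt hfix hr
    hs hσ hσ' hm hdens
  set V := Metric.ball z δ
  have ball_ne_zero : (c • volume.restrict V) V ≠ 0 := by
    rw [Measure.smul_apply, Measure.restrict_apply_self]
    exact mul_ne_zero hc (Metric.measure_ball_pos volume z hδ).ne'
  have kernel_K : ∀ x, transitionKernel θ hFc.measurable x K = 1 := fun x => by
    have measurable_step : Measurable fun η => noisyMap T σ η x :=
      hFc.measurable.comp measurable_prodMk_right
    refine prob_compl_eq_zero_iff hKc.measurableSet |>.1 ?_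
    exact (ae_map_iff measurable_step.aemeasurable hKc.measurableSet).2 <|
      hθ.mono fun η hη => hK x (noisyMap_mem_noiseInterval (hs.trans_le (hσ x)) hη)
  obtain ⟨N, hN, c', hc', minorization⟩ := exists_uniform_minorization hKc hKc.measurableSet
    kernel_K Metric.isOpen_ball.measurableSet ball_ne_zero hone fun x hx =>
      A.exists_reaches hFc ha hs (fun x _ => hσ x) (fun x _ => hK x) hsupp Metric.isOpen_ball
        ⟨z, Metric.mem_ball_self hδ, hz⟩ hx
  refine ⟨N, hN, c' • c • volume.restrict V, fun hzero => ?_, fun x => minorization x (mem_univ x)⟩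
  have mass_V : c' * (c • volume.restrict V) V = 0 := congrArg (fun ν : Measure ℝ => ν V) hzero
  exact mul_ne_zero hc' ball_ne_zero mass_V

end GlobalMinorization

/-! ### Localization of the stationary measure -/

/-- In a stationary system the two integrals agree, so the nonnegative difference vanishes. -/
lemma StationarySystem.ae_eq_of_ae_le {X Y : Type*} [MeasurableSpace X] [MeasurableSpace Y]
    {F : Y → X → X} {θ : Measure Y} [IsProbabilityMeasure θ] {μ : Measure X}
    [IsProbabilityMeasure μ] (H : StationarySystem F θ μ) {V : X → ℝ} (hV : BddMeasurable V)
    (hle : ∀ᵐ p ∂(θ.prod μ), V p.2 ≤ V (F p.1 p.2)) :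
    ∀ᵐ p ∂(θ.prod μ), V p.2 = V (F p.1 p.2) := by
  have integrable_after : Integrable (fun p : Y × X => V (F p.1 p.2)) (θ.prod μ) :=
    (hV.comp H.measurable).integrable _
  have integrable_before : Integrable (fun p : Y × X => V p.2) (θ.prod μ) :=
    (hV.comp measurable_snd).integrable _
  have integral_after : ∫ p, V (F p.1 p.2) ∂(θ.prod μ) = ∫ x, V x ∂μ := by
    conv_rhs => rw [← H.map_eq]
    exact (integral_map H.measurable.aemeasurable hV.measurable.aestronglyMeasurable).symm
  have integral_before : ∫ p : Y × X, V p.2 ∂(θ.prod μ) = ∫ x, V x ∂μ := by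
    rw [integral_fun_snd, probReal_univ, one_smul]
  have integral_diff : ∫ p, (V (F p.1 p.2) - V p.2) ∂(θ.prod μ) = 0 := by
    rw [integral_sub integrable_after integrable_before, integral_after, integral_before, sub_self]
  have diff_eq_zero := (integral_eq_zero_iff_of_nonneg_ae
    (hle.mono fun p hp => sub_nonneg.2 hp) (integrable_after.sub integrable_before)).1 integral_diff
  filter_upwards [diff_eq_zero] with p hp
  exact (sub_eq_zero.1 hp).symm

namespace RandomSystem

variable (S : RandomSystem)

lemma a_pos : 0 < S.a := S.noise_assumption.a_pos

lemma gap_pos : 0 < gap S.T S.c := sub_pos.2 S.map_assumption.max_lt_one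

lemma gap_le_one : gap S.T S.c ≤ 1 := by
  have := (S.map_assumption.mapsTo S.map_assumption.c_mem).1
  unfold gap
  linarith

lemma normConst_pos : 0 < S.normConst := inv_pos.2 S.weight_integral_pos

lemma noiseDensity_eq_zero {η : ℝ} (hη : η ∉ Ioo (-S.a) S.a) : S.noiseDensity η = 0 := by
  rw [← S.bump_assumption.support_eq, Function.notMem_support] at hη
  simp [noiseDensity, hη]

lemma noiseDensity_pos {η : ℝ} (hη : η ∈ Ioo (-S.a) S.a) : 0 < S.noiseDensity η := by
  rw [← S.bump_assumption.support_eq, Function.mem_support] at hη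
  have := lt_of_le_of_ne (S.bump_assumption.nonneg η) hη.symm
  have := S.normConst_pos
  unfold noiseDensity
  positivity

lemma continuous_noiseDensity : Continuous S.noiseDensity := by
  have := S.bump_assumption.contDiff.continuous
  unfold noiseDensity
  fun_prop

lemma ae_mem_noise : ∀ᵐ η ∂S.θ, η ∈ Ioo (-S.a) S.a := by
  rw [θ, ae_withDensity_iff S.continuous_noiseDensity.measurable.ennreal_ofReal]
  refine Eventually.of_forall fun η hη => ?_
  by_contra hcon
  simp [S.noiseDensity_eq_zero hcon] at hη

lemma noise_nhds_ne_zero : ∀ η ∈ Ioo (-S.a) S.a, ∀ J ∈ 𝓝 η, S.θ J ≠ 0 := by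
  intro η hη J hJ h0
  obtain ⟨u, hu, huo, hηu⟩ := mem_nhds_iff.1 (inter_mem hJ (isOpen_Ioo.mem_nhds hη))
  have measure_u : S.θ u = 0 := measure_mono_null (hu.trans inter_subset_left) h0
  rw [θ, withDensity_apply_eq_zero S.continuous_noiseDensity.measurable.ennreal_ofReal] at measure_u
  have density_ne_zero : u ⊆ {y | ENNReal.ofReal (S.noiseDensity y) ≠ 0} ∩ u := fun y hy =>
    ⟨by simpa using S.noiseDensity_pos (hu hy).2, hy⟩
  exact (huo.measure_pos volume ⟨η, hηu⟩).ne' (measure_mono_null density_ne_zero measure_u)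

lemma exists_noise_minorization :
    ∃ m : ENNReal, m ≠ 0 ∧ m • volume.restrict (Icc (-(S.a / 2)) (S.a / 2)) ≤ S.θ := by
  have ha := S.a_pos
  obtain ⟨y, hy, hmin⟩ := (isCompact_Icc (a := -(S.a / 2)) (b := S.a / 2)).exists_isMinOn
    ⟨0, by constructor <;> linarith⟩ S.continuous_noiseDensity.continuousOn
  refine ⟨ENNReal.ofReal (S.noiseDensity y), ?_, Measure.le_iff.2 fun A hA => ?_⟩
  · simpa using S.noiseDensity_pos ⟨by linarith [hy.1], by linarith [hy.2]⟩
  · rw [θ, withDensity_apply _ hA, Measure.smul_apply, smul_eq_mul, Measure.restrict_apply hA,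
      ← setLIntegral_const]
    calc ∫⁻ _ in A ∩ Icc (-(S.a / 2)) (S.a / 2), ENNReal.ofReal (S.noiseDensity y)
        ≤ ∫⁻ z in A ∩ Icc (-(S.a / 2)) (S.a / 2), ENNReal.ofReal (S.noiseDensity z) :=
          setLIntegral_mono' (hA.inter measurableSet_Icc) fun z hz =>
            ENNReal.ofReal_le_ofReal (hmin hz.2)
      _ ≤ _ := lintegral_mono_set inter_subset_left

lemma measurable_randomMap : Measurable fun p : ℝ × ℝ => S.randomMap p.1 p.2 := by
  have measurable_T := S.extension_assumption.measurable
  have measurable_σ := S.noise_assumption.measurable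
  unfold randomMap
  fun_prop

lemma map_le_of_mem {x : ℝ} (hx : x ∈ S.space) : S.T x ≤ 1 - gap S.T S.c := by
  rw [gap, sub_sub_cancel]
  rcases le_total 0 x with h | h
  · by_cases hxc : x = S.c
    · rw [hxc]
    · exact (S.map_assumption.unique_max x ⟨h, hx.2⟩ hxc).le
  · exact (S.extension_assumption.antitoneOn ⟨le_rfl, by linarith [S.gap_pos]⟩ ⟨hx.1, h⟩ hx.1).trans
      S.extension_assumption.left_lt.le

lemma map_nonneg_of_nonpos {x : ℝ} (hx : x ∈ S.space) (h : x ≤ 0) : 0 ≤ S.T x :=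
  (S.map_assumption.mapsTo ⟨le_rfl, zero_le_one⟩).1.trans
    (S.extension_assumption.antitoneOn ⟨hx.1, h⟩ ⟨by linarith [S.gap_pos], le_rfl⟩ h)

lemma noise_le {x : ℝ} (hx : x ∈ S.space) : S.a * S.σ x ≤ gap S.T S.c / 2 := by
  rcases S.noise_assumption.cases with ⟨-, -, h, -⟩ | ⟨-, h⟩
  · exact h x hx
  · exact (h x hx).trans (min_le_left _ _)

lemma upper_le {x : ℝ} (hx : x ∈ S.space) : S.T x + S.a * S.σ x ≤ 1 - gap S.T S.c / 2 := by
  linarith [S.map_le_of_mem hx, S.noise_le hx]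

lemma randomMap_mem {x η : ℝ} (hx : x ∈ S.space) (hη : η ∈ Ioo (-S.a) S.a) :
    S.randomMap η x ∈ Icc (S.T x - S.a * S.σ x) (S.T x + S.a * S.σ x) := by
  have := S.noise_assumption.nonneg x hx
  unfold randomMap
  constructor <;> nlinarith [hη.1, hη.2]

lemma mem_space_of_mem_Ioc {x : ℝ} (hx : x ∈ Ioc 0 (1 - gap S.T S.c / 2)) : x ∈ S.space :=
  ⟨by linarith [hx.1, S.gap_pos], by linarith [hx.2, S.gap_pos]⟩

lemma θ_Iio_zero_lt_one : S.θ (Iio 0) < 1 := by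
  have half_pos := half_pos S.a_pos
  have Ioi_ne_zero : S.θ (Ioi 0) ≠ 0 :=
    S.noise_nhds_ne_zero (S.a / 2) ⟨by linarith [S.a_pos], by linarith⟩ _ (Ioi_mem_nhds half_pos)
  calc S.θ (Iio 0) < S.θ (Iio 0) + S.θ (Ioi 0) :=
        ENNReal.lt_add_right (measure_ne_top _ _) Ioi_ne_zero
    _ = S.θ (Iio 0 ∪ Ioi 0) := (measure_union
        (Set.disjoint_left.2 fun _ hneg hpos => lt_asymm hneg hpos) measurableSet_Ioi).symm
    _ ≤ 1 := prob_le_one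

lemma transition_Iio_zero_le {x : ℝ} (hx : x ∈ S.space) (hneg : x < 0) :
    S.transition x (Iio 0) ≤ S.θ (Iio 0) :=
  measure_mono fun η (hη : S.T x + S.σ x * η < 0) => by
    by_contra hcon
    have := mul_nonneg (S.noise_assumption.nonneg x hx) (not_lt.1 hcon)
    linarith [S.map_nonneg_of_nonpos hx hneg.le]

lemma transition_Iio_zero_eq_zero {x : ℝ} (hx : x ∈ Ioc 0 (1 - gap S.T S.c / 2)) :
    S.transition x (Iio 0) = 0 := by
  refine measure_mono_null (t := {η | η ∉ Ioo (-S.a) S.a})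
    (fun η (hη : S.randomMap η x < 0) hnoise => ?_) (ae_iff.1 S.ae_mem_noise)
  exact not_lt.2 ((S.noise_assumption.lower_pos x hx).le.trans
    (S.randomMap_mem (S.mem_space_of_mem_Ioc hx) hnoise).1) hη

lemma continuousOn_lower {b e : ℝ} (hb : 0 < b) (he : e < 1) :
    ContinuousOn (fun x => S.T x - S.a * S.σ x) (Icc b e) := by
  refine (S.map_assumption.continuousOn.mono (Icc_subset_Icc hb.le he.le)).sub
    (continuousOn_const.mul (S.noise_assumption.differentiableOn.continuousOn.mono ?_))
  exact Icc_subset_Ioo hb he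

lemma ae_mem_space {μ : Measure ℝ} (hac : μ ≪ volume.restrict S.space) : ∀ᵐ x ∂μ, x ∈ S.space :=
  hac.ae_le (ae_restrict_mem measurableSet_Icc)

variable {S} {μ : Measure ℝ}

namespace IsStationary

lemma stationarySystem [SFinite μ] (hμ : S.IsStationary μ) :
    StationarySystem S.randomMap S.θ μ := by
  refine ⟨S.measurable_randomMap, ?_⟩
  ext A hA
  rw [Measure.map_apply S.measurable_randomMap hA,
    Measure.prod_apply_symm (S.measurable_randomMap hA), ← hμ A hA]
  rfl

lemma ae_of_step (hμ : S.IsStationary μ) {A : Set ℝ} (hA : MeasurableSet A)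
    (h : ∀ᵐ x ∂μ, ∀ η ∈ Ioo (-S.a) S.a, S.randomMap η x ∈ A) : ∀ᵐ x ∂μ, x ∈ A := by
  rw [ae_iff]
  change μ Aᶜ = 0
  rw [← hμ _ hA.compl, lintegral_eq_zero_iff']
  · filter_upwards [h] with x hx
    exact ae_iff.1 (S.ae_mem_noise.mono fun η hη => hx η hη)
  · exact (measurable_measure_prodMk_right (S.measurable_randomMap hA.compl)).aemeasurable

lemma ae_le (hμ : S.IsStationary μ) (hac : μ ≪ volume.restrict S.space) :
    ∀ᵐ x ∂μ, x ≤ 1 - gap S.T S.c / 2 :=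
  hμ.ae_of_step measurableSet_Iic ((S.ae_mem_space hac).mono fun _ hx _ hη =>
    (S.randomMap_mem hx hη).2.trans (S.upper_le hx))

/-- A negative point stays negative with probability at most `θ (-∞, 0) < 1`, and no positive
point becomes negative. -/
lemma ae_pos [IsProbabilityMeasure μ] (hμ : S.IsStationary μ)
    (hac : μ ≪ volume.restrict S.space) : ∀ᵐ x ∂μ, 0 < x := by
  have ae_ne_zero : ∀ᵐ x ∂μ, x ≠ 0 := hac.ae_le (ae_restrict_of_ae (Measure.ae_ne volume 0))
  have contraction : μ (Iio 0) ≤ S.θ (Iio 0) * μ (Iio 0) := by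
    rw [← setLIntegral_const]
    nth_rewrite 1 [← hμ _ measurableSet_Iio]
    rw [← lintegral_indicator measurableSet_Iio]
    refine lintegral_mono_ae ?_
    filter_upwards [S.ae_mem_space hac, ae_ne_zero, hμ.ae_le hac] with x hx hx0 hxe
    rcases lt_or_gt_of_ne hx0 with hneg | hpos
    · rw [indicator_of_mem (mem_Iio.2 hneg)]
      exact S.transition_Iio_zero_le hx hneg
    · exact (S.transition_Iio_zero_eq_zero ⟨hpos, hxe⟩).trans_le zero_le
  have measure_Iio_zero : μ (Iio 0) = 0 := by
    by_contra hcon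
    have := ENNReal.mul_lt_mul_left hcon (measure_ne_top μ _) S.θ_Iio_zero_lt_one
    rw [one_mul] at this
    exact absurd contraction (not_le.2 this)
  have ae_nonneg : ∀ᵐ x ∂μ, x ∉ Iio 0 := measure_eq_zero_iff_ae_notMem.1 measure_Iio_zero
  filter_upwards [ae_nonneg, ae_ne_zero] with x hnonneg hne
  exact lt_of_le_of_ne (not_lt.1 hnonneg) hne.symm

/-- The bounded function `x ↦ min x ε` cannot increase on a set of positive measure. -/
lemma ae_ge_of_pushed [IsProbabilityMeasure μ] (hμ : S.IsStationary μ) {ε : ℝ} (hε : 0 ≤ ε)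
    (hpush : ∀ᵐ x ∂μ, ∀ η ∈ Ioo (-S.a) S.a, x < ε → x < S.randomMap η x)
    (hstay : ∀ᵐ x ∂μ, ∀ η ∈ Ioo (-S.a) S.a, ε ≤ x → ε ≤ S.randomMap η x)
    (hpos : ∀ᵐ x ∂μ, 0 < x) : ∀ᵐ x ∂μ, ε ≤ x := by
  set V : ℝ → ℝ := fun x => max 0 (min x ε) with hV
  have bddMeasurable_V : BddMeasurable V := by
    refine ⟨by fun_prop, ε, fun x => ?_⟩
    rw [abs_of_nonneg (le_max_left _ _)]
    exact max_le hε (min_le_right _ _)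
  have increase : ∀ᵐ p ∂(S.θ.prod μ), V p.2 ≤ V (S.randomMap p.1 p.2) ∧
      (p.2 < ε → V p.2 < V (S.randomMap p.1 p.2)) := by
    filter_upwards [Measure.quasiMeasurePreserving_fst.ae S.ae_mem_noise,
      Measure.quasiMeasurePreserving_snd.ae hpush, Measure.quasiMeasurePreserving_snd.ae hstay,
      Measure.quasiMeasurePreserving_snd.ae hpos] with p hnoise hpush hstay hpos
    rcases lt_or_ge p.2 ε with hlt | hge
    · have strict : V p.2 < V (S.randomMap p.1 p.2) := by
        simp only [hV]
        rw [min_eq_left hlt.le, max_eq_right hpos.le]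
        exact lt_max_of_lt_right (lt_min (hpush _ hnoise hlt) hlt)
      exact ⟨strict.le, fun _ => strict⟩
    · refine ⟨?_, fun hlt => absurd hlt (not_lt.2 hge)⟩
      simp only [hV]
      rw [min_eq_right hge, min_eq_right (hstay _ hnoise hge)]
  have ge_snd : ∀ᵐ p ∂(S.θ.prod μ), ε ≤ p.2 := by
    filter_upwards [increase,
      hμ.stationarySystem.ae_eq_of_ae_le bddMeasurable_V (increase.mono fun _ h => h.1)]
      with p hincrease hinvariant
    by_contra! hlt
    exact (hincrease.2 hlt).ne hinvariant
  rw [← measurePreserving_snd (μ := S.θ) (ν := μ) |>.map_eq,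
    ae_map_iff measurable_snd.aemeasurable measurableSet_Ici]
  exact ge_snd

end IsStationary

/-- All noises map the compact interval `[b, e] ⊆ (0, 1)` into itself. -/
structure InvariantInterval (S : RandomSystem) (b e : ℝ) : Prop where
  left_pos : 0 < b
  le : b ≤ e
  right_lt : e < 1
  invariant : ∀ x ∈ Icc b e, b ≤ S.T x - S.a * S.σ x ∧ S.T x + S.a * S.σ x ≤ e

section FixedOrigin

variable {ε : ℝ}

lemma invariantInterval_of_pushed (hε : 0 < ε)
    (hlow : ∀ x ∈ Ioo 0 ε, x < S.T x - S.a * S.σ x)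
    (hhigh : ∀ x ∈ Ioo ε (1 - gap S.T S.c / 2), ε < S.T x - S.a * S.σ x) :
    S.InvariantInterval ε (1 - gap S.T S.c / 2) := by
  have gap_pos := S.gap_pos
  have gap_le_one := S.gap_le_one
  have ε_lt : ε < 1 - gap S.T S.c / 2 := by
    by_contra! hcon
    have mem_space : 1 - 3 * gap S.T S.c / 4 ∈ S.space :=
      S.mem_space_of_mem_Ioc ⟨by linarith, by linarith⟩
    have noise_nonneg := mul_nonneg S.a_pos.le (S.noise_assumption.nonneg _ mem_space)
    linarith [hlow (1 - 3 * gap S.T S.c / 4) ⟨by linarith, by linarith⟩,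
      S.map_le_of_mem mem_space]
  refine ⟨hε, ε_lt.le, by linarith, fun x hx => ⟨?_, ?_⟩⟩
  · have continuousOn := S.continuousOn_lower (e := 1 - gap S.T S.c / 2) hε (by linarith)
    rw [← closure_Ioo ε_lt.ne] at continuousOn hx
    exact le_on_closure (fun y hy => (hhigh y hy).le) continuousOn_const continuousOn hx
  · exact S.upper_le (S.mem_space_of_mem_Ioc ⟨hε.trans_le hx.1, hx.2⟩)

lemma InvariantInterval.ae_mem_of_pushed [IsProbabilityMeasure μ]
    (I : S.InvariantInterval ε (1 - gap S.T S.c / 2)) (hμ : S.IsStationary μ)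
    (hac : μ ≪ volume.restrict S.space) (hlow : ∀ x ∈ Ioo 0 ε, x < S.T x - S.a * S.σ x) :
    ∀ᵐ x ∂μ, x ∈ Icc ε (1 - gap S.T S.c / 2) := by
  have hpos := hμ.ae_pos hac
  have hge := hμ.ae_ge_of_pushed I.left_pos.le ?_ ?_ hpos
  · filter_upwards [hge, hμ.ae_le hac] with x hge hle using ⟨hge, hle⟩
  · filter_upwards [hpos, S.ae_mem_space hac] with x hpos hx η hη hlt
    exact (hlow x ⟨hpos, hlt⟩).trans_le (S.randomMap_mem hx hη).1
  · filter_upwards [hμ.ae_le hac, S.ae_mem_space hac] with x hle hx η hη hge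
    exact (I.invariant x ⟨hge, hle⟩).1.trans (S.randomMap_mem hx hη).1

end FixedOrigin

section RepellingOrigin

variable (hT0 : 0 < S.T 0) (hnoise : ∀ x ∈ S.space, S.a * S.σ x ≤ S.T 0 / 2)

include hT0 hnoise

/-- Near `0` continuity of `T` gives the bound; elsewhere the lower bound is attained on a compact
interval. -/
lemma exists_pos_le_lower : ∃ b, 0 < b ∧ b ≤ 1 - gap S.T S.c / 2 ∧
    ∀ x ∈ Ioc 0 (1 - gap S.T S.c / 2), b ≤ S.T x - S.a * S.σ x := by
  have gap_pos := S.gap_pos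
  have gap_le_one := S.gap_le_one
  obtain ⟨δ, hδ, near_zero⟩ := Metric.continuousWithinAt_iff.1
    (S.map_assumption.continuousOn 0 ⟨le_rfl, zero_le_one⟩) (S.T 0 / 4) (by linarith)
  set δ' := min δ (1 - gap S.T S.c / 2)
  have δ'_pos : 0 < δ' := lt_min hδ (by linarith)
  obtain ⟨y, hy, hmin⟩ := (isCompact_Icc (a := δ') (b := 1 - gap S.T S.c / 2)).exists_isMinOn
    ⟨δ', le_rfl, min_le_right _ _⟩ (S.continuousOn_lower δ'_pos (by linarith))
  have lower_pos := S.noise_assumption.lower_pos y ⟨δ'_pos.trans_le hy.1, hy.2⟩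
  refine ⟨min (S.T y - S.a * S.σ y) (min (S.T 0 / 4) (1 - gap S.T S.c / 2)),
    lt_min lower_pos (lt_min (by linarith) (by linarith)),
    (min_le_right _ _).trans (min_le_right _ _), fun x hx => ?_⟩
  rcases le_or_gt δ' x with hge | hlt
  · exact (min_le_left _ _).trans (hmin ⟨hge, hx.2⟩)
  · have map_close := near_zero (x := x) ⟨hx.1.le, by linarith [hx.2]⟩ (by
      rw [Real.dist_eq, sub_zero, abs_of_pos hx.1]
      exact hlt.trans_le (min_le_left _ _))
    rw [Real.dist_eq, abs_lt] at map_close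
    have quarter_le : S.T 0 / 4 ≤ S.T x - S.a * S.σ x := by
      linarith [map_close.1, hnoise x (S.mem_space_of_mem_Ioc hx)]
    exact ((min_le_right _ _).trans (min_le_left _ _)).trans quarter_le

lemma IsStationary.exists_invariantInterval_of_map_zero_pos [IsProbabilityMeasure μ]
    (hμ : S.IsStationary μ) (hac : μ ≪ volume.restrict S.space) :
    ∃ b e : ℝ, S.InvariantInterval b e ∧ ∀ᵐ x ∂μ, x ∈ Icc b e := by
  obtain ⟨b, hb, hbe, le_lower⟩ := exists_pos_le_lower hT0 hnoise
  refine ⟨b, 1 - gap S.T S.c / 2, ⟨hb, hbe, by linarith [S.gap_pos], fun x hx => ?_⟩,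
    hμ.ae_of_step measurableSet_Icc ?_⟩
  · have mem_Ioc : x ∈ Ioc 0 (1 - gap S.T S.c / 2) := ⟨hb.trans_le hx.1, hx.2⟩
    exact ⟨le_lower x mem_Ioc, S.upper_le (S.mem_space_of_mem_Ioc mem_Ioc)⟩
  · filter_upwards [S.ae_mem_space hac, hμ.ae_le hac, hμ.ae_pos hac] with x hx hle hpos η hη
    have step_mem := S.randomMap_mem hx hη
    exact ⟨(le_lower x ⟨hpos, hle⟩).trans step_mem.1, step_mem.2.trans (S.upper_le hx)⟩

end RepellingOrigin

theorem IsStationary.exists_invariantInterval [IsProbabilityMeasure μ] (hμ : S.IsStationary μ)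
    (hac : μ ≪ volume.restrict S.space) :
    ∃ b e : ℝ, S.InvariantInterval b e ∧ ∀ᵐ x ∂μ, x ∈ Icc b e := by
  rcases S.noise_assumption.cases with ⟨-, -, -, ε, hε, hlow, hhigh⟩ | ⟨hT0, hnoise⟩
  · have I := invariantInterval_of_pushed hε hlow hhigh
    exact ⟨ε, _, I, I.ae_mem_of_pushed hμ hac hlow⟩
  · exact hμ.exists_invariantInterval_of_map_zero_pos hT0
      (fun x hx => (hnoise x hx).trans ((min_le_right _ _).trans (min_le_left _ _))) hac

end RandomSystem

/-! ### Limit theorems for bounded observables -/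

lemma exists_bddMeasurable_of_memLp_top {X : Type*} [MeasurableSpace X] {μ : Measure X} {g : X → ℝ}
    (hg : MemLp g ⊤ μ) : ∃ f : X → ℝ, BddMeasurable f ∧ f =ᵐ[μ] g := by
  set B := lpNorm g ⊤ μ
  have measurable_mk := hg.aestronglyMeasurable.stronglyMeasurable_mk.measurable
  have B_nonneg : 0 ≤ B := lpNorm_nonneg
  refine ⟨fun x => max (-B) (min (hg.aestronglyMeasurable.mk g x) B),
    ⟨measurable_const.max (measurable_mk.min measurable_const), B, fun x => ?_⟩, ?_⟩
  · exact abs_le.2 ⟨le_max_left _ _, max_le (by linarith) (min_le_right _ _)⟩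
  · filter_upwards [hg.aestronglyMeasurable.ae_eq_mk, ae_le_lpNorm_exponent_top hg] with x hmk hB
    obtain ⟨hlow, hhigh⟩ := abs_le.1 hB
    rw [← hmk, min_eq_left hhigh, max_eq_right hlow]

namespace StationarySystem

open BoundedMeasurable

variable {X Y : Type*} [MeasurableSpace X] [MeasurableSpace Y] {F G : Y → X → X} {θ : Measure Y}
  {μ : Measure X} [IsProbabilityMeasure θ] [IsProbabilityMeasure μ] {f g : X → ℝ}

lemma measurePreserving_noise_randomOrbit (H : StationarySystem F θ μ) (k : ℕ) :
    MeasurePreserving (fun p : (ℕ → Y) × X => (p.1 k, randomOrbit F p.1 p.2 k)) (path θ μ)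
      (θ.prod μ) := by
  have measurable_pair (k : ℕ) :
      Measurable fun p : (ℕ → Y) × X => (p.1 k, randomOrbit F p.1 p.2 k) :=
    ((measurable_pi_apply k).comp measurable_fst).prodMk (measurable_randomOrbit H.measurable k)
  induction k with
  | zero => exact (measurePreserving_eval_infinitePi (fun _ : ℕ => θ) 0).prod (.id μ)
  | succ k ih =>
    exact (ih.comp H.measurePreserving_pathShift).congr (measurable_pair (k + 1))
      (.of_forall fun p => Prod.ext rfl (randomOrbit_pathShift F p k))

lemma randomSum_ae_eq (H : StationarySystem F θ μ)
    (hFG : ∀ᵐ q ∂(θ.prod μ), F q.1 q.2 = G q.1 q.2) (hfg : f =ᵐ[μ] g) (t : ℕ) :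
    randomSum F f t =ᵐ[path θ μ] randomSum G g t := by
  have maps_eq : ∀ᵐ p ∂(path θ μ), ∀ k,
      F (p.1 k) (randomOrbit F p.1 p.2 k) = G (p.1 k) (randomOrbit F p.1 p.2 k) :=
    ae_all_iff.2 fun k =>
      (H.measurePreserving_noise_randomOrbit k).quasiMeasurePreserving.ae hFG
  have values_eq : ∀ᵐ p ∂(path θ μ), ∀ k,
      f (randomOrbit F p.1 p.2 k) = g (randomOrbit F p.1 p.2 k) :=
    ae_all_iff.2 fun k => (H.measurePreserving_randomOrbit k).quasiMeasurePreserving.ae hfg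
  filter_upwards [maps_eq, values_eq] with p hmaps hvalues
  have orbit_eq (k : ℕ) : randomOrbit F p.1 p.2 k = randomOrbit G p.1 p.2 k := by
    induction k with
    | zero => rfl
    | succ k ih => rw [randomOrbit, randomOrbit, hmaps, ih]
  exact Finset.sum_congr rfl fun k _ => by rw [hvalues, orbit_eq]

lemma averageOp_ae_eq (H : StationarySystem F θ μ)
    (hFG : ∀ᵐ q ∂(θ.prod μ), F q.1 q.2 = G q.1 q.2) (hfg : f =ᵐ[μ] g) :
    averageOp F θ f =ᵐ[μ] averageOp G θ g := by
  have values_eq : ∀ᵐ q ∂(θ.prod μ), f (F q.1 q.2) = g (G q.1 q.2) := by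
    filter_upwards [hFG, H.quasiMeasurePreserving.ae hfg] with q hmap hvalue
    rw [hvalue, hmap]
  filter_upwards [Measure.ae_ae_of_ae_prod
    (Measure.measurePreserving_swap.quasiMeasurePreserving.ae values_eq)] with x hx
  exact integral_congr_ae hx

lemma averageOp_iterate_ae_eq (H : StationarySystem F θ μ)
    (hFG : ∀ᵐ q ∂(θ.prod μ), F q.1 q.2 = G q.1 q.2) (hfg : f =ᵐ[μ] g) (t : ℕ) :
    (averageOp F θ)^[t] f =ᵐ[μ] (averageOp G θ)^[t] g := by
  induction t with
  | zero => exact hfg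
  | succ t ih =>
    rw [Function.iterate_succ_apply', Function.iterate_succ_apply']
    exact H.averageOp_ae_eq hFG ih

/-- The conclusions see the random map only up to null sets, so `F` may be a more regular version of
`G`. -/
theorem exists_variance_quasiPower (H : StationarySystem F θ μ) {C ρ : ℝ}
    (hgap : SpectralGap (averageCLM (transitionKernel θ H.measurable)) (integralCLM μ)
      (BoundedMeasurable.one X) C ρ)
    (hFG : ∀ᵐ q ∂(θ.prod μ), F q.1 q.2 = G q.1 q.2) (hg : MemLp g ⊤ μ) (hg0 : ∫ x, g x ∂μ = 0) :
    ∃ v : ℝ, (∀ t, Integrable (fun p => randomSum G g t p ^ 2) (path θ μ)) ∧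
      (∀ t, Integrable (fun x => g x * (averageOp G θ)^[t] g x) μ) ∧
      Tendsto (fun t : ℕ => (1 / (t : ℝ)) * ∫ p, randomSum G g t p ^ 2 ∂(path θ μ)) atTop (𝓝 v) ∧
      (Summable fun t : ℕ => ∫ x, g x * (averageOp G θ)^[t + 1] g x ∂μ) ∧
      v = ∫ x, g x ^ 2 ∂μ + 2 * ∑' t : ℕ, ∫ x, g x * (averageOp G θ)^[t + 1] g x ∂μ ∧
      ∃ (ℓ : ℂ → ℂ) (δ K : ℝ), QuasiPower (path θ μ) (randomSum G g) ℓ δ K := by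
  obtain ⟨f, hf, hfg⟩ := exists_bddMeasurable_of_memLp_top hg
  have hf0 : ∫ x, f x ∂μ = 0 := by rw [integral_congr_ae hfg, hg0]
  have sum_eq := H.randomSum_ae_eq hFG hfg
  have sum_sq_eq (t : ℕ) := (sum_eq t).fun_comp (· ^ 2)
  have correlation_eq (t : ℕ) := hfg.fun_mul (H.averageOp_iterate_ae_eq hFG hfg t)
  have integral_sum_sq_eq (t : ℕ) := integral_congr_ae (sum_sq_eq t)
  have integral_correlation_eq (t : ℕ) := integral_congr_ae (correlation_eq t)
  have integral_sq_eq := integral_congr_ae (hfg.fun_comp (· ^ 2))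
  have summable_correlations := H.summable_correlations hgap hf hf0
  have tendsto_variance := H.tendsto_variance hf summable_correlations
  obtain ⟨ℓ, δ, K, Q⟩ := H.exists_quasiPower hgap hf hf0
  simp only [Function.comp_apply] at integral_sum_sq_eq integral_sq_eq
  simp only [integral_correlation_eq, integral_sum_sq_eq, integral_sq_eq]
    at summable_correlations tendsto_variance
  exact ⟨_, fun t => ((hf.randomSum H.measurable t).pow_two.integrable _).congr (sum_sq_eq t),
    fun t => ((hf.mul (hf.averageOp_iterate H.measurable t)).integrable _).congr (correlation_eq t),
    tendsto_variance, summable_correlations, rfl, ℓ, δ, K, Q.congr_ae sum_eq⟩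

end StationarySystem

lemma gaussianReal_real_Iic {ι : ℝ} (hι : 0 < ι) (r : ℝ) :
    (gaussianReal 0 (Real.toNNReal (ι ^ 2))).real (Iic r) =
      1 / (ι * √(2 * Real.pi)) * ∫ u in Iic r, Real.exp (-u ^ 2 / (2 * ι ^ 2)) := by
  rw [gaussianReal_real_Iic_eq_integral 0 (Real.toNNReal_pos.2 (by positivity)).ne']
  simp only [gaussianPDFReal_def, sub_zero]
  rw [integral_const_mul, Real.coe_toNNReal _ (sq_nonneg ι), one_div,
    Real.sqrt_mul (by positivity), Real.sqrt_sq hι.le, mul_comm ι]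

/-! ### The clamped system -/

namespace RandomSystem

variable {S : RandomSystem} {b e : ℝ}

/-- The random map with its argument clamped to `[b, e]`; unlike the random map itself it is
continuous on the whole line when `[b, e]` is invariant. -/
def clampedMap (S : RandomSystem) (hbe : b ≤ e) (η x : ℝ) : ℝ :=
  S.randomMap η (projIcc b e hbe x)

lemma clampedMap_of_mem (hbe : b ≤ e) (η : ℝ) {x : ℝ} (hx : x ∈ Icc b e) :
    S.clampedMap hbe η x = S.randomMap η x := by
  rw [clampedMap, projIcc_of_mem hbe hx]

namespace InvariantInterval

open BoundedMeasurable

lemma subset_Ioo (I : S.InvariantInterval b e) : Icc b e ⊆ Ioo 0 1 :=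
  Icc_subset_Ioo I.left_pos I.right_lt

lemma noiseInterval_subset (I : S.InvariantInterval b e) {x : ℝ} (hx : x ∈ Icc b e) :
    noiseInterval S.T S.σ S.a x ⊆ Icc b e := fun _ hy =>
  ⟨(I.invariant x hx).1.trans hy.1.le, hy.2.le.trans (I.invariant x hx).2⟩

lemma continuousOn_noise (I : S.InvariantInterval b e) : ContinuousOn S.σ (Icc b e) :=
  S.noise_assumption.differentiableOn.continuousOn.mono I.subset_Ioo

lemma continuous_map_projIcc (I : S.InvariantInterval b e) :
    Continuous fun x => S.T (projIcc b e I.le x) :=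
  (S.map_assumption.continuousOn.mono (I.subset_Ioo.trans Ioo_subset_Icc_self)).comp_continuous
    (continuous_subtype_val.comp continuous_projIcc) fun x => (projIcc b e I.le x).2

lemma continuous_clampedMap (I : S.InvariantInterval b e) :
    Continuous fun p : ℝ × ℝ => S.clampedMap I.le p.1 p.2 :=
  continuous_noisyMap I.continuous_map_projIcc <| I.continuousOn_noise.comp_continuous
    (continuous_subtype_val.comp continuous_projIcc) fun x => (projIcc b e I.le x).2

lemma clampedMap_ae_eq (I : S.InvariantInterval b e) {μ : Measure ℝ}
    (hI : ∀ᵐ x ∂μ, x ∈ Icc b e) :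
    ∀ᵐ p ∂(S.θ.prod μ), S.clampedMap I.le p.1 p.2 = S.randomMap p.1 p.2 :=
  (Measure.quasiMeasurePreserving_snd.ae hI).mono fun p => clampedMap_of_mem I.le p.1

lemma stationarySystem (I : S.InvariantInterval b e) {μ : Measure ℝ} [SFinite μ]
    (hμ : S.IsStationary μ) (hI : ∀ᵐ x ∂μ, x ∈ Icc b e) :
    StationarySystem (S.clampedMap I.le) S.θ μ :=
  hμ.stationarySystem.congr I.continuous_clampedMap.measurable
    ((I.clampedMap_ae_eq hI).mono fun _ => Eq.symm)

lemma exists_pos_le_noise (I : S.InvariantInterval b e) : ∃ s > 0, ∀ x ∈ Icc b e, s ≤ S.σ x := by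
  obtain ⟨y, hy, hmin⟩ :=
    isCompact_Icc.exists_isMinOn ⟨b, left_mem_Icc.2 I.le⟩ I.continuousOn_noise
  exact ⟨S.σ y, S.noise_assumption.pos y (I.subset_Ioo hy), fun x hx => hmin hx⟩

lemma isTransitiveAttractor (I : S.InvariantInterval b e) :
    IsTransitiveAttractor (fun x => S.T (projIcc b e I.le x)) (Icc b e) S.d₁ S.d₂ := by
  have M := S.map_assumption
  obtain ⟨s, hs, s_le⟩ := I.exists_pos_le_noise
  have A : IsTransitiveAttractor S.T (Icc b e) S.d₁ S.d₂ :=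
    ⟨M.d_lt, M.core_invariant,
      by simpa only [Function.iterate_one] using M.core_transitive 1 le_rfl,
      ae_restrict_of_ae_restrict_of_subset (I.subset_Ioo.trans Ioo_subset_Icc_self)
        M.core_attracting⟩
  refine A.congr (fun x hx => by rw [projIcc_of_mem I.le hx]) measurableSet_Icc ?_ ?_
  · exact mapsTo_of_noiseInterval_subset S.a_pos (fun x hx => hs.trans_le (s_le x hx))
      fun x => I.noiseInterval_subset
  · exact A.subset_of_isClosed S.a_pos hs s_le (fun x => I.noiseInterval_subset) isClosed_Icc
      (nonempty_Icc.2 I.le)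

lemma exists_minorization (I : S.InvariantInterval b e) :
    ∃ N > 0, ∃ ν : Measure ℝ, ν ≠ 0 ∧
      ∀ x, ν ≤ (transitionKernel S.θ I.continuous_clampedMap.measurable ^ N) x := by
  obtain ⟨s, hs, s_le⟩ := I.exists_pos_le_noise
  obtain ⟨s', le_s'⟩ := isCompact_Icc.bddAbove_image I.continuousOn_noise
  obtain ⟨m, hm, density_ge⟩ := S.exists_noise_minorization
  have proj_mem (x : ℝ) := (projIcc b e I.le x).2
  exact I.isTransitiveAttractor.exists_minorization
    (σ := fun x => S.σ (projIcc b e I.le x)) I.continuous_map_projIcc I.continuous_clampedMap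
    S.a_pos hs (fun x => s_le _ (proj_mem x)) (fun x => le_s' (mem_image_of_mem _ (proj_mem x)))
    isCompact_Icc (fun x => I.noiseInterval_subset (proj_mem x)) S.ae_mem_noise
    S.noise_nhds_ne_zero (half_pos S.a_pos) hm density_ge

lemma exists_spectralGap (I : S.InvariantInterval b e) {μ : Measure ℝ} [IsProbabilityMeasure μ]
    (H : StationarySystem (S.clampedMap I.le) S.θ μ) :
    ∃ C ρ : ℝ, SpectralGap (averageCLM (transitionKernel S.θ H.measurable)) (integralCLM μ)
      (BoundedMeasurable.one ℝ) C ρ := by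
  obtain ⟨N, hN, ν, hν0, hν⟩ := I.exists_minorization
  exact exists_spectralGap_of_minorization H.invariant_transitionKernel hN hν0 hν

end InvariantInterval

lemma orbit_eq_randomOrbit (ω : ℕ → ℝ) (x : ℝ) (k : ℕ) :
    S.orbit ω x k = randomOrbit S.randomMap ω x k := by
  induction k with
  | zero => rfl
  | succ k ih => rw [orbit, randomOrbit, ih]

lemma birkhoff_eq_randomSum (g : ℝ → ℝ) : S.birkhoff g = randomSum S.randomMap g := by
  ext t p
  simp only [birkhoff, randomSum, orbit_eq_randomOrbit]

theorem IsStationary.exists_variance_quasiPower {μ : Measure ℝ} [IsProbabilityMeasure μ]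
    (hμ : S.IsStationary μ) (hac : μ ≪ volume.restrict S.space) {g : ℝ → ℝ} (hg : MemLp g ⊤ μ)
    (hg0 : ∫ x, g x ∂μ = 0) :
    ∃ v : ℝ, (∀ t, Integrable (fun p => S.birkhoff g t p ^ 2) (S.pathMeasure μ)) ∧
      (∀ t, Integrable (fun x => g x * S.adjointOp^[t] g x) μ) ∧
      Tendsto (fun t : ℕ => (1 / (t : ℝ)) * ∫ p, S.birkhoff g t p ^ 2 ∂(S.pathMeasure μ)) atTop
        (𝓝 v) ∧
      (Summable fun t : ℕ => ∫ x, g x * S.adjointOp^[t + 1] g x ∂μ) ∧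
      v = ∫ x, g x ^ 2 ∂μ + 2 * ∑' t : ℕ, ∫ x, g x * S.adjointOp^[t + 1] g x ∂μ ∧
      ∃ (ℓ : ℂ → ℂ) (δ K : ℝ), QuasiPower (S.pathMeasure μ) (S.birkhoff g) ℓ δ K := by
  obtain ⟨b, e, I, hI⟩ := hμ.exists_invariantInterval hac
  have H := I.stationarySystem hμ hI
  obtain ⟨C, ρ, hgap⟩ := I.exists_spectralGap H
  rw [birkhoff_eq_randomSum]
  exact H.exists_variance_quasiPower hgap (I.clampedMap_ae_eq hI) hg hg0

end RandomSystem

/-! ### Densities of bounded variation -/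

lemma MemBV.memLp_top {g : ℝ → ℝ} {s : Set ℝ} (hg : MemBV g s) (hs : MeasurableSet s) :
    MemLp g ⊤ (volume.restrict s) := by
  rcases s.eq_empty_or_nonempty with rfl | ⟨x₀, hx₀⟩
  · rw [Measure.restrict_empty]
    exact memLp_measure_zero
  obtain ⟨u, hug, hu⟩ : ∃ u : ℝ → ℝ, u =ᵐ[volume.restrict s] g ∧ eVariationOn u s < ⊤ := by
    have := hg.variation_ne_top.lt_top
    simpa only [essVariationOn, iInf_lt_iff, exists_prop] using this
  refine memLp_top_of_bound hg.integrableOn.aestronglyMeasurable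
    ((eVariationOn u s).toReal + |u x₀|) ?_
  filter_upwards [hug, ae_restrict_mem hs] with x hx hxs
  have edist_le := eVariationOn.edist_le u hxs hx₀
  rw [edist_dist, ENNReal.ofReal_le_iff_le_toReal hu.ne, Real.dist_eq] at edist_le
  rw [← hx, Real.norm_eq_abs]
  linarith [abs_sub_abs_le_abs_sub (u x) (u x₀)]

namespace RandomSystem.HasBVDensity

variable {S : RandomSystem} {μ : Measure ℝ} {h : ℝ → ℝ}

lemma absolutelyContinuous (hh : S.HasBVDensity μ h) : μ ≪ volume.restrict S.space := by
  rw [hh.eq_withDensity]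
  exact withDensity_absolutelyContinuous _ _

lemma one_le_bvNorm [IsProbabilityMeasure μ] (hh : S.HasBVDensity μ h) : 1 ≤ bvNorm h S.space := by
  have mass : μ univ = 1 := measure_univ
  rw [hh.eq_withDensity, withDensity_apply _ MeasurableSet.univ, Measure.restrict_univ,
    ← ofReal_integral_eq_lintegral_ofReal hh.memBV.integrableOn
      (Eventually.of_forall hh.nonneg), ENNReal.ofReal_eq_one] at mass
  calc 1 = ∫ x in S.space, |h x| := by simp only [abs_of_nonneg (hh.nonneg _), mass]
    _ ≤ bvNorm h S.space := le_add_of_nonneg_left ENNReal.toReal_nonneg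

lemma memLp_top (hh : S.HasBVDensity μ h) {g : ℝ → ℝ} (hg : MemBV g S.space) : MemLp g ⊤ μ := by
  have memLp_volume := hg.memLp_top measurableSet_Icc
  refine ⟨memLp_volume.aestronglyMeasurable.mono_ac hh.absolutelyContinuous, ?_⟩
  exact (eLpNormEssSup_mono_measure g hh.absolutelyContinuous).trans_lt memLp_volume.2

end RandomSystem.HasBVDensity

end

theorem mainTheorem5_general (S : RandomSystem)
    (μ : Measure ℝ) [IsProbabilityMeasure μ] (hμ : S.IsStationary μ)
    (hac : μ ≪ volume.restrict S.space) (g : ℝ → ℝ) (hg : MemLp g ⊤ μ) (hg0 : ∫ x, g x ∂μ = 0) :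
    ∃ ι : ℝ, 0 ≤ ι ∧
      (∀ t : ℕ, Integrable (fun p => S.birkhoff g t p ^ 2) (S.pathMeasure μ)) ∧
      (∀ t : ℕ, Integrable (fun x => g x * (S.adjointOp)^[t] g x) μ) ∧
      Tendsto (fun t : ℕ => (1 / (t : ℝ)) * ∫ p, S.birkhoff g t p ^ 2 ∂(S.pathMeasure μ))
        atTop (𝓝 (ι ^ 2)) ∧
      Summable (fun t : ℕ => ∫ x, g x * (S.adjointOp)^[t + 1] g x ∂μ) ∧
      ι ^ 2 = ∫ x, g x ^ 2 ∂μ + 2 * ∑' t : ℕ, ∫ x, g x * (S.adjointOp)^[t + 1] g x ∂μ ∧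
      (0 < ι →
        TendstoInDistribution (fun (t : ℕ) p => S.birkhoff g t p / √(t : ℝ)) atTop
          (id : ℝ → ℝ) (fun _ => S.pathMeasure μ) (gaussianReal 0 (Real.toNNReal (ι ^ 2))) ∧
        (∃ R : ℝ → ℝ, (∀ x, 0 ≤ R x) ∧ Continuous R ∧ StrictConvexOn ℝ univ R ∧
          (∀ x, R x = 0 ↔ x = 0) ∧
          ∃ ε₀ : ℝ, 0 < ε₀ ∧ ∀ ε : ℝ, 0 < ε → ε < ε₀ →
            Tendsto (fun t : ℕ => (1 / (t : ℝ)) *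
                Real.log ((S.pathMeasure μ).real {p | (t : ℝ) * ε < S.birkhoff g t p}))
              atTop (𝓝 (-R ε))) ∧
        (∃ D : ℝ, 0 < D ∧ ∀ t : ℕ, 1 ≤ t → ∀ r : ℝ,
          |(S.pathMeasure μ).real {p | S.birkhoff g t p / √(t : ℝ) ≤ r} -
              1 / (ι * √(2 * Real.pi)) * ∫ u in Iic r, Real.exp (-u ^ 2 / (2 * ι ^ 2))|
            ≤ D / √(t : ℝ))) := by
  obtain ⟨v, hS, hcorr, hvar, hsum, hv, ℓ, δ, K, Q⟩ := hμ.exists_variance_quasiPower hac hg hg0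
  have v_nonneg : 0 ≤ v :=
    ge_of_tendsto' hvar fun t => mul_nonneg (by positivity) (integral_nonneg fun p => sq_nonneg _)
  obtain ⟨ι, hι, rfl⟩ : ∃ ι : ℝ, 0 ≤ ι ∧ ι ^ 2 = v :=
    ⟨√v, Real.sqrt_nonneg v, Real.sq_sqrt v_nonneg⟩
  refine ⟨ι, hι, hS, hcorr, hvar, hsum, hv, fun ι_pos => ?_⟩
  have variance_pos : 0 < ι ^ 2 := by positivity
  have second_deriv := Q.deriv_deriv_zero hvar
  refine ⟨Q.tendstoInDistribution variance_pos second_deriv,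
    Q.large_deviations variance_pos second_deriv, ?_⟩
  simpa only [gaussianReal_real_Iic ι_pos] using Q.berry_esseen variance_pos second_deriv

theorem mainTheorem5 (S : RandomSystem)
    (μ : MeasureTheory.Measure ℝ) [MeasureTheory.IsProbabilityMeasure μ]
    (hμ : S.IsStationary μ) (h : ℝ → ℝ) (hh : S.HasBVDensity μ h)
    (g : ℝ → ℝ) (hg : MemBV g S.space) (hg0 : ∫ x, g x ∂μ = 0) :
    ∃ ι : ℝ, 0 ≤ ι ∧
      -- asymptotic variance and Green–Kubo formula
      (∀ t : ℕ, Integrable (fun p => S.birkhoff g t p ^ 2) (S.pathMeasure μ)) ∧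
      (∀ t : ℕ, Integrable (fun x => g x * (S.adjointOp)^[t] g x) μ) ∧
      Tendsto (fun t : ℕ => (1 / (t : ℝ)) * ∫ p, S.birkhoff g t p ^ 2 ∂(S.pathMeasure μ))
        atTop (𝓝 (ι ^ 2)) ∧
      Summable (fun t : ℕ => ∫ x, g x * (S.adjointOp)^[t + 1] g x ∂μ) ∧
      ι ^ 2 = ∫ x, g x ^ 2 ∂μ + 2 * ∑' t : ℕ, ∫ x, g x * (S.adjointOp)^[t + 1] g x ∂μ ∧
      (0 < ι →
        -- central limit theorem
        TendstoInDistribution (fun (t : ℕ) p => S.birkhoff g t p / √(t : ℝ)) atTop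
          (id : ℝ → ℝ) (fun _ => S.pathMeasure μ) (gaussianReal 0 (Real.toNNReal (ι ^ 2))) ∧
        -- large deviation principle
        (∃ R : ℝ → ℝ, (∀ x, 0 ≤ R x) ∧ Continuous R ∧ StrictConvexOn ℝ univ R ∧
          (∀ x, R x = 0 ↔ x = 0) ∧
          ∃ ε₀ : ℝ, 0 < ε₀ ∧ ∀ ε : ℝ, 0 < ε → ε < ε₀ →
            Tendsto (fun t : ℕ => (1 / (t : ℝ)) *
                Real.log ((S.pathMeasure μ).real {p | (t : ℝ) * ε < S.birkhoff g t p}))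
              atTop (𝓝 (-R ε))) ∧
        -- Berry–Esseen inequality
        (∃ D : ℝ, 0 < D ∧ ∀ t : ℕ, 1 ≤ t → ∀ r : ℝ,
          |(S.pathMeasure μ).real {p | S.birkhoff g t p / √(t : ℝ) ≤ r} -
              1 / (ι * √(2 * Real.pi)) * ∫ u in Iic r, Real.exp (-u ^ 2 / (2 * ι ^ 2))|
            ≤ D * bvNorm h S.space / √(t : ℝ))) := by
  obtain ⟨ι, hι, hS, hcorr, hvar, hsum, hv, limit_theorems⟩ :=
    mainTheorem5_general S μ hμ hh.absolutelyContinuous g (hh.memLp_top hg) hg0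
  refine ⟨ι, hι, hS, hcorr, hvar, hsum, hv, fun ι_pos => ?_⟩
  obtain ⟨clt, ldp, D, hD, berry_esseen⟩ := limit_theorems ι_pos
  refine ⟨clt, ldp, D, hD, fun t ht r => (berry_esseen t ht r).trans ?_⟩
  gcongr
  exact le_mul_of_one_le_right hD.le hh.one_le_bvNorm
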